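/- Let $g\ge 1$. A real principally polarized abelian variety of dimension $g$ is a triple $(\mathfrak A,E,S)$, where $\mathfrak A=\mathbb C^g/L$ ($L$ a lattice), $E$ is a principal polarization on $\mathfrak A$, and $S$ is an anti-holomorphic involution of $\mathfrak A$ with $S(0)=0$ and $E(S_*a,S_*b)=-E(a,b)$ for $a,b\in H_1(\mathfrak A,\mathbb Z)=L$. A real isomorphism $(\mathbb C^g/L,E,S)\cong(\mathbb C^g/L',E',S')$ is a $\mathbb C$-linear automorphism $\varphi$ of $\mathbb C^g$ with $\varphi(L)=L'$, $\varphi_*E=E'$, $\varphi\circ S\circ\varphi^{-1}=S'$. Let $\mathcal P_g$ be the cone of positive definite symmetric real $g\times g$ matrices, and $$\mathscr H_g=\{\Omega=X+iY:\ {}^t\Omega=\Omega,\ Y\in\mathcal P_g,\ 2X\in\mathbb Z^{(g,g)}\},$$ $$\Gamma_g^\star=\left\{\begin{pmatrix}A&B\\0&{}^tA^{-1}\end{pmatrix}\in\Gamma_g\right\},\qquad \Gamma_g=Sp(g,\mathbb Z),$$ acting on $\mathscr H_g$ by $\gamma\cdot\Omega=A\Omega\,{}^tA+B\,{}^tA$,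 and let $\mathscr X^g_{\mathbb R}=\Gamma_g^\star\backslash\mathscr H_g$ with the quotient topology and the real analytic structure inherited from $\mathscr H_g$ (a function on an open $U\subset\mathscr X^g_{\mathbb R}$ is real analytic if its pullback to $\mathscr H_g$ is; a real analytic map is a continuous map pulling real analytic functions on open sets back to real analytic functions). For $\Omega\in\mathscr H_g$ let $\mathfrak A_\Omega=\mathbb C^g/(\Omega\mathbb Z^g+\mathbb Z^g)$, $E_\Omega(u,v)=\mathrm{Im}\big({}^tu(\mathrm{Im}\,\Omega)^{-1}\bar v\big)$, and let $\sigma_\Omega$ be induced by complex conjugation. Then $[\Omega]\mapsto[(\mathfrak A_\Omega,E_\Omega,\sigma_\Omega)]$ is a bijection from $\mathscr X^g_{\mathbb R}$ onto the set of real isomorphism classes of real principally polarized abelian varieties of dimension $g$, and with this identification the map $$\Sigma:\mathscr X^g_{\mathbb R}\to\mathscr X^g_{\mathbb R},\qquad \Sigma([(\mathfrak A,E,S)])=[(\mathfrak A,E,-S)],$$ is a well-defined real analytic involution, different from the identity. For a pair $(\lambda,i)$ with $0\le\lambda\le g$, $i\in\{0,1\}$, $i=0$ if $\lambda$ is odd,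 and $i=1$ if $\lambda=0$, let $\mathscr X^g_{(\lambda,i)}$ be the set of classes of the $\Omega\in\mathscr H_g$ such that $N=2\,\mathrm{Re}\,\Omega\bmod 2$ has rank $\lambda$ and $\prod_k(1-n_{kk})=i$ in $\mathbb Z/2$. Each such $\mathscr X^g_{(\lambda,i)}$ is a connected component of $\mathscr X^g_{\mathbb R}$ and $\Sigma(\mathscr X^g_{(\lambda,i)})=\mathscr X^g_{(\lambda,i)}$; moreover $\Sigma$ maps every connected component of $\mathscr X_{\mathbb R}^g$ onto itself. Finally, for such a pair let $M\in\mathbb Z^{(g,g)}$ be the standard form $\begin{pmatrix}I_\lambda&0\\0&0\end{pmatrix}$ if $i=0$ and $\begin{pmatrix}H_\lambda&0\\0&0\end{pmatrix}$ if $i=1$, where $H_\lambda$ is the $\lambda\times\lambda$ matrix with ones on the antidiagonal and zeros elsewhere, and put $$\Sigma_M=\begin{pmatrix}-M&I_g\\-(I_g+M^2)&M\end{pmatrix}.$$ Then $\Sigma_M\in\Gamma_g$, and for every $Y\in\mathcal P_g$ the point $\tfrac12M+iY\in\mathscr H_g$ has its class in $\mathscr X^g_{(\lambda,i)}$, $\Sigma$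 maps this class to the class of $\Sigma_M(\tfrac12M+iY)\in\mathscr H_g$, and $$\Sigma_M\left(\tfrac12M+iY\right)=\tfrac12M+i\begin{pmatrix}\tfrac12I_\lambda&0\\0&I_{g-\lambda}\end{pmatrix}Y^{-1}\begin{pmatrix}\tfrac12I_\lambda&0\\0&I_{g-\lambda}\end{pmatrix},$$ where $\begin{pmatrix}A&B\\C&D\end{pmatrix}(\Omega)=(A\Omega+B)(C\Omega+D)^{-1}$. -/

import Mathlib

/-! Real principally polarized abelian varieties, the space `ℋ_g`, the group `Γ_g^⋆`,
and the moduli space `𝒳_ℝ^g = Γ_g^⋆ \ ℋ_g`. -/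

namespace RealModuli

open Matrix Topology ComplexConjugate

noncomputable section

/-! ### Real principally polarized abelian varieties -/

/-- The complex vector space `ℂ^g`. -/
abbrev CVec (g : ℕ) : Type := Fin g → ℂ

/-- The symplectic matrix `J_g = (0 I; -I 0)`. -/
def Jg (g : ℕ) : Matrix (Fin g ⊕ Fin g) (Fin g ⊕ Fin g) ℤ :=
  Matrix.fromBlocks 0 1 (-1) 0

/-- `H(u,v) = E(iu,v) + i E(u,v)`. -/
def hermitianForm {g : ℕ} (E : CVec g →ₗ[ℝ] CVec g →ₗ[ℝ] ℝ) (u v : CVec g) : ℂ :=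
  (E (Complex.I • u) v : ℂ) + Complex.I * (E u v : ℂ)

/-- The (ℝ-linearly extended) form `E` is a polarization on the torus `ℂ^g / L`. -/
structure IsPolarization {g : ℕ} (L : Submodule ℤ (CVec g))
    (E : CVec g →ₗ[ℝ] CVec g →ₗ[ℝ] ℝ) : Prop where
  alternating : ∀ u, E u u = 0
  hermitian : ∀ u v, conj (hermitianForm E u v) = hermitianForm E v u
  posDef : ∀ u, u ≠ 0 → 0 < (hermitianForm E u u).re
  integral : ∀ u ∈ L, ∀ v ∈ L, ∃ n : ℤ, E u v = n

/-- The polarization is represented by `J_g` in a suitable `ℤ`-basis of `L`. -/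
def IsPrincipal {g : ℕ} (L : Submodule ℤ (CVec g))
    (E : CVec g →ₗ[ℝ] CVec g →ₗ[ℝ] ℝ) : Prop :=
  ∃ b : Module.Basis (Fin g ⊕ Fin g) ℤ L,
    ∀ i j, E (b i : CVec g) (b j : CVec g) = (Jg g i j : ℝ)

/-- A self-map of the complex torus `ℂ^g / L` is anti-holomorphic: around every point it lifts
to a map of `ℂ^g` whose complex conjugate is holomorphic. -/
def IsAntiholomorphic {g : ℕ} (L : Submodule ℤ (CVec g)) (S : CVec g ⧸ L → CVec g ⧸ L) : Prop :=
  ∀ v : CVec g, ∃ F : CVec g → CVec g,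
    (∀ᶠ w in 𝓝 v, S (L.mkQ w) = L.mkQ (F w)) ∧
    (∀ᶠ w in 𝓝 v, DifferentiableAt ℂ (fun z => star (F z)) w)

/-- A real structure on the torus `ℂ^g / L`: an anti-holomorphic involution fixing the origin. -/
structure IsRealStructure {g : ℕ} (L : Submodule ℤ (CVec g))
    (S : CVec g ⧸ L → CVec g ⧸ L) : Prop where
  antiholomorphic : IsAntiholomorphic L S
  involutive : Function.Involutive S
  map_zero : S 0 = 0

/-- `F` is the continuous lift of `S` to the universal covering `ℂ^g` that fixes `0`. For
`a ∈ L = H_1(ℂ^g / L, ℤ)` one has `S_*(a) = F(a)`, the end point of the lift, starting at `0`,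
of the image under `S` of the loop `t ↦ t a`. -/
structure IsLift {g : ℕ} (L : Submodule ℤ (CVec g)) (S : CVec g ⧸ L → CVec g ⧸ L)
    (F : CVec g → CVec g) : Prop where
  continuous : Continuous F
  map_zero : F 0 = 0
  mk_eq : ∀ v, S (L.mkQ v) = L.mkQ (F v)

theorem sub_mem_of_mkQ_eq {g : ℕ} {L : Submodule ℤ (CVec g)} {u v : CVec g}
    (h : L.mkQ u = L.mkQ v) : u - v ∈ L := by
  rwa [Submodule.mkQ_apply, Submodule.mkQ_apply, Submodule.Quotient.eq] at h

theorem IsLift.differentiable {g : ℕ} {L : Submodule ℤ (CVec g)} [DiscreteTopology L]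
    {S : CVec g ⧸ L → CVec g ⧸ L} {F : CVec g → CVec g} (hF : IsLift L S F)
    (hS : IsAntiholomorphic L S) : Differentiable ℂ (fun v => star (F v)) := by
  intro v
  obtain ⟨F₀, h1, h2⟩ := hS v
  have hd := h2.self_of_nhds
  have hc₀ : ContinuousAt F₀ v := by
    have := (continuous_star.continuousAt (x := star (F₀ v))).comp
      (f := fun z => star (F₀ z)) hd.continuousAt
    simpa [Function.comp_def] using this
  have hc : ContinuousAt (fun w => (F w - F₀ w) - (F v - F₀ v)) v :=
    (hF.continuous.continuousAt.sub hc₀).sub continuousAt_const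
  have hmem : ∀ᶠ w in 𝓝 v, F w - F₀ w ∈ L := by
    filter_upwards [h1] with w hw
    exact sub_mem_of_mkQ_eq (by rw [← hw, hF.mk_eq])
  obtain ⟨U, hU, hUL⟩ : ∃ U ∈ 𝓝 (0 : CVec g), ∀ x ∈ U, x ∈ L → x = 0 := by
    have h0 : ({0} : Set L) ∈ 𝓝 (0 : L) := by simp
    rw [mem_nhds_subtype] at h0
    obtain ⟨U, hU, hsub⟩ := h0
    refine ⟨U, hU, fun x hx hxL => ?_⟩
    have : (⟨x, hxL⟩ : L) ∈ ({0} : Set L) := hsub hx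
    simpa using congrArg Subtype.val (Set.mem_singleton_iff.1 this)
  have hev : ∀ᶠ w in 𝓝 v, star (F w) = star (F₀ w) + star (F v - F₀ v) := by
    have := hc.preimage_mem_nhds (t := U) (by simpa using hU)
    filter_upwards [this, hmem] with w hw hwL
    have h3 := hUL _ hw (L.sub_mem hwL hmem.self_of_nhds)
    rw [← star_add, ← sub_eq_zero.1 h3]
    simp
  exact (hd.add_const _).congr_of_eventuallyEq hev

theorem IsLift.map_add {g : ℕ} {L : Submodule ℤ (CVec g)} [DiscreteTopology L] [IsZLattice ℝ L]
    {S : CVec g ⧸ L → CVec g ⧸ L} {F : CVec g → CVec g} (hF : IsLift L S F)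
    (hS : IsAntiholomorphic L S) (u v : CVec g) : F (u + v) = F u + F v := by
  have hG := hF.differentiable hS
  have hper : ∀ l ∈ L, ∀ w, F (w + l) = F w + F l := by
    intro l hl w
    have hmem : ∀ w, F (w + l) - F w ∈ L := fun w => by
      apply sub_mem_of_mkQ_eq
      rw [← hF.mk_eq, ← hF.mk_eq, _root_.map_add]
      congr 1
      simpa using hl
    have hcont : Continuous (fun w => (⟨F (w + l) - F w, hmem w⟩ : L)) :=
      Continuous.subtype_mk
        ((hF.continuous.comp (continuous_add_const l)).sub hF.continuous) _
    have := PreconnectedSpace.constant inferInstance hcont (x := w) (y := 0)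
    have h2 := congrArg Subtype.val this
    simp only [zero_add, hF.map_zero, sub_zero] at h2
    rw [← h2]; abel
  have hb : Bornology.IsBounded (Set.range fun w => star (F (w + u)) - star (F w)) := by
    let b := (Module.Free.chooseBasis ℤ L).ofZLatticeBasis ℝ L
    have hspan : Submodule.span ℤ (Set.range b) = L :=
      (Module.Free.chooseBasis ℤ L).ofZLatticeBasis_span ℝ
    have hK : IsCompact (Metric.closedBall (0 : CVec g) (∑ i, ‖b i‖)) :=
      isCompact_closedBall _ _
    have hcont : Continuous fun w => star (F (w + u)) - star (F w) :=
      (hG.continuous.comp (continuous_add_const u)).sub hG.continuous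
    refine (hK.image hcont).isBounded.subset ?_
    rintro _ ⟨w, rfl⟩
    refine ⟨ZSpan.fract b w, by simpa using ZSpan.norm_fract_le b w, ?_⟩
    have hl : ((ZSpan.floor b w : Submodule.span ℤ (Set.range b)) : CVec g) ∈ L :=
      hspan.le (ZSpan.floor b w).2
    have hw : w = ZSpan.fract b w + ((ZSpan.floor b w : _) : CVec g) := by
      rw [ZSpan.fract]; abel
    have e1 := hper _ hl (ZSpan.fract b w)
    have e2 := hper _ hl (ZSpan.fract b w + u)
    rw [← hw] at e1
    rw [add_right_comm, ← hw] at e2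
    simp only [e1, e2, star_add]
    abel
  have hD : Differentiable ℂ fun w => star (F (w + u)) - star (F w) :=
    (hG.comp (differentiable_id.add_const u)).sub hG
  have h := hD.apply_eq_apply_of_bounded hb v 0
  simp only [zero_add, hF.map_zero, star_zero, sub_zero] at h
  rw [← star_sub] at h
  have h' := star_injective h
  rw [add_comm u v, ← h']; abel

/-- The polarization `E` is `S`-real: `E(S_* a, S_* b) = -E(a,b)` on `H_1`. -/
def IsReal {g : ℕ} (L : Submodule ℤ (CVec g)) (E : CVec g →ₗ[ℝ] CVec g →ₗ[ℝ] ℝ)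
    (S : CVec g ⧸ L → CVec g ⧸ L) : Prop :=
  ∃ F : CVec g → CVec g, IsLift L S F ∧ ∀ a ∈ L, ∀ b ∈ L, E (F a) (F b) = -E a b

/-- A real principally polarized abelian variety `(𝔄, E, S)` of dimension `g`, `𝔄 = ℂ^g / L`. -/
structure RealPPAV (g : ℕ) where
  lattice : Submodule ℤ (CVec g)
  [discrete : DiscreteTopology lattice]
  [isZLattice : IsZLattice ℝ lattice]
  /-- the polarization, extended `ℝ`-linearly to `ℂ^g` -/
  pol : CVec g →ₗ[ℝ] CVec g →ₗ[ℝ] ℝ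
  isPolarization : IsPolarization lattice pol
  isPrincipal : IsPrincipal lattice pol
  /-- the real structure `S` on `ℂ^g / L` -/
  real : CVec g ⧸ lattice → CVec g ⧸ lattice
  isRealStructure : IsRealStructure lattice real
  isReal : IsReal lattice pol real

/-- Real isomorphism of triples: a complex linear isomorphism `φ` with `φ(L) = L'`,
`φ_* E = E'` and `φ ∘ S ∘ φ⁻¹ = S'` on the tori. -/
def IsIsomorphic {g : ℕ} (A B : RealPPAV g) : Prop :=
  ∃ φ : CVec g ≃ₗ[ℂ] CVec g,
    (∀ v, φ v ∈ B.lattice ↔ v ∈ A.lattice) ∧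
    (∀ u v, B.pol (φ u) (φ v) = A.pol u v) ∧
    (∀ v w, A.real (A.lattice.mkQ v) = A.lattice.mkQ w →
      B.real (B.lattice.mkQ (φ v)) = B.lattice.mkQ (φ w))

theorem IsIsomorphic.refl {g : ℕ} (A : RealPPAV g) : IsIsomorphic A A :=
  ⟨LinearEquiv.refl ℂ _, fun _ => Iff.rfl, fun _ _ => rfl, fun _ _ h => h⟩

theorem IsIsomorphic.symm {g : ℕ} {A B : RealPPAV g} (h : IsIsomorphic A B) :
    IsIsomorphic B A := by
  obtain ⟨φ, h1, h2, h3⟩ := h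
  refine ⟨φ.symm, fun v => ?_, fun u v => ?_, fun v w hvw => ?_⟩
  · rw [← h1, LinearEquiv.apply_symm_apply]
  · rw [← h2, LinearEquiv.apply_symm_apply, LinearEquiv.apply_symm_apply]
  · obtain ⟨w', hw'⟩ := A.lattice.mkQ_surjective (A.real (A.lattice.mkQ (φ.symm v)))
    have h4 := h3 _ _ hw'.symm
    rw [LinearEquiv.apply_symm_apply, hvw] at h4
    rw [← hw']
    simp only [Submodule.mkQ_apply] at h4 ⊢
    rw [Submodule.Quotient.eq] at h4 ⊢
    rw [← h1, map_sub, LinearEquiv.apply_symm_apply, ← neg_sub]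
    exact B.lattice.neg_mem h4

theorem IsIsomorphic.trans {g : ℕ} {A B C : RealPPAV g} (h : IsIsomorphic A B)
    (h' : IsIsomorphic B C) : IsIsomorphic A C := by
  obtain ⟨φ, h1, h2, h3⟩ := h
  obtain ⟨ψ, k1, k2, k3⟩ := h'
  refine ⟨φ.trans ψ, fun v => ?_, fun u v => ?_, fun v w hvw => ?_⟩
  · simp [k1, h1]
  · simp [k2, h2]
  · exact k3 _ _ (h3 _ _ hvw)

instance isoSetoid (g : ℕ) : Setoid (RealPPAV g) where
  r := IsIsomorphic
  iseqv := ⟨IsIsomorphic.refl, IsIsomorphic.symm, IsIsomorphic.trans⟩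

/-- The set of real isomorphism classes `[(𝔄, E, S)]`. -/
def IsoClass (g : ℕ) : Type := Quotient (isoSetoid g)

/-- The class `[(𝔄, E, S)]`. -/
def IsoClass.mk {g : ℕ} (A : RealPPAV g) : IsoClass g := Quotient.mk (isoSetoid g) A

/-- `(𝔄, E, S) ↦ (𝔄, E, -S)`. -/
def RealPPAV.neg {g : ℕ} (A : RealPPAV g) : RealPPAV g where
  lattice := A.lattice
  discrete := A.discrete
  isZLattice := A.isZLattice
  pol := A.pol
  isPolarization := A.isPolarization
  isPrincipal := A.isPrincipal
  real := fun x => -A.real x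
  isRealStructure := by
    have := A.discrete
    have := A.isZLattice
    obtain ⟨F, hF, -⟩ := A.isReal
    have hS := A.isRealStructure
    have hadd := hF.map_add hS.antiholomorphic
    have hFneg : ∀ v, F (-v) = -F v := fun v => by
      have h := hadd v (-v)
      rw [add_neg_cancel, hF.map_zero] at h
      exact (neg_eq_of_add_eq_zero_right h.symm).symm
    refine ⟨fun v => ?_, fun x => ?_, by simp [hS.map_zero]⟩
    · obtain ⟨F₀, h1, h2⟩ := hS.antiholomorphic v
      refine ⟨fun w => -F₀ w, h1.mono fun w hw => ?_, h2.mono fun w hw => ?_⟩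
      · rw [hw, map_neg]
      · simpa using hw.neg
    · obtain ⟨v, rfl⟩ := A.lattice.mkQ_surjective x
      have h := hS.involutive (A.lattice.mkQ v)
      show -A.real (-A.real (A.lattice.mkQ v)) = A.lattice.mkQ v
      rw [hF.mk_eq, ← map_neg, hF.mk_eq, hFneg, map_neg, neg_neg, ← hF.mk_eq, ← hF.mk_eq, h]
  isReal := by
    obtain ⟨F, hF, hE⟩ := A.isReal
    refine ⟨fun v => -F v, ⟨hF.continuous.neg, by simp [hF.map_zero], fun v => ?_⟩, ?_⟩
    · rw [map_neg, hF.mk_eq]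
    · intro a ha b hb
      simpa using hE a ha b hb

/-! ### The space `ℋ_g`, the group `Γ_g^⋆` and the quotient `𝒳_ℝ^g` -/

/-- `ℋ_g`: the points `Ω` of the Siegel upper half plane with `2 Re Ω` integral. -/
def HSet (g : ℕ) : Set (Matrix (Fin g) (Fin g) ℂ) :=
  {Ω | Ωᵀ = Ω ∧ (Ω.map Complex.im).PosDef ∧
    ∃ N : Matrix (Fin g) (Fin g) ℤ, ∀ i j, 2 * (Ω i j).re = N i j}

/-- `ℋ_g` as a topological space. -/
abbrev HSpace (g : ℕ) : Type := HSet g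

/-- `ℤ`-matrices as complex matrices. -/
def toC {g : ℕ} (A : Matrix (Fin g) (Fin g) ℤ) : Matrix (Fin g) (Fin g) ℂ :=
  A.map (Int.cast : ℤ → ℂ)

/-- The Siegel modular group `Γ_g = Sp(g, ℤ)`. -/
abbrev SiegelGroup (g : ℕ) : Submonoid (Matrix (Fin g ⊕ Fin g) (Fin g ⊕ Fin g) ℤ) :=
  Matrix.symplecticGroup (Fin g) ℤ

/-- Mathlib's symplectic group is the one defined by `ᵗγ J_g γ = J_g`. -/
theorem mem_siegelGroup_iff {g : ℕ} (γ : Matrix (Fin g ⊕ Fin g) (Fin g ⊕ Fin g) ℤ) :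
    γ ∈ SiegelGroup g ↔ γᵀ * Jg g * γ = Jg g := by
  have hJ : Jg g = -Matrix.J (Fin g) ℤ := by
    rw [Jg, Matrix.J, Matrix.fromBlocks_neg]; simp
  rw [SymplecticGroup.mem_iff', hJ]
  simp

theorem toBlocks₂₁_mul {g : ℕ} (γ δ : Matrix (Fin g ⊕ Fin g) (Fin g ⊕ Fin g) ℤ) :
    (γ * δ).toBlocks₂₁ = γ.toBlocks₂₁ * δ.toBlocks₁₁ + γ.toBlocks₂₂ * δ.toBlocks₂₁ := by
  conv_lhs => rw [← fromBlocks_toBlocks γ, ← fromBlocks_toBlocks δ, fromBlocks_multiply]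
  rw [toBlocks_fromBlocks₂₁]

theorem toBlocks₁₁_mul {g : ℕ} (γ δ : Matrix (Fin g ⊕ Fin g) (Fin g ⊕ Fin g) ℤ) :
    (γ * δ).toBlocks₁₁ = γ.toBlocks₁₁ * δ.toBlocks₁₁ + γ.toBlocks₁₂ * δ.toBlocks₂₁ := by
  conv_lhs => rw [← fromBlocks_toBlocks γ, ← fromBlocks_toBlocks δ, fromBlocks_multiply]
  rw [toBlocks_fromBlocks₁₁]

theorem toBlocks₁₂_mul {g : ℕ} (γ δ : Matrix (Fin g ⊕ Fin g) (Fin g ⊕ Fin g) ℤ) :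
    (γ * δ).toBlocks₁₂ = γ.toBlocks₁₁ * δ.toBlocks₁₂ + γ.toBlocks₁₂ * δ.toBlocks₂₂ := by
  conv_lhs => rw [← fromBlocks_toBlocks γ, ← fromBlocks_toBlocks δ, fromBlocks_multiply]
  rw [toBlocks_fromBlocks₁₂]

/-- `Γ_g^⋆`: the elements `(A B; 0 ᵗA⁻¹)` of `Γ_g`. -/
def GammaStar (g : ℕ) : Subgroup (SiegelGroup g) where
  carrier := {γ | (γ : Matrix (Fin g ⊕ Fin g) (Fin g ⊕ Fin g) ℤ).toBlocks₂₁ = 0}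
  mul_mem' := by
    intro γ δ hγ hδ
    simp only [Set.mem_ofPred_eq] at hγ hδ ⊢
    rw [Submonoid.coe_mul, toBlocks₂₁_mul, hγ, hδ]
    simp
  one_mem' := by
    ext i j
    simp [toBlocks₂₁]
  inv_mem' := by
    intro γ hγ
    simp only [Set.mem_ofPred_eq] at hγ ⊢
    rw [SymplecticGroup.coe_inv, ← fromBlocks_toBlocks γ.1, hγ, Matrix.J,
      fromBlocks_transpose, fromBlocks_neg, fromBlocks_multiply, fromBlocks_multiply,
      toBlocks_fromBlocks₂₁]
    simp

theorem GammaStar.relations {g : ℕ} {γ : SiegelGroup g} (hγ : γ ∈ GammaStar g) :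
    γ.1.toBlocks₁₁ * γ.1.toBlocks₂₂ᵀ = 1 ∧
      γ.1.toBlocks₁₁ * γ.1.toBlocks₁₂ᵀ = γ.1.toBlocks₁₂ * γ.1.toBlocks₁₁ᵀ := by
  have hC : γ.1.toBlocks₂₁ = 0 := hγ
  have h := SymplecticGroup.mem_iff.1 γ.2
  rw [← fromBlocks_toBlocks γ.1, hC, Matrix.J, fromBlocks_transpose, fromBlocks_multiply,
    fromBlocks_multiply, fromBlocks_inj] at h
  obtain ⟨h1, h2, -, -⟩ := h
  simp only [mul_zero, zero_add, Matrix.mul_neg, mul_one, Matrix.neg_mul, add_zero,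
    transpose_zero, neg_inj] at h1 h2
  exact ⟨h2, (add_neg_eq_zero.1 h1).symm⟩

/-- `γ · Ω = A Ω ᵗA + B ᵗA`, for `γ = (A B; 0 ᵗA⁻¹)`. -/
def starAct {g : ℕ} (γ : Matrix (Fin g ⊕ Fin g) (Fin g ⊕ Fin g) ℤ)
    (Ω : Matrix (Fin g) (Fin g) ℂ) : Matrix (Fin g) (Fin g) ℂ :=
  toC γ.toBlocks₁₁ * Ω * (toC γ.toBlocks₁₁)ᵀ + toC γ.toBlocks₁₂ * (toC γ.toBlocks₁₁)ᵀ

theorem toC_mul {g : ℕ} (A B : Matrix (Fin g) (Fin g) ℤ) : toC (A * B) = toC A * toC B := by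
  simpa [toC] using Matrix.map_mul (L := A) (M := B) (f := Int.castRingHom ℂ)

theorem toC_add {g : ℕ} (A B : Matrix (Fin g) (Fin g) ℤ) : toC (A + B) = toC A + toC B := by
  ext; simp [toC]

theorem toC_one {g : ℕ} : toC (1 : Matrix (Fin g) (Fin g) ℤ) = 1 := by
  simp [toC]

theorem toC_transpose {g : ℕ} (A : Matrix (Fin g) (Fin g) ℤ) : toC Aᵀ = (toC A)ᵀ := rfl

/-- Real and imaginary part of `γ · Ω`. -/
theorem starAct_apply_im {g : ℕ} (γ : Matrix (Fin g ⊕ Fin g) (Fin g ⊕ Fin g) ℤ)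
    (Ω : Matrix (Fin g) (Fin g) ℂ) :
    (starAct γ Ω).map Complex.im =
      γ.toBlocks₁₁.map (Int.cast : ℤ → ℝ) * Ω.map Complex.im *
        (γ.toBlocks₁₁.map (Int.cast : ℤ → ℝ))ᵀ := by
  ext i j
  simp [starAct, toC, Matrix.mul_apply, Finset.sum_mul]

theorem starAct_apply_re {g : ℕ} (γ : Matrix (Fin g ⊕ Fin g) (Fin g ⊕ Fin g) ℤ)
    (Ω : Matrix (Fin g) (Fin g) ℂ) :
    (starAct γ Ω).map Complex.re =
      γ.toBlocks₁₁.map (Int.cast : ℤ → ℝ) * Ω.map Complex.re *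
        (γ.toBlocks₁₁.map (Int.cast : ℤ → ℝ))ᵀ +
      γ.toBlocks₁₂.map (Int.cast : ℤ → ℝ) * (γ.toBlocks₁₁.map (Int.cast : ℤ → ℝ))ᵀ := by
  ext i j
  simp [starAct, toC, Matrix.mul_apply, Finset.sum_mul]

theorem starAct_mem {g : ℕ} {γ : SiegelGroup g} (hγ : γ ∈ GammaStar g)
    {Ω : Matrix (Fin g) (Fin g) ℂ} (hΩ : Ω ∈ HSet g) : starAct γ.1 Ω ∈ HSet g := by
  obtain ⟨h1, h2⟩ := GammaStar.relations hγ
  obtain ⟨hs, hp, N, hN⟩ := hΩ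
  refine ⟨?_, ?_, γ.1.toBlocks₁₁ * N * γ.1.toBlocks₁₁ᵀ +
    (γ.1.toBlocks₁₂ * γ.1.toBlocks₁₁ᵀ + γ.1.toBlocks₁₂ * γ.1.toBlocks₁₁ᵀ), ?_⟩
  · have h3 : toC γ.1.toBlocks₁₁ * (toC γ.1.toBlocks₁₂)ᵀ
        = toC γ.1.toBlocks₁₂ * (toC γ.1.toBlocks₁₁)ᵀ := by
      rw [← toC_transpose, ← toC_transpose, ← toC_mul, ← toC_mul, h2]
    rw [starAct, transpose_add, transpose_mul, transpose_mul, transpose_mul, transpose_transpose,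
      hs, h3, Matrix.mul_assoc]
  · rw [starAct_apply_im]
    have h3 := congrArg (Matrix.map · (Int.cast : ℤ → ℝ)) h1
    have h4 : γ.1.toBlocks₁₁.map (Int.cast : ℤ → ℝ) * γ.1.toBlocks₂₂ᵀ.map (Int.cast : ℤ → ℝ)
        = 1 := by
      have := Matrix.map_mul (L := γ.1.toBlocks₁₁) (M := γ.1.toBlocks₂₂ᵀ)
        (f := Int.castRingHom ℝ)
      rw [h1] at this
      simpa using this.symm
    have hu : IsUnit (γ.1.toBlocks₁₁.map (Int.cast : ℤ → ℝ)) :=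
      (Matrix.isUnit_iff_isUnit_det _).2 (Matrix.isUnit_det_of_right_inverse h4)
    have := hp.mul_mul_conjTranspose_same (B := γ.1.toBlocks₁₁.map (Int.cast : ℤ → ℝ))
      (Matrix.vecMul_injective_of_isUnit hu)
    rwa [Matrix.conjTranspose_eq_transpose_of_trivial] at this
  · intro i j
    have hre : Ω.map Complex.re = (1 / 2 : ℝ) • N.map (Int.cast : ℤ → ℝ) := by
      ext i j
      have := hN i j
      show (Ω i j).re = 1 / 2 * (N i j : ℝ)
      linarith
    have h := congrFun (congrFun (starAct_apply_re γ.1 Ω) i) j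
    rw [map_apply, hre] at h
    rw [h]
    simp [Matrix.mul_apply, Finset.sum_mul, Finset.mul_sum, mul_add]
    rw [← two_mul, Finset.mul_sum]

instance (g : ℕ) : MulAction (GammaStar g) (HSpace g) where
  smul γ Ω := ⟨starAct γ.1.1 Ω.1, starAct_mem γ.2 Ω.2⟩
  one_smul Ω := by
    apply Subtype.ext
    show starAct (1 : Matrix _ _ ℤ) Ω.1 = Ω.1
    have h1 : (1 : Matrix (Fin g ⊕ Fin g) (Fin g ⊕ Fin g) ℤ).toBlocks₁₁ = 1 := by
      rw [← fromBlocks_one, toBlocks_fromBlocks₁₁]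
    have h2 : (1 : Matrix (Fin g ⊕ Fin g) (Fin g ⊕ Fin g) ℤ).toBlocks₁₂ = 0 := by
      rw [← fromBlocks_one, toBlocks_fromBlocks₁₂]
    rw [starAct, h1, h2, toC_one]
    simp [toC]
  mul_smul γ δ Ω := by
    apply Subtype.ext
    show starAct (γ.1.1 * δ.1.1) Ω.1 = starAct γ.1.1 (starAct δ.1.1 Ω.1)
    have hC : δ.1.1.toBlocks₂₁ = 0 := δ.2
    have h1 : toC δ.1.1.toBlocks₂₂ * (toC δ.1.1.toBlocks₁₁)ᵀ = 1 := by
      have := congrArg transpose (GammaStar.relations δ.2).1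
      rw [transpose_mul, transpose_transpose, transpose_one] at this
      rw [← toC_transpose, ← toC_mul, this, toC_one]
    rw [starAct, starAct, starAct, toBlocks₁₁_mul, toBlocks₁₂_mul, hC, Matrix.mul_zero, add_zero,
      toC_add, toC_mul, toC_mul, toC_mul, transpose_mul]
    have h2 : toC γ.1.1.toBlocks₁₂ * toC δ.1.1.toBlocks₂₂ *
        ((toC δ.1.1.toBlocks₁₁)ᵀ * (toC γ.1.1.toBlocks₁₁)ᵀ)
          = toC γ.1.1.toBlocks₁₂ * (toC γ.1.1.toBlocks₁₁)ᵀ := by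
      rw [Matrix.mul_assoc, ← Matrix.mul_assoc (toC δ.1.1.toBlocks₂₂), h1, Matrix.one_mul]
    rw [Matrix.add_mul, h2]
    noncomm_ring

/-- The moduli space `𝒳_ℝ^g = Γ_g^⋆ \ ℋ_g`, with the quotient topology. -/
abbrev XSpace (g : ℕ) : Type := MulAction.orbitRel.Quotient (GammaStar g) (HSpace g)

/-- The natural projection `π_g : ℋ_g → 𝒳_ℝ^g`. -/
def proj {g : ℕ} (Ω : HSpace g) : XSpace g := Quotient.mk _ Ω

/-! ### The triple `(𝔄_Ω, E_Ω, σ_Ω)` -/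

/-- The columns of the period matrix `(Ω, I_g)`. -/
def periodVec {g : ℕ} (Ω : Matrix (Fin g) (Fin g) ℂ) : Fin g ⊕ Fin g → CVec g :=
  Sum.elim (fun j i => Ω i j) (fun j => Pi.single j 1)

/-- The lattice `L_Ω = Ω ℤ^g + ℤ^g`. -/
def periodLattice {g : ℕ} (Ω : Matrix (Fin g) (Fin g) ℂ) : Submodule ℤ (CVec g) :=
  Submodule.span ℤ (Set.range (periodVec Ω))

/-- `E_Ω(u,v) = Im (ᵗu (Im Ω)⁻¹ v̄)`. -/
def periodForm {g : ℕ} (Ω : Matrix (Fin g) (Fin g) ℂ) : CVec g →ₗ[ℝ] CVec g →ₗ[ℝ] ℝ :=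
  LinearMap.mk₂ ℝ
    (fun u v => (u ⬝ᵥ (((Ω.map Complex.im)⁻¹).map ((↑) : ℝ → ℂ) *ᵥ star v)).im)
    (by intro a b c; simp [add_dotProduct])
    (by intro r a b; simp [smul_dotProduct])
    (by intro a b c; simp [mulVec_add, dotProduct_add])
    (by
      intro r a b
      have : star (r • b) = (r : ℂ) • star b := by ext; simp
      rw [this, mulVec_smul, dotProduct_smul]; simp)

theorem periodForm_apply {g : ℕ} (Ω : Matrix (Fin g) (Fin g) ℂ) (u v : CVec g) :
    periodForm Ω u v =
      (fun i => (u i).im) ⬝ᵥ ((Ω.map Complex.im)⁻¹ *ᵥ fun i => (v i).re) -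
      (fun i => (u i).re) ⬝ᵥ ((Ω.map Complex.im)⁻¹ *ᵥ fun i => (v i).im) := by
  simp only [periodForm, LinearMap.mk₂_apply, dotProduct, mulVec, Complex.im_sum, ←
    Finset.sum_sub_distrib]
  refine Finset.sum_congr rfl fun i _ => ?_
  rw [Complex.mul_im]
  simp [Complex.re_sum, Complex.im_sum]
  ring

theorem isUnit_im_det {g : ℕ} {Ω : Matrix (Fin g) (Fin g) ℂ} (hΩ : Ω ∈ HSet g) :
    IsUnit (Ω.map Complex.im).det :=
  (Matrix.isUnit_iff_isUnit_det _).1 hΩ.2.1.isUnit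

theorem im_inv_symm {g : ℕ} {Ω : Matrix (Fin g) (Fin g) ℂ} (hΩ : Ω ∈ HSet g) (a b : Fin g → ℝ) :
    a ⬝ᵥ ((Ω.map Complex.im)⁻¹ *ᵥ b) = b ⬝ᵥ ((Ω.map Complex.im)⁻¹ *ᵥ a) := by
  have hs : ((Ω.map Complex.im)⁻¹)ᵀ = (Ω.map Complex.im)⁻¹ := by
    rw [transpose_nonsing_inv]
    congr 1
    rw [← transpose_map, hΩ.1]
  rw [dotProduct_mulVec, ← mulVec_transpose, hs, dotProduct_comm]

/-- `E_Ω` is `E_0` transported by `F_Ω(x, y) = Ω x + y`. -/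
theorem periodForm_period {g : ℕ} {Ω : Matrix (Fin g) (Fin g) ℂ} (hΩ : Ω ∈ HSet g)
    (x y x' y' : Fin g → ℝ) :
    periodForm Ω ((Ω *ᵥ fun i => (x i : ℂ)) + fun i => (y i : ℂ))
      ((Ω *ᵥ fun i => (x' i : ℂ)) + fun i => (y' i : ℂ)) = x ⬝ᵥ y' - y ⬝ᵥ x' := by
  have hu := isUnit_im_det hΩ
  have him : ∀ x y : Fin g → ℝ, (fun i => (((Ω *ᵥ fun i => (x i : ℂ)) +
      fun i => (y i : ℂ)) i).im) = Ω.map Complex.im *ᵥ x := by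
    intro x y; ext i; simp [mulVec, dotProduct]
  have hre : ∀ x y : Fin g → ℝ, (fun i => (((Ω *ᵥ fun i => (x i : ℂ)) +
      fun i => (y i : ℂ)) i).re) = Ω.map Complex.re *ᵥ x + y := by
    intro x y; ext i; simp [mulVec, dotProduct]
  have hX : (Ω.map Complex.re)ᵀ = Ω.map Complex.re := by rw [← transpose_map, hΩ.1]
  rw [periodForm_apply, him, hre, im_inv_symm hΩ, him, hre, mulVec_mulVec, mulVec_mulVec,
    nonsing_inv_mul _ hu, one_mulVec, one_mulVec, add_dotProduct, add_dotProduct,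
    dotProduct_comm _ x, dotProduct_mulVec, ← mulVec_transpose, hX, dotProduct_comm y' x]
  ring

theorem sum_smul_periodVec {g : ℕ} (Ω : Matrix (Fin g) (Fin g) ℂ) (c : Fin g ⊕ Fin g → ℝ) :
    ∑ i, c i • periodVec Ω i =
      (Ω *ᵥ fun i => (c (Sum.inl i) : ℂ)) + fun i => (c (Sum.inr i) : ℂ) := by
  ext i
  simp [periodVec, mulVec, dotProduct, Finset.sum_apply, Pi.single_apply, mul_comm]

theorem mem_periodLattice {g : ℕ} (Ω : Matrix (Fin g) (Fin g) ℂ) (v : CVec g) :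
    v ∈ periodLattice Ω ↔ ∃ x y : Fin g → ℤ,
      v = (Ω *ᵥ fun i => (x i : ℂ)) + fun i => (y i : ℂ) := by
  have key : ∀ c : Fin g ⊕ Fin g → ℤ, ∑ i, c i • periodVec Ω i =
      (Ω *ᵥ fun i => (c (Sum.inl i) : ℂ)) + fun i => (c (Sum.inr i) : ℂ) := by
    intro c
    have := sum_smul_periodVec Ω (fun i => (c i : ℝ))
    simp only [Complex.ofReal_intCast] at this
    rw [← this]
    refine Finset.sum_congr rfl fun i _ => ?_
    ext j
    simp
  rw [periodLattice, Submodule.mem_span_range_iff_exists_fun]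
  constructor
  · rintro ⟨c, rfl⟩
    exact ⟨fun i => c (Sum.inl i), fun i => c (Sum.inr i), key c⟩
  · rintro ⟨x, y, rfl⟩
    exact ⟨Sum.elim x y, by rw [key]; rfl⟩

theorem periodForm_isPolarization {g : ℕ} {Ω : Matrix (Fin g) (Fin g) ℂ} (hΩ : Ω ∈ HSet g) :
    IsPolarization (periodLattice Ω) (periodForm Ω) := by
  have hE : ∀ u v : CVec g, periodForm Ω (Complex.I • u) v =
      (fun i => (u i).re) ⬝ᵥ ((Ω.map Complex.im)⁻¹ *ᵥ fun i => (v i).re) +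
      (fun i => (u i).im) ⬝ᵥ ((Ω.map Complex.im)⁻¹ *ᵥ fun i => (v i).im) := by
    intro u v
    have : (fun i => -(u i).im) = -fun i => (u i).im := rfl
    rw [periodForm_apply]
    simp [this, neg_dotProduct]
  have halt : ∀ u v : CVec g, periodForm Ω u v = -periodForm Ω v u := by
    intro u v
    rw [periodForm_apply, periodForm_apply, im_inv_symm hΩ (fun i => (v i).im),
      im_inv_symm hΩ (fun i => (v i).re)]
    ring
  refine ⟨fun u => ?_, fun u v => ?_, fun u hu => ?_, fun u hu v hv => ?_⟩
  · have := halt u u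
    linarith
  · apply Complex.ext
    · simp only [hermitianForm, hE]
      simp only [Complex.conj_re, Complex.add_re, Complex.ofReal_re, Complex.mul_re, Complex.I_re,
        Complex.I_im, Complex.ofReal_im]
      rw [im_inv_symm hΩ (fun i => (v i).im), im_inv_symm hΩ (fun i => (v i).re)]
      ring
    · have := halt u v
      simp [hermitianForm, this]
  · have hP : ((Ω.map Complex.im)⁻¹).PosDef := hΩ.2.1.inv
    have hnn : ∀ a : Fin g → ℝ, 0 ≤ a ⬝ᵥ ((Ω.map Complex.im)⁻¹ *ᵥ a) := fun a => by
      simpa using hP.posSemidef.dotProduct_mulVec_nonneg a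
    have hpos : ∀ a : Fin g → ℝ, a ≠ 0 → 0 < a ⬝ᵥ ((Ω.map Complex.im)⁻¹ *ᵥ a) := fun a ha => by
      simpa using hP.dotProduct_mulVec_pos ha
    have hre : (hermitianForm (periodForm Ω) u u).re =
        periodForm Ω (Complex.I • u) u := by simp [hermitianForm]
    rw [hre, hE]
    by_cases h : (fun i => (u i).re) = 0
    · refine add_pos_of_nonneg_of_pos (hnn _) (hpos _ fun h' => hu ?_)
      ext i
      exact Complex.ext (congrFun h i) (congrFun h' i)
    · exact add_pos_of_pos_of_nonneg (hpos _ h) (hnn _)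
  · obtain ⟨x, y, rfl⟩ := (mem_periodLattice Ω u).1 hu
    obtain ⟨x', y', rfl⟩ := (mem_periodLattice Ω v).1 hv
    refine ⟨x ⬝ᵥ y' - y ⬝ᵥ x', ?_⟩
    have := periodForm_period hΩ (fun i => (x i : ℝ)) (fun i => (y i : ℝ)) (fun i => (x' i : ℝ))
      (fun i => (y' i : ℝ))
    simp only [Complex.ofReal_intCast] at this
    rw [this]
    simp [dotProduct]

theorem periodVec_linearIndependent {g : ℕ} {Ω : Matrix (Fin g) (Fin g) ℂ} (hΩ : Ω ∈ HSet g) :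
    LinearIndependent ℝ (periodVec Ω) := by
  rw [Fintype.linearIndependent_iff]
  intro c hc
  rw [sum_smul_periodVec] at hc
  have h := fun x' y' => periodForm_period hΩ (fun i => c (Sum.inl i)) (fun i => c (Sum.inr i))
    x' y'
  simp only [hc, map_zero, LinearMap.zero_apply] at h
  have hx : (fun i => c (Sum.inl i)) = 0 := by
    have := h 0 (fun i => c (Sum.inl i))
    rw [dotProduct_zero, sub_zero] at this
    exact dotProduct_self_eq_zero.1 this.symm
  have hy : (fun i => c (Sum.inr i)) = 0 := by
    have := h (fun i => c (Sum.inr i)) 0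
    rw [dotProduct_zero, zero_sub, zero_eq_neg] at this
    exact dotProduct_self_eq_zero.1 this
  rintro (i | i)
  · exact congrFun hx i
  · exact congrFun hy i

/-- The columns of `(Ω, I_g)` as a real basis of `ℂ^g`. -/
def periodBasis {g : ℕ} {Ω : Matrix (Fin g) (Fin g) ℂ} (hΩ : Ω ∈ HSet g) :
    Module.Basis (Fin g ⊕ Fin g) ℝ (CVec g) :=
  basisOfLinearIndependentOfCardEqFinrank' (periodVec Ω) (periodVec_linearIndependent hΩ)
    (by simp [Module.finrank_pi_fintype, mul_two])

theorem coe_periodBasis {g : ℕ} {Ω : Matrix (Fin g) (Fin g) ℂ} (hΩ : Ω ∈ HSet g) :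
    ⇑(periodBasis hΩ) = periodVec Ω := by
  simp [periodBasis]

theorem periodLattice_discrete {g : ℕ} {Ω : Matrix (Fin g) (Fin g) ℂ} (hΩ : Ω ∈ HSet g) :
    DiscreteTopology (periodLattice Ω) := by
  rw [periodLattice, ← coe_periodBasis hΩ]
  infer_instance

theorem periodForm_periodVec {g : ℕ} {Ω : Matrix (Fin g) (Fin g) ℂ} (hΩ : Ω ∈ HSet g)
    (i j : Fin g ⊕ Fin g) : periodForm Ω (periodVec Ω i) (periodVec Ω j) = (Jg g i j : ℝ) := by
  have h : ∀ i, periodVec Ω i = (Ω *ᵥ fun k => (((Pi.single i 1 : Fin g ⊕ Fin g → ℝ)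
      (Sum.inl k) : ℝ) : ℂ)) + fun k => (((Pi.single i 1 : Fin g ⊕ Fin g → ℝ)
      (Sum.inr k) : ℝ) : ℂ) := by
    intro i
    rw [← sum_smul_periodVec]
    simp [Pi.single_apply]
  rw [h i, h j, periodForm_period hΩ]
  rcases i with i | i <;> rcases j with j | j <;>
    simp [Jg, dotProduct, Pi.single_apply, Matrix.one_apply, eq_comm]

theorem periodForm_isPrincipal {g : ℕ} {Ω : Matrix (Fin g) (Fin g) ℂ} (hΩ : Ω ∈ HSet g) :
    IsPrincipal (periodLattice Ω) (periodForm Ω) := by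
  have hli : LinearIndependent ℤ (periodVec Ω) :=
    (periodVec_linearIndependent hΩ).restrict_scalars' ℤ
  refine ⟨Module.Basis.span hli, fun i j => ?_⟩
  have h : ∀ i, ((Module.Basis.span hli i : periodLattice Ω) : CVec g) = periodVec Ω i :=
    fun i => congrArg Subtype.val (Module.Basis.span_apply hli i)
  exact (congrArg₂ (fun u v => periodForm Ω u v) (h i) (h j)).trans (periodForm_periodVec hΩ i j)

/-- Complex conjugation `σ : ℂ^g → ℂ^g`. -/
def conjMap (g : ℕ) : CVec g →ₗ[ℤ] CVec g :=
  (starAddEquiv : CVec g ≃+ CVec g).toAddMonoidHom.toIntLinearMap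

theorem conjMap_apply {g : ℕ} (v : CVec g) : conjMap g v = star v := rfl

theorem conjMap_periodLattice {g : ℕ} {Ω : Matrix (Fin g) (Fin g) ℂ} (hΩ : Ω ∈ HSet g) :
    periodLattice Ω ≤ (periodLattice Ω).comap (conjMap g) := by
  intro v hv
  obtain ⟨x, y, rfl⟩ := (mem_periodLattice Ω v).1 hv
  obtain ⟨-, -, N, hN⟩ := hΩ
  rw [Submodule.mem_comap, conjMap_apply, mem_periodLattice]
  refine ⟨-x, N *ᵥ x + y, ?_⟩
  have hN' : ∀ i j, star (Ω i j) = -Ω i j + (N i j : ℂ) := by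
    intro i j
    have h := hN i j
    apply Complex.ext <;> simp
    linarith
  ext i
  simp only [Pi.star_apply, Pi.add_apply, mulVec, dotProduct, star_add, star_sum, star_mul', hN',
    Pi.neg_apply]
  simp [add_mul, Finset.sum_add_distrib]
  ring

/-- The real structure `σ_Ω` on `ℂ^g / L_Ω` induced by complex conjugation. -/
def sigma {g : ℕ} {Ω : Matrix (Fin g) (Fin g) ℂ} (hΩ : Ω ∈ HSet g) :
    CVec g ⧸ periodLattice Ω → CVec g ⧸ periodLattice Ω :=
  (periodLattice Ω).mapQ (periodLattice Ω) (conjMap g) (conjMap_periodLattice hΩ)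

theorem sigma_mkQ {g : ℕ} {Ω : Matrix (Fin g) (Fin g) ℂ} (hΩ : Ω ∈ HSet g) (v : CVec g) :
    sigma hΩ ((periodLattice Ω).mkQ v) = (periodLattice Ω).mkQ (star v) := rfl

/-- The real principally polarized abelian variety `(𝔄_Ω, E_Ω, σ_Ω)`, `Ω ∈ ℋ_g`. -/
def RealPPAV.ofPeriod {g : ℕ} (Ω : HSpace g) : RealPPAV g where
  lattice := periodLattice Ω.1
  discrete := periodLattice_discrete Ω.2
  isZLattice := by
    refine @IsZLattice.mk _ _ _ _ _ _ (_) ?_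
    rw [periodLattice, ← coe_periodBasis Ω.2]
    exact ZSpan.span_top _
  pol := periodForm Ω.1
  isPolarization := periodForm_isPolarization Ω.2
  isPrincipal := periodForm_isPrincipal Ω.2
  real := sigma Ω.2
  isRealStructure := by
    refine ⟨fun v => ⟨star, .of_forall fun w => sigma_mkQ Ω.2 w, .of_forall fun w => ?_⟩,
      fun x => ?_, ?_⟩
    · simp
    · obtain ⟨v, rfl⟩ := (periodLattice Ω.1).mkQ_surjective x
      rw [sigma_mkQ, sigma_mkQ, star_star]
    · have := sigma_mkQ Ω.2 0
      simpa using this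
  isReal := by
    refine ⟨star, ⟨continuous_star, star_zero _, fun v => sigma_mkQ Ω.2 v⟩, fun a _ b _ => ?_⟩
    have h : ∀ v : CVec g, (fun i => -(v i).im) = -fun i => (v i).im := fun _ => rfl
    rw [periodForm_apply, periodForm_apply]
    simp only [Pi.star_apply, RCLike.star_def, Complex.conj_re, Complex.conj_im, h,
      neg_dotProduct, mulVec_neg, dotProduct_neg]
    ring

/-- Points of `ℋ_g` in one `Γ_g^⋆`-orbit give isomorphic triples. -/
theorem ofPeriod_smul {g : ℕ} (γ : GammaStar g) (Ω : HSpace g) :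
    IsIsomorphic (RealPPAV.ofPeriod Ω) (RealPPAV.ofPeriod (γ • Ω)) := by
  obtain ⟨hAD, -⟩ := GammaStar.relations γ.2
  set AZ := γ.1.1.toBlocks₁₁ with hAZ
  set BZ := γ.1.1.toBlocks₁₂ with hBZ
  set DZ := γ.1.1.toBlocks₂₂ with hDZ
  have hDA : DZᵀ * AZ = 1 := mul_eq_one_comm.1 hAD
  have hAD' : toC AZ * (toC DZ)ᵀ = 1 := by rw [← toC_transpose, ← toC_mul, hAD, toC_one]
  have hDA' : (toC DZ)ᵀ * toC AZ = 1 := by rw [← toC_transpose, ← toC_mul, hDA, toC_one]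
  have hADt : (toC AZ)ᵀ * toC DZ = 1 := by
    have := congrArg transpose hDA'
    rwa [transpose_mul, transpose_transpose, transpose_one] at this
  have hint : ∀ (P : Matrix (Fin g) (Fin g) ℤ) (x : Fin g → ℤ),
      (fun i => (((P *ᵥ x) i : ℤ) : ℂ)) = toC P *ᵥ fun i => (x i : ℂ) := by
    intro P x; ext i; simp [mulVec, dotProduct, toC]
  have hcoe : (γ • Ω).1 = toC AZ * Ω.1 * (toC AZ)ᵀ + toC BZ * (toC AZ)ᵀ := rfl
  have hone : ∀ P Q : Matrix (Fin g) (Fin g) ℂ, P * Q = 1 → ∀ z, P *ᵥ (Q *ᵥ z) = z := by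
    intro P Q h z; rw [mulVec_mulVec, h, one_mulVec]
  refine ⟨LinearEquiv.ofLinearMap (toC AZ).mulVecLin ((toC DZ)ᵀ).mulVecLin
    (LinearMap.ext fun z => hone _ _ hAD' z) (LinearMap.ext fun z => hone _ _ hDA' z),
    fun v => ?_, fun u v => ?_, fun v w hvw => ?_⟩
  · show toC AZ *ᵥ v ∈ periodLattice (γ • Ω).1 ↔ v ∈ periodLattice Ω.1
    rw [mem_periodLattice, mem_periodLattice, hcoe]
    constructor
    · rintro ⟨x, y, h⟩
      refine ⟨AZᵀ *ᵥ x, DZᵀ *ᵥ (BZ *ᵥ (AZᵀ *ᵥ x) + y), ?_⟩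
      have h' := congrArg ((toC DZ)ᵀ *ᵥ ·) h
      simp only [hone _ _ hDA'] at h'
      have hy : (fun i => (((BZ *ᵥ (AZᵀ *ᵥ x) + y) i : ℤ) : ℂ)) =
          toC BZ *ᵥ ((toC AZ)ᵀ *ᵥ fun i => (x i : ℂ)) + fun i => (y i : ℂ) := by
        rw [← toC_transpose, ← hint, ← hint]
        ext i; simp
      rw [hint, hint, hy, toC_transpose, toC_transpose, h', add_mulVec, mulVec_add, mulVec_add,
        mulVec_add, ← mulVec_mulVec, ← mulVec_mulVec, ← mulVec_mulVec, hone _ _ hDA', add_assoc]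
    · rintro ⟨x, y, rfl⟩
      refine ⟨DZ *ᵥ x, AZ *ᵥ y - BZ *ᵥ x, ?_⟩
      have hy : (fun i => (((AZ *ᵥ y - BZ *ᵥ x) i : ℤ) : ℂ)) =
          toC AZ *ᵥ (fun i => (y i : ℂ)) - toC BZ *ᵥ fun i => (x i : ℂ) := by
        rw [← hint, ← hint]
        ext i; simp
      rw [hint, hy, add_mulVec, mulVec_add, ← mulVec_mulVec, ← mulVec_mulVec, ← mulVec_mulVec,
        hone _ _ hADt]
      abel
  · show periodForm (γ • Ω).1 (toC AZ *ᵥ u) (toC AZ *ᵥ v) = periodForm Ω.1 u v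
    set AR : Matrix (Fin g) (Fin g) ℝ := AZ.map (Int.cast : ℤ → ℝ) with hAR
    set DR : Matrix (Fin g) (Fin g) ℝ := DZ.map (Int.cast : ℤ → ℝ) with hDR
    have hRD : DRᵀ * AR = 1 := by
      have := Matrix.map_mul (L := DZᵀ) (M := AZ) (f := Int.castRingHom ℝ)
      rw [hDA] at this
      simp at this
      exact this.symm
    have hARinv : AR⁻¹ = DRᵀ := Matrix.inv_eq_left_inv hRD
    have him : (γ • Ω).1.map Complex.im = AR * Ω.1.map Complex.im * ARᵀ :=
      starAct_apply_im γ.1.1 Ω.1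
    have hconj : ARᵀ * ((γ • Ω).1.map Complex.im)⁻¹ * AR = (Ω.1.map Complex.im)⁻¹ := by
      have hRDt : ARᵀ * DR = 1 := by
        have := congrArg transpose hRD
        rwa [transpose_mul, transpose_transpose, transpose_one] at this
      rw [him, Matrix.mul_inv_rev, Matrix.mul_inv_rev, ← transpose_nonsing_inv, hARinv,
        transpose_transpose, ← Matrix.mul_assoc, hRDt, Matrix.one_mul, Matrix.mul_assoc, hRD,
        Matrix.mul_one]
    have hmove : ∀ a b : Fin g → ℝ, (AR *ᵥ a) ⬝ᵥ (((γ • Ω).1.map Complex.im)⁻¹ *ᵥ (AR *ᵥ b)) =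
        a ⬝ᵥ ((Ω.1.map Complex.im)⁻¹ *ᵥ b) := by
      intro a b
      rw [← hconj, ← mulVec_mulVec, ← mulVec_mulVec, dotProduct_mulVec a, vecMul_transpose]
    have hre : ∀ z : CVec g, (fun i => ((toC AZ *ᵥ z) i).re) = AR *ᵥ fun i => (z i).re := by
      intro z; ext i; simp [mulVec, dotProduct, toC, hAR]
    have himv : ∀ z : CVec g, (fun i => ((toC AZ *ᵥ z) i).im) = AR *ᵥ fun i => (z i).im := by
      intro z; ext i; simp [mulVec, dotProduct, toC, hAR]
    rw [periodForm_apply, periodForm_apply, hre, hre, himv, himv, hmove, hmove]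
  · have hstar : star (toC AZ *ᵥ v) = toC AZ *ᵥ star v := by
      ext i; simp [mulVec, dotProduct, toC]
    have hlat : ∀ z, z ∈ periodLattice Ω.1 → toC AZ *ᵥ z ∈ periodLattice (γ • Ω).1 := by
      intro z hz
      obtain ⟨x, y, rfl⟩ := (mem_periodLattice _ _).1 hz
      rw [mem_periodLattice, hcoe]
      refine ⟨DZ *ᵥ x, AZ *ᵥ y - BZ *ᵥ x, ?_⟩
      have hy : (fun i => (((AZ *ᵥ y - BZ *ᵥ x) i : ℤ) : ℂ)) =
          toC AZ *ᵥ (fun i => (y i : ℂ)) - toC BZ *ᵥ fun i => (x i : ℂ) := by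
        rw [← hint, ← hint]
        ext i; simp
      rw [hint, hy, add_mulVec, mulVec_add, ← mulVec_mulVec, ← mulVec_mulVec, ← mulVec_mulVec,
        hone _ _ hADt]
      abel
    have h1 : star v - w ∈ periodLattice Ω.1 :=
      sub_mem_of_mkQ_eq ((sigma_mkQ Ω.2 v).symm.trans hvw)
    have h2 := hlat _ h1
    show sigma (γ • Ω).2 ((periodLattice (γ • Ω).1).mkQ (toC AZ *ᵥ v)) =
      (periodLattice (γ • Ω).1).mkQ (toC AZ *ᵥ w)
    rw [sigma_mkQ, hstar, Submodule.mkQ_apply, Submodule.mkQ_apply, Submodule.Quotient.eq,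
      ← mulVec_sub]
    exact h2

/-- The map `[Ω] ↦ [(𝔄_Ω, E_Ω, σ_Ω)]` from `𝒳_ℝ^g` to the set of isomorphism classes. -/
def classMap {g : ℕ} : XSpace g → IsoClass g :=
  Quotient.lift (fun Ω => IsoClass.mk (RealPPAV.ofPeriod Ω)) (by
    rintro _ Ω ⟨γ, rfl⟩
    exact Quotient.sound (ofPeriod_smul γ Ω).symm)

/-! ### The real analytic structure and the components of `𝒳_ℝ^g` -/

/-- `f` is a section over `U` of the structure sheaf of the quotient `𝒳_ℝ^g`: the function
`f ∘ π_g` on the preimage of `U` is real analytic on `ℋ_g`, that is, near each of its points it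
is the restriction of a real analytic function of the matrix entries. -/
def IsAnalyticOn {g : ℕ} (U : Set (XSpace g)) (f : XSpace g → ℝ) : Prop :=
  ∀ Ω : HSpace g, proj Ω ∈ U → ∃ G : (Fin g → Fin g → ℂ) → ℝ,
    AnalyticAt ℝ G (fun i j => Ω.1 i j) ∧
    ∀ᶠ Ω' in 𝓝 Ω, f (proj Ω') = G (fun i j => Ω'.1 i j)

/-- A real analytic self-map of `𝒳_ℝ^g`: continuous, and it pulls real analytic functions on
open sets back to real analytic functions. -/
structure IsRealAnalytic {g : ℕ} (T : XSpace g → XSpace g) : Prop where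
  continuous : Continuous T
  pullback : ∀ U : Set (XSpace g), IsOpen U → ∀ f : XSpace g → ℝ,
    IsAnalyticOn U f → IsAnalyticOn (T ⁻¹' U) (f ∘ T)

/-- The integral matrix `2 Re Ω`, for `Ω ∈ ℋ_g`. -/
def twoRe {g : ℕ} (Ω : Matrix (Fin g) (Fin g) ℂ) : Matrix (Fin g) (Fin g) ℤ :=
  Ω.map fun z => round (2 * z.re)

theorem twoRe_cast {g : ℕ} (Ω : HSpace g) (i j : Fin g) :
    (twoRe Ω.1 i j : ℝ) = 2 * (Ω.1 i j).re := by
  obtain ⟨-, -, N, hN⟩ := Ω.2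
  simp [twoRe, hN]

/-- Reduction modulo `2`. -/
def mod2 {g : ℕ} (M : Matrix (Fin g) (Fin g) ℤ) : Matrix (Fin g) (Fin g) (ZMod 2) :=
  M.map (Int.cast : ℤ → ZMod 2)

/-- `π(N) = ∏ (1 - n_kk)`. -/
def diagInvariant {g : ℕ} (N : Matrix (Fin g) (Fin g) (ZMod 2)) : ZMod 2 :=
  ∏ k, (1 - N k k)

/-- `𝒳_(λ,i)^g`: the classes of the `Ω = M/2 + iY` with `rank (M mod 2) = λ`,
`π(M mod 2) = i`. -/
def component (g lam : ℕ) (i : ZMod 2) : Set (XSpace g) :=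
  proj '' {Ω : HSpace g | (mod2 (twoRe Ω.1)).rank = lam ∧ diagInvariant (mod2 (twoRe Ω.1)) = i}

/-- The pairs `(λ, i)` that occur as invariants. -/
def Admissible (g lam : ℕ) (i : ZMod 2) : Prop :=
  lam ≤ g ∧ (Odd lam → i = 0) ∧ (lam = 0 → i = 1)

/-- The matrix of the standard form with invariants `(λ, i)`: `(I_λ 0; 0 0)` if `i = 0`, and
`(H_λ 0; 0 0)` with the antidiagonal matrix `H_λ` if `i = 1`. -/
def standardForm (g lam : ℕ) (i : ZMod 2) : Matrix (Fin g) (Fin g) ℤ :=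
  Matrix.of fun j k =>
    if i = 0 then (if j = k ∧ (j : ℕ) < lam then 1 else 0)
    else (if (j : ℕ) + (k : ℕ) + 1 = lam then 1 else 0)

/-- `Σ_M = (-M I; -(I + M²) M)`. -/
def sigmaMatrix {g : ℕ} (M : Matrix (Fin g) (Fin g) ℤ) :
    Matrix (Fin g ⊕ Fin g) (Fin g ⊕ Fin g) ℤ :=
  Matrix.fromBlocks (-M) 1 (-(1 + M * M)) M

/-- `γ(Ω) = (AΩ + B)(CΩ + D)⁻¹`. -/
def moebius {g : ℕ} (γ : Matrix (Fin g ⊕ Fin g) (Fin g ⊕ Fin g) ℤ)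
    (Ω : Matrix (Fin g) (Fin g) ℂ) : Matrix (Fin g) (Fin g) ℂ :=
  (toC γ.toBlocks₁₁ * Ω + toC γ.toBlocks₁₂) * (toC γ.toBlocks₂₁ * Ω + toC γ.toBlocks₂₂)⁻¹

/-- `M/2 + iY`. -/
def halfPoint {g : ℕ} (M : Matrix (Fin g) (Fin g) ℤ) (Y : Matrix (Fin g) (Fin g) ℝ) :
    Matrix (Fin g) (Fin g) ℂ :=
  (1 / 2 : ℂ) • toC M + Complex.I • Y.map ((↑) : ℝ → ℂ)

/-- The diagonal matrix `(½ I_λ 0; 0 I_{g-λ})`. -/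
def halfDiag (g lam : ℕ) : Matrix (Fin g) (Fin g) ℝ :=
  Matrix.diagonal fun j => if (j : ℕ) < lam then 1 / 2 else 1

end
end RealModuli

open RealModuli

/-!
# The moduli space of real principally polarized abelian varieties and the involution `S ↦ -S`

**Classification.** The lift of a real structure `S` to `ℂ^g` is an antilinear involution `σ` that
preserves the lattice `L` and changes the sign of the polarization `E`. Its fixed lattice is
isotropic, has rank `g` and is a direct summand of `L`; since `E` is unimodular, a `ℤ`-basis `f` of
it extends to a symplectic basis `(e, f)` of `L` (`IsLinearRealStructure.exists_adaptedBasis`).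
In the complex coordinates given by `f` the involution is complex conjugation, the lattice is
`Ω ℤ^g + ℤ^g`, and the Riemann relations say `Ω ∈ ℋ_g`; hence the period map is surjective.
Conversely, an isomorphism of two period triples commutes with conjugation, so it is an integral
matrix `U`, and `Ω' - U Ω ᵗU` is integral; hence it is injective.

**Components.** Modulo `2`, a symmetric integral matrix is `GL_g(ℤ)`-congruent to exactly one
standard form: non-alternating forms over `𝔽₂` have orthogonal bases with entries `0, 1`,
alternating ones have hyperbolic bases, and `GL_g(ℤ) → GL_g(𝔽₂)` is surjective. So every class is
represented by some `M/2 + iY` with `M` a standard form (`exists_smul_eq_standardPoint`), and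
`𝒳_(λ,i)` is the image of the convex cone of positive definite matrices. As `2 Re Ω` is locally
constant and its invariants do not change along orbits, `𝒳_(λ,i)` is also open and closed.

**The involution.** Let `K = (½ I_λ 0; 0 I)`. As `M² = (I_λ 0; 0 0)`, multiplication by the purely
imaginary matrix `i K Y⁻¹` maps the lattice of `M/2 + iY` onto that of `M/2 + i K Y⁻¹ K`,
and it turns `-σ` into `σ` (`isIsomorphic_neg_standardPoint`). So `Σ` is
`M/2 + iY ↦ M/2 + i K Y⁻¹ K` on standard points, which gives its action on components and, through
local lifts to `ℋ_g`, its analyticity. It moves the class of `2i I`, since the determinant of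
`Im Ω` is constant along orbits.
-/

namespace RealModuli

open Matrix Topology ComplexConjugate

/-! ### Symmetric bilinear forms over the field with two elements -/

theorem zmodTwo_eq_one {a : ZMod 2} (h : a ≠ 0) : a = 1 := by
  revert a; decide

theorem exists_seq_span_eq {V : Type*} [AddCommGroup V] [Module (ZMod 2) V]
    [FiniteDimensional (ZMod 2) V] (W : Submodule (ZMod 2) V) {n : ℕ}
    (hn : Module.finrank (ZMod 2) W = n) :
    ∃ c : ℕ → V, Submodule.span (ZMod 2) (c '' Set.Iio n) = W := by
  subst hn
  let b := Module.finBasis (ZMod 2) W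
  refine ⟨fun k => if h : k < Module.finrank (ZMod 2) W then b ⟨k, h⟩ else 0, ?_⟩
  have : (fun k => if h : k < Module.finrank (ZMod 2) W then ((b ⟨k, h⟩ : W) : V) else 0) ''
      Set.Iio (Module.finrank (ZMod 2) W) = W.subtype '' Set.range b := by
    ext v
    constructor
    · rintro ⟨k, hk, rfl⟩
      exact ⟨b ⟨k, hk⟩, ⟨_, rfl⟩, by simp [Set.mem_Iio.1 hk]⟩
    · rintro ⟨_, ⟨k, rfl⟩, rfl⟩
      exact ⟨k, k.2, by simp⟩
  rw [this, Submodule.span_image, b.span_eq, Submodule.map_top, Submodule.range_subtype]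

section Forms

variable {V : Type*} [AddCommGroup V] [Module (ZMod 2) V]
  (B : V →ₗ[ZMod 2] V →ₗ[ZMod 2] ZMod 2)

/-- The vectors of `W` orthogonal to `v`. -/
def orthogonalIn (W : Submodule (ZMod 2) V) (v : V) : Submodule (ZMod 2) V :=
  W ⊓ LinearMap.ker (B v)

variable {B}

theorem orthogonalIn_sup_span {W : Submodule (ZMod 2) V} {v : V} (hv : v ∈ W) (h1 : B v v = 1) :
    orthogonalIn B W v ⊔ Submodule.span (ZMod 2) {v} = W := by
  apply le_antisymm
  · refine sup_le inf_le_left ?_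
    rwa [Submodule.span_singleton_le_iff_mem]
  · intro w hw
    rw [Submodule.mem_sup]
    refine ⟨w - B v w • v, ⟨W.sub_mem hw (W.smul_mem _ hv), ?_⟩, B v w • v,
      Submodule.smul_mem _ _ (Submodule.mem_span_singleton_self v), by abel⟩
    simp [h1]

/-- A vector `v` with `B(v,v) = 1` can be chosen so that the form on its orthogonal complement is
again either non-alternating or zero: if `B` is alternating and non-zero on `v^⊥`, with
`B(x,y) = 1`, then `v + x` is a better choice, because `v + y` lies in its complement. -/
theorem exists_unit_vector (hs : ∀ u v, B u v = B v u) {W : Submodule (ZMod 2) V}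
    (h : ∃ v ∈ W, B v v = 1) :
    ∃ v ∈ W, B v v = 1 ∧ ((∃ w ∈ orthogonalIn B W v, B w w = 1) ∨
      ∀ u ∈ orthogonalIn B W v, ∀ w ∈ orthogonalIn B W v, B u w = 0) := by
  obtain ⟨v, hv, h1⟩ := h
  by_contra! hcon
  obtain ⟨halt, x, hx, y, hy, hxy⟩ := hcon v hv h1
  have hxy := zmodTwo_eq_one hxy
  have hxx : B x x = 0 := by by_contra hne; exact halt x hx (zmodTwo_eq_one hne)
  have hyy : B y y = 0 := by by_contra hne; exact halt y hy (zmodTwo_eq_one hne)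
  obtain ⟨hxW, hvx⟩ := hx
  obtain ⟨hyW, hvy⟩ := hy
  rw [SetLike.mem_coe, LinearMap.mem_ker] at hvx hvy
  have h2 : B (v + x) (v + x) = 1 := by simp [h1, hvx, hs x v, hxx]
  refine (hcon (v + x) (W.add_mem hv hxW) h2).1 (v + y) ⟨W.add_mem hv hyW, ?_⟩ ?_
  · have : (1 : ZMod 2) + 1 = 0 := by decide
    simp [h1, hvy, hs x v, hvx, hxy, this]
  · simp [h1, hvy, hs y v, hyy]

theorem exists_diagonal_gram [FiniteDimensional (ZMod 2) V] (hs : ∀ u v, B u v = B v u) (n : ℕ) :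
    ∀ W : Submodule (ZMod 2) V, Module.finrank (ZMod 2) W = n →
      ((∃ v ∈ W, B v v = 1) ∨ ∀ u ∈ W, ∀ v ∈ W, B u v = 0) →
      ∃ (c : ℕ → V) (l : ℕ), l ≤ n ∧ Submodule.span (ZMod 2) (c '' Set.Iio n) = W ∧
        ∀ j < n, ∀ k < n, B (c j) (c k) = if j = k ∧ j < l then 1 else 0 := by
  induction n with
  | zero =>
    intro W hW _
    obtain ⟨c, hc⟩ := exists_seq_span_eq W hW
    exact ⟨c, 0, le_rfl, hc, by simp⟩
  | succ n ih =>
    rintro W hW (hnon | hzero)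
    · obtain ⟨v, hv, h1, hv'⟩ := exists_unit_vector hs hnon
      have hsup := orthogonalIn_sup_span hv h1
      have hnot : v ∉ orthogonalIn B W v := fun h => by
        have := h.2
        rw [SetLike.mem_coe, LinearMap.mem_ker, h1] at this
        exact one_ne_zero this
      have hrk := Submodule.finrank_sup_span_singleton (K := ZMod 2) hnot
      rw [hsup, hW] at hrk
      obtain ⟨c, l, hl, hspan, hc⟩ := ih (orthogonalIn B W v) (by omega) hv'
      have hmem : ∀ k < n, c k ∈ orthogonalIn B W v := fun k hk =>
        hspan ▸ Submodule.subset_span ⟨k, hk, rfl⟩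
      refine ⟨fun k => if k = 0 then v else c (k - 1), l + 1, by omega, ?_, ?_⟩
      · rw [← hsup, ← hspan, ← Submodule.span_union]
        congr 1
        ext w
        constructor
        · rintro ⟨k, hk, rfl⟩
          rw [Set.mem_Iio] at hk
          by_cases h0 : k = 0
          · right; simp [h0]
          · left
            exact ⟨k - 1, Set.mem_Iio.2 (by omega), by simp [h0]⟩
        · rintro (⟨k, hk, rfl⟩ | h)
          · exact ⟨k + 1, Set.mem_Iio.2 (by rw [Set.mem_Iio] at hk; omega), by simp⟩
          · exact ⟨0, Set.mem_Iio.2 (by omega), by simpa using h.symm⟩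
      · intro j hj k hk
        have hvc : ∀ k < n, B v (c k) = 0 := fun k hk => (hmem k hk).2
        dsimp only
        split_ifs <;> first
          | omega
          | assumption
          | rw [hvc _ (by omega)]
          | rw [hs, hvc _ (by omega)]
          | rw [hc _ (by omega) _ (by omega), if_pos (by omega)]
          | rw [hc _ (by omega) _ (by omega), if_neg (by omega)]
    · obtain ⟨c, hc⟩ := exists_seq_span_eq W hW
      refine ⟨c, 0, Nat.zero_le _, hc, fun j hj k hk => ?_⟩
      rw [hzero _ (hc ▸ Submodule.subset_span ⟨j, hj, rfl⟩) _
        (hc ▸ Submodule.subset_span ⟨k, hk, rfl⟩)]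
      simp

/-- The vector `x` goes to the front of the family and its partner `y` to position `l + 1`, so
that the antidiagonal block of size `l` grows to size `l + 2`. -/
theorem exists_antidiagonal_gram [FiniteDimensional (ZMod 2) V] (hs : ∀ u v, B u v = B v u)
    (n : ℕ) :
    ∀ W : Submodule (ZMod 2) V, Module.finrank (ZMod 2) W = n → (∀ v ∈ W, B v v = 0) →
      ∃ (c : ℕ → V) (l : ℕ), l ≤ n ∧ Submodule.span (ZMod 2) (c '' Set.Iio n) = W ∧
        ∀ j < n, ∀ k < n, B (c j) (c k) = if j + k + 1 = l then 1 else 0 := by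
  induction n using Nat.strong_induction_on with
  | _ n ih =>
    intro W hW halt
    by_cases hzero : ∀ u ∈ W, ∀ v ∈ W, B u v = 0
    · obtain ⟨c, hc⟩ := exists_seq_span_eq W hW
      refine ⟨c, 0, Nat.zero_le _, hc, fun j hj k hk => ?_⟩
      rw [hzero _ (hc ▸ Submodule.subset_span ⟨j, hj, rfl⟩) _
        (hc ▸ Submodule.subset_span ⟨k, hk, rfl⟩)]
      simp
    push Not at hzero
    obtain ⟨x, hx, y, hy, hxy⟩ := hzero
    have hxy := zmodTwo_eq_one hxy
    have hyx : B y x = 1 := by rw [hs, hxy]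
    have hxx := halt x hx
    have hyy := halt y hy
    set W' := orthogonalIn B (orthogonalIn B W x) y with hW'
    have hle : W' ≤ W := inf_le_left.trans inf_le_left
    have hsup : (W' ⊔ Submodule.span (ZMod 2) {x}) ⊔ Submodule.span (ZMod 2) {y} = W := by
      apply le_antisymm
      · refine sup_le (sup_le hle ?_) ?_ <;> rwa [Submodule.span_singleton_le_iff_mem]
      · intro w hw
        rw [Submodule.mem_sup]
        refine ⟨w - B x w • y, ?_, B x w • y,
          Submodule.smul_mem _ _ (Submodule.mem_span_singleton_self y), by abel⟩
        rw [Submodule.mem_sup]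
        refine ⟨w - B x w • y - B y w • x, ⟨⟨?_, ?_⟩, ?_⟩, B y w • x,
          Submodule.smul_mem _ _ (Submodule.mem_span_singleton_self x), by abel⟩
        · exact W.sub_mem (W.sub_mem hw (W.smul_mem _ hy)) (W.smul_mem _ hx)
        · simp [hxy, hxx]
        · simp [hyx, hyy]
    have hx' : x ∉ W' := fun h => by
      have := h.2
      rw [SetLike.mem_coe, LinearMap.mem_ker, hyx] at this
      exact one_ne_zero this
    have hy' : y ∉ W' ⊔ Submodule.span (ZMod 2) {x} := fun h => by
      have hk : W' ⊔ Submodule.span (ZMod 2) {x} ≤ LinearMap.ker (B x) := by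
        refine sup_le (inf_le_left.trans inf_le_right) ?_
        rw [Submodule.span_singleton_le_iff_mem]
        exact hxx
      have := hk h
      rw [LinearMap.mem_ker, hxy] at this
      exact one_ne_zero this
    have hrk := Submodule.finrank_sup_span_singleton (K := ZMod 2) hy'
    rw [hsup, hW, Submodule.finrank_sup_span_singleton (K := ZMod 2) hx'] at hrk
    obtain ⟨c, l, hl, hspan, hc⟩ := ih (n - 2) (by omega) W' (by omega)
      fun v hv => halt v (hle hv)
    have hmem : ∀ k < n - 2, c k ∈ W' := fun k hk =>
      hspan ▸ Submodule.subset_span ⟨k, hk, rfl⟩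
    have hxc : ∀ k < n - 2, B x (c k) = 0 := fun k hk => (hmem k hk).1.2
    have hyc : ∀ k < n - 2, B y (c k) = 0 := fun k hk => (hmem k hk).2
    refine ⟨fun k => if k = 0 then x else if k ≤ l then c (k - 1) else if k = l + 1 then y
      else c (k - 2), l + 2, by omega, ?_, ?_⟩
    · rw [← hsup, ← hspan, ← Submodule.span_union, ← Submodule.span_union]
      congr 1
      ext w
      constructor
      · rintro ⟨k, hk, rfl⟩
        rw [Set.mem_Iio] at hk
        dsimp only
        split_ifs with h0 h1 h2
        · exact Or.inl (Or.inr rfl)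
        · exact Or.inl (Or.inl ⟨k - 1, Set.mem_Iio.2 (by omega), rfl⟩)
        · exact Or.inr rfl
        · exact Or.inl (Or.inl ⟨k - 2, Set.mem_Iio.2 (by omega), rfl⟩)
      · rintro ((⟨k, hk, rfl⟩ | h) | h)
        · rw [Set.mem_Iio] at hk
          by_cases hkl : k < l
          · refine ⟨k + 1, Set.mem_Iio.2 (by omega), ?_⟩
            dsimp only
            rw [if_neg (by omega), if_pos (by omega)]
            rfl
          · refine ⟨k + 2, Set.mem_Iio.2 (by omega), ?_⟩
            dsimp only
            rw [if_neg (by omega), if_neg (by omega), if_neg (by omega)]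
            rfl
        · exact ⟨0, Set.mem_Iio.2 (by omega), by simpa using h.symm⟩
        · refine ⟨l + 1, Set.mem_Iio.2 (by omega), ?_⟩
          dsimp only
          rw [if_neg (by omega), if_neg (by omega), if_pos rfl]
          exact (Set.mem_singleton_iff.1 h).symm
    · intro j hj k hk
      dsimp only
      split_ifs <;> first
        | omega
        | assumption
        | rw [hxc _ (by omega)]
        | rw [hyc _ (by omega)]
        | rw [hs, hxc _ (by omega)]
        | rw [hs, hyc _ (by omega)]
        | rw [hc _ (by omega) _ (by omega), if_pos (by omega)]
        | rw [hc _ (by omega) _ (by omega), if_neg (by omega)]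

end Forms

/-! ### Lifting invertible matrices modulo `2` -/

theorem mod2_mul {g : ℕ} (A B : Matrix (Fin g) (Fin g) ℤ) : mod2 (A * B) = mod2 A * mod2 B := by
  simpa [mod2] using Matrix.map_mul (L := A) (M := B) (f := Int.castRingHom (ZMod 2))

theorem mod2_one {g : ℕ} : mod2 (1 : Matrix (Fin g) (Fin g) ℤ) = 1 := by
  simp [mod2]

theorem mod2_transpose {g : ℕ} (A : Matrix (Fin g) (Fin g) ℤ) : mod2 Aᵀ = (mod2 A)ᵀ := rfl

/-- `GL_g(ℤ) → GL_g(𝔽₂)` is surjective, as `GL_g(𝔽₂)` is generated by transvections. -/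
theorem exists_lift_of_det_ne_zero {g : ℕ} (A : Matrix (Fin g) (Fin g) (ZMod 2))
    (hA : A.det ≠ 0) :
    ∃ U V : Matrix (Fin g) (Fin g) ℤ, U * V = 1 ∧ mod2 U = A := by
  refine Matrix.diagonal_transvection_induction_of_det_ne_zero
    (fun A => ∃ U V : Matrix (Fin g) (Fin g) ℤ, U * V = 1 ∧ mod2 U = A) A hA ?_ ?_ ?_
  · intro D hD
    -- an invertible diagonal matrix over `𝔽₂` is the identity
    refine ⟨1, 1, by simp, ?_⟩
    rw [det_diagonal, Finset.prod_ne_zero_iff] at hD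
    have : D = 1 := funext fun i => zmodTwo_eq_one (hD i (Finset.mem_univ i))
    rw [mod2_one, this]
    exact diagonal_one.symm
  · intro t
    obtain ⟨i, j, hij, c⟩ := t
    obtain ⟨z, rfl⟩ := ZMod.intCast_surjective c
    refine ⟨transvection i j z, transvection i j (-z), ?_, ?_⟩
    · rw [transvection_mul_transvection_same _ _ hij]; simp
    · ext a b
      simp [mod2, transvection, TransvectionStruct.toMatrix, Matrix.single_apply,
        Matrix.one_apply]
  · rintro A B - - ⟨U, V, hUV, rfl⟩ ⟨U', V', hUV', rfl⟩
    refine ⟨U * U', V' * V, ?_, mod2_mul _ _⟩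
    rw [Matrix.mul_assoc, ← Matrix.mul_assoc U', hUV', Matrix.one_mul, hUV]

/-! ### The standard forms and their invariants -/

theorem standardForm_transpose (g lam : ℕ) (i : ZMod 2) :
    (standardForm g lam i)ᵀ = standardForm g lam i := by
  ext j k
  simp only [standardForm, transpose_apply, of_apply]
  split_ifs <;> first | rfl | omega

/-- The square of a standard form: the projection onto the first `λ` coordinates. -/
def headProj (g lam : ℕ) : Matrix (Fin g) (Fin g) ℤ :=
  Matrix.diagonal fun j => if (j : ℕ) < lam then 1 else 0

theorem standardForm_zero (g lam : ℕ) : standardForm g lam 0 = headProj g lam := by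
  ext j k
  simp only [standardForm, headProj, of_apply, diagonal_apply, if_true]
  split_ifs <;> first | rfl | (exfalso; grind)

theorem standardForm_mul_headProj (g lam : ℕ) (i : ZMod 2) :
    standardForm g lam i * headProj g lam = standardForm g lam i := by
  ext j k
  rw [headProj, mul_diagonal]
  simp only [standardForm, of_apply]
  split_ifs <;> first | rfl | (exfalso; grind)

theorem standardForm_mul_self {g lam : ℕ} (h : lam ≤ g) (i : ZMod 2) :
    standardForm g lam i * standardForm g lam i = headProj g lam := by
  by_cases hi : i = 0
  · conv_lhs => enter [2]; rw [hi, standardForm_zero]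
    rw [standardForm_mul_headProj, hi, standardForm_zero]
  · ext j k
    rw [mul_apply]
    simp only [standardForm, headProj, of_apply, if_neg hi, diagonal_apply]
    by_cases hj : (j : ℕ) < lam
    -- row `j` of the antidiagonal form has its one in column `λ - 1 - j`
    · rw [Finset.sum_eq_single (⟨lam - 1 - j, by omega⟩ : Fin g)]
      · rw [if_pos (by simp only []; omega), one_mul]
        by_cases hjk : j = k
        · subst hjk
          rw [if_pos (by simp only []; omega), if_pos rfl, if_pos hj]
        · rw [if_neg (by simp only []; omega), if_neg hjk]
      · intro b _ hb
        rw [if_neg, zero_mul]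
        intro h
        apply hb
        ext
        simp only []
        omega
      · simp
    · rw [Finset.sum_eq_zero]
      · split_ifs <;> rfl
      · intro b _
        rw [if_neg (by omega), zero_mul]

theorem rank_mod2_headProj {g lam : ℕ} (h : lam ≤ g) : (mod2 (headProj g lam)).rank = lam := by
  have : mod2 (headProj g lam) =
      Matrix.diagonal fun j : Fin g => if (j : ℕ) < lam then (1 : ZMod 2) else 0 := by
    ext j k
    simp only [mod2, headProj, map_apply, diagonal_apply]
    split_ifs <;> simp
  rw [this, rank_diagonal, Fintype.card_subtype]
  have h2 : (Finset.univ.filter fun j : Fin g => (if (j : ℕ) < lam then (1 : ZMod 2) else 0) ≠ 0) =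
      Finset.univ.filter fun j : Fin g => (j : ℕ) < lam := by
    ext j; simp
  rw [h2, Fin.card_filter_val_lt]
  omega

theorem rank_mod2_standardForm {g lam : ℕ} (h : lam ≤ g) (i : ZMod 2) :
    (mod2 (standardForm g lam i)).rank = lam := by
  apply le_antisymm
  · conv_lhs => rw [← standardForm_mul_headProj, mod2_mul]
    exact (rank_mul_le_right _ _).trans (rank_mod2_headProj h).le
  · conv_lhs => rw [← rank_mod2_headProj h, ← standardForm_mul_self h i, mod2_mul]
    exact rank_mul_le_left _ _

theorem diagInvariant_eq_one_iff {g : ℕ} (N : Matrix (Fin g) (Fin g) (ZMod 2)) :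
    diagInvariant N = 1 ↔ ∀ k, N k k = 0 := by
  constructor
  · intro h k
    by_contra hk
    rw [diagInvariant, Finset.prod_eq_zero (Finset.mem_univ k)] at h
    · exact zero_ne_one h
    · rw [zmodTwo_eq_one hk, sub_self]
  · intro h
    simp [diagInvariant, h]

theorem diagInvariant_eq_of_iff {g : ℕ} {N N' : Matrix (Fin g) (Fin g) (ZMod 2)}
    (h : (∀ k, N k k = 0) ↔ ∀ k, N' k k = 0) : diagInvariant N = diagInvariant N' := by
  rw [← diagInvariant_eq_one_iff, ← diagInvariant_eq_one_iff] at h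
  generalize diagInvariant N = a at *
  generalize diagInvariant N' = b at *
  revert a b; decide

theorem diagInvariant_standardForm {g lam : ℕ} {i : ZMod 2} (h : Admissible g lam i) :
    diagInvariant (mod2 (standardForm g lam i)) = i := by
  obtain ⟨hl, hodd, h0⟩ := h
  by_cases hi : i = 0
  · subst hi
    have hpos : 0 < lam := Nat.pos_of_ne_zero fun h => zero_ne_one (h0 h)
    rw [diagInvariant, Finset.prod_eq_zero (Finset.mem_univ (⟨0, by omega⟩ : Fin g))]
    simp [mod2, standardForm, hpos]
  · rw [zmodTwo_eq_one hi, diagInvariant_eq_one_iff]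
    intro k
    have : ¬ ((k : ℕ) + k + 1 = lam) := fun hk => hi (hodd ⟨k, by omega⟩)
    simp [mod2, standardForm, this]

/-! ### Congruence of symmetric integral matrices modulo `2` -/

theorem isUnit_mod2 {g : ℕ} {U V : Matrix (Fin g) (Fin g) ℤ} (hUV : U * V = 1) :
    IsUnit (mod2 U).det :=
  isUnit_det_of_right_inverse (B := mod2 V) (by rw [← mod2_mul, hUV, mod2_one])

theorem rank_mod2_congr {g : ℕ} {U V : Matrix (Fin g) (Fin g) ℤ} (hUV : U * V = 1)
    (N : Matrix (Fin g) (Fin g) ℤ) : (mod2 (U * N * Uᵀ)).rank = (mod2 N).rank := by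
  have hU := isUnit_mod2 hUV
  rw [mod2_mul, mod2_mul, mod2_transpose, rank_mul_eq_left_of_isUnit_det,
    rank_mul_eq_right_of_isUnit_det _ _ hU]
  rwa [det_transpose]

/-- A symmetric form over `𝔽₂` that vanishes on the diagonal is alternating. -/
theorem dotProduct_mulVec_self_eq_zero {g : ℕ} {N : Matrix (Fin g) (Fin g) (ZMod 2)}
    (hN : Nᵀ = N) (hd : ∀ k, N k k = 0) (x : Fin g → ZMod 2) : x ⬝ᵥ (N *ᵥ x) = 0 := by
  simp only [dotProduct, mulVec, Finset.mul_sum]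
  rw [← Finset.sum_product', Finset.univ_product_univ]
  refine Finset.sum_involution (fun p _ => (p.2, p.1)) ?_ ?_ (by simp) (by simp)
  · rintro ⟨j, k⟩ _
    have : N k j = N j k := congrFun (congrFun hN j) k
    simp only [this]
    rw [show x k * (N j k * x j) = x j * (N j k * x k) by ring]
    exact CharTwo.add_self_eq_zero _
  · rintro ⟨j, k⟩ _ hne h
    have hjk : k = j := congrArg Prod.fst h
    subst hjk
    simp [hd] at hne

theorem mod2_congr_diag {g : ℕ} {U N : Matrix (Fin g) (Fin g) ℤ} (hN : Nᵀ = N)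
    (hd : ∀ k, mod2 N k k = 0) (k : Fin g) : mod2 (U * N * Uᵀ) k k = 0 := by
  have h := dotProduct_mulVec_self_eq_zero (N := mod2 N) (by rw [← mod2_transpose, hN]) hd
    (mod2 U k)
  rw [mod2_mul, mod2_mul, mod2_transpose, Matrix.mul_assoc, ← h]
  rfl

theorem diagInvariant_mod2_congr {g : ℕ} {U V : Matrix (Fin g) (Fin g) ℤ} (hUV : U * V = 1)
    {N : Matrix (Fin g) (Fin g) ℤ} (hN : Nᵀ = N) :
    diagInvariant (mod2 (U * N * Uᵀ)) = diagInvariant (mod2 N) := by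
  refine diagInvariant_eq_of_iff ⟨fun h => ?_, fun h => mod2_congr_diag hN h⟩
  have hVU : V * U = 1 := mul_eq_one_comm.1 hUV
  have hback : V * (U * N * Uᵀ) * Vᵀ = N := by
    have : Uᵀ * Vᵀ = 1 := by rw [← transpose_mul, hVU, transpose_one]
    rw [← Matrix.mul_assoc, ← Matrix.mul_assoc, hVU, Matrix.one_mul, Matrix.mul_assoc, this,
      Matrix.mul_one]
  intro k
  have := mod2_congr_diag (U := V) (N := U * N * Uᵀ) (by simp [hN, Matrix.mul_assoc]) h k
  rwa [hback] at this

/-- The change of basis to a spanning family of `g` vectors of `𝔽₂^g` lifts to `GL_g(ℤ)`. -/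
theorem exists_lift_gram {g : ℕ} {N : Matrix (Fin g) (Fin g) ℤ} {c : ℕ → Fin g → ZMod 2}
    (hspan : Submodule.span (ZMod 2) (c '' Set.Iio g) = ⊤) :
    ∃ U V : Matrix (Fin g) (Fin g) ℤ, U * V = 1 ∧
      ∀ j k : Fin g, mod2 (U * N * Uᵀ) j k = c j ⬝ᵥ (mod2 N *ᵥ c k) := by
  have hli : LinearIndependent (ZMod 2) (Matrix.of fun j : Fin g => c j).row := by
    apply linearIndependent_of_top_le_span_of_card_eq_finrank
    · rw [← hspan]
      apply Submodule.span_mono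
      rintro _ ⟨k, hk, rfl⟩
      exact ⟨⟨k, hk⟩, rfl⟩
    · simp
  have hu := linearIndependent_rows_iff_isUnit.1 hli
  rw [isUnit_iff_isUnit_det] at hu
  obtain ⟨U, V, hUV, hU⟩ := exists_lift_of_det_ne_zero _ hu.ne_zero
  refine ⟨U, V, hUV, fun j k => ?_⟩
  rw [mod2_mul, mod2_mul, mod2_transpose, Matrix.mul_assoc, hU]
  rfl

/-- Every symmetric integral matrix is congruent modulo `2`, under `GL_g(ℤ)`, to a standard
form. -/
theorem exists_congr_standardForm {g : ℕ} {N : Matrix (Fin g) (Fin g) ℤ} (hN : Nᵀ = N) :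
    ∃ (U V : Matrix (Fin g) (Fin g) ℤ) (lam : ℕ) (i : ZMod 2), U * V = 1 ∧
      Admissible g lam i ∧ mod2 (U * N * Uᵀ) = mod2 (standardForm g lam i) := by
  let B : (Fin g → ZMod 2) →ₗ[ZMod 2] (Fin g → ZMod 2) →ₗ[ZMod 2] ZMod 2 :=
    Matrix.toLinearMap₂' (ZMod 2) (mod2 N)
  have hB : ∀ u v, B u v = u ⬝ᵥ (mod2 N *ᵥ v) := fun u v => toLinearMap₂'_apply' _ _ _
  have hN' : (mod2 N)ᵀ = mod2 N := by rw [← mod2_transpose, hN]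
  have hs : ∀ u v, B u v = B v u := by
    intro u v
    rw [hB, hB, dotProduct_mulVec, ← mulVec_transpose, hN', dotProduct_comm]
  have hrk : Module.finrank (ZMod 2) (⊤ : Submodule (ZMod 2) (Fin g → ZMod 2)) = g := by simp
  by_cases halt : ∀ v, B v v = 0
  · obtain ⟨c, l, hl, hspan, hc⟩ := exists_antidiagonal_gram hs g ⊤ hrk fun v _ => halt v
    obtain ⟨U, V, hUV, hU⟩ := exists_lift_gram (N := N) hspan
    refine ⟨U, V, l, 1, hUV, ⟨hl, ?_, fun _ => rfl⟩, ?_⟩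
    · rintro ⟨m, rfl⟩
      -- the middle entry of an antidiagonal block of odd size would lie on the diagonal
      have := hc m (by omega) m (by omega)
      rw [halt, if_pos (by omega)] at this
      exact absurd this zero_ne_one
    · ext j k
      rw [hU, ← hB, hc _ j.2 _ k.2]
      simp [mod2, standardForm]
  · push Not at halt
    obtain ⟨v, hv⟩ := halt
    have hv := zmodTwo_eq_one hv
    obtain ⟨c, l, hl, hspan, hc⟩ :=
      exists_diagonal_gram hs g ⊤ hrk (Or.inl ⟨v, trivial, hv⟩)
    obtain ⟨U, V, hUV, hU⟩ := exists_lift_gram (N := N) hspan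
    have hform : mod2 (U * N * Uᵀ) = mod2 (standardForm g l 0) := by
      ext j k
      rw [hU, ← hB, hc _ j.2 _ k.2]
      simp [mod2, standardForm, Fin.ext_iff]
    refine ⟨U, V, l, 0, hUV, ⟨hl, fun _ => rfl, fun h0 => ?_⟩, hform⟩
    subst h0
    have hd : diagInvariant (mod2 N) = 1 := by
      rw [← diagInvariant_mod2_congr hUV hN, hform, diagInvariant_eq_one_iff]
      simp [mod2, standardForm]
    rw [hB, dotProduct_mulVec_self_eq_zero hN' ((diagInvariant_eq_one_iff _).1 hd)] at hv
    exact absurd hv zero_ne_one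

/-! ### The action of `Γ_g^⋆` on `ℋ_g` -/

/-- The element `(U S ᵗV; 0 ᵗV)` of `Γ_g^⋆`, for `U V = 1` and `S` symmetric. It acts on `ℋ_g` by
`Ω ↦ U Ω ᵗU + S`. -/
def congrElement {g : ℕ} (U V S : Matrix (Fin g) (Fin g) ℤ) (hUV : U * V = 1) (hS : Sᵀ = S) :
    GammaStar g :=
  ⟨⟨Matrix.fromBlocks U (S * Vᵀ) 0 Vᵀ, by
    have h2 : Vᵀ * Uᵀ = 1 := by rw [← transpose_mul, hUV, transpose_one]
    rw [SymplecticGroup.mem_iff, Matrix.J, fromBlocks_transpose, fromBlocks_multiply,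
      fromBlocks_multiply]
    congr 1
    · simp [hS, ← Matrix.mul_assoc, hUV]
      simp [Matrix.mul_assoc, h2]
    · simp [hUV]
    · simp [h2]
    · simp⟩, by
    show (Matrix.fromBlocks U (S * Vᵀ) 0 Vᵀ).toBlocks₂₁ = 0
    rw [toBlocks_fromBlocks₂₁]⟩

theorem coe_congrElement_smul {g : ℕ} {U V S : Matrix (Fin g) (Fin g) ℤ} (hUV : U * V = 1)
    (hS : Sᵀ = S) (Ω : HSpace g) :
    (congrElement U V S hUV hS • Ω).1 = toC U * Ω.1 * (toC U)ᵀ + toC S := by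
  have h2 : toC Vᵀ * toC Uᵀ = 1 := by
    rw [← toC_mul, ← transpose_mul, hUV, transpose_one, toC_one]
  show starAct (Matrix.fromBlocks U (S * Vᵀ) 0 Vᵀ) Ω.1 = _
  rw [starAct, toBlocks_fromBlocks₁₁, toBlocks_fromBlocks₁₂, toC_mul, Matrix.mul_assoc (toC S),
    ← toC_transpose U, h2, Matrix.mul_one]

theorem proj_smul {g : ℕ} (γ : GammaStar g) (Ω : HSpace g) : proj (γ • Ω) = proj Ω :=
  Quotient.sound ⟨γ, rfl⟩

theorem proj_eq_iff {g : ℕ} {Ω Ω' : HSpace g} : proj Ω = proj Ω' ↔ ∃ γ : GammaStar g, γ • Ω = Ω' :=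
  ⟨fun h => by
    obtain ⟨γ, hγ⟩ := Quotient.exact h.symm
    exact ⟨γ, hγ⟩, fun ⟨γ, hγ⟩ => by rw [← hγ, proj_smul]⟩

theorem proj_surjective {g : ℕ} : Function.Surjective (proj : HSpace g → XSpace g) :=
  Quotient.mk_surjective

theorem continuous_proj {g : ℕ} : Continuous (proj : HSpace g → XSpace g) :=
  continuous_quotient_mk'

/-- The imaginary part `Y` of `Ω = X + iY`. -/
abbrev imPart {g : ℕ} (Ω : Matrix (Fin g) (Fin g) ℂ) : Matrix (Fin g) (Fin g) ℝ :=
  Ω.map Complex.im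

theorem halfPoint_re {g : ℕ} (M : Matrix (Fin g) (Fin g) ℤ) (Y : Matrix (Fin g) (Fin g) ℝ)
    (j k : Fin g) : (halfPoint M Y j k).re = (M j k : ℝ) / 2 := by
  simp [halfPoint, toC]; ring

theorem halfPoint_im {g : ℕ} (M : Matrix (Fin g) (Fin g) ℤ) (Y : Matrix (Fin g) (Fin g) ℝ)
    (j k : Fin g) : (halfPoint M Y j k).im = Y j k := by
  simp [halfPoint, toC]

theorem imPart_halfPoint {g : ℕ} (M : Matrix (Fin g) (Fin g) ℤ) (Y : Matrix (Fin g) (Fin g) ℝ) :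
    imPart (halfPoint M Y) = Y := by
  ext j k; exact halfPoint_im M Y j k

theorem halfPoint_mem {g : ℕ} {M : Matrix (Fin g) (Fin g) ℤ} {Y : Matrix (Fin g) (Fin g) ℝ}
    (hM : Mᵀ = M) (hY : Y.PosDef) : halfPoint M Y ∈ HSet g := by
  refine ⟨?_, (imPart_halfPoint M Y ▸ hY :), M, fun j k => by rw [halfPoint_re]; ring⟩
  have hYs : Yᵀ = Y := by
    have := hY.isHermitian.eq
    rwa [conjTranspose_eq_transpose_of_trivial] at this
  rw [halfPoint, transpose_add, transpose_smul, transpose_smul, ← toC_transpose, hM,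
    ← transpose_map, hYs]

theorem twoRe_halfPoint {g : ℕ} (M : Matrix (Fin g) (Fin g) ℤ) (Y : Matrix (Fin g) (Fin g) ℝ) :
    twoRe (halfPoint M Y) = M := by
  ext j k
  rw [twoRe, map_apply, halfPoint_re, mul_div_cancel₀ _ two_ne_zero, round_intCast]

theorem eq_halfPoint {g : ℕ} (Ω : HSpace g) : Ω.1 = halfPoint (twoRe Ω.1) (imPart Ω.1) := by
  ext j k
  apply Complex.ext
  · rw [halfPoint_re, twoRe_cast]; ring
  · rw [halfPoint_im]; rfl

theorem twoRe_transpose {g : ℕ} (Ω : HSpace g) : (twoRe Ω.1)ᵀ = twoRe Ω.1 := by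
  rw [twoRe, ← transpose_map, Ω.2.1]

theorem toR_mul {g : ℕ} (A B : Matrix (Fin g) (Fin g) ℤ) :
    (A * B).map (Int.cast : ℤ → ℝ) = A.map (Int.cast : ℤ → ℝ) * B.map (Int.cast : ℤ → ℝ) := by
  simpa using Matrix.map_mul (L := A) (M := B) (f := Int.castRingHom ℝ)

/-- `U (M/2 + iY) ᵗU + S = (U M ᵗU + 2S)/2 + i U Y ᵗU`. -/
theorem congr_halfPoint {g : ℕ} (U S M : Matrix (Fin g) (Fin g) ℤ)
    (Y : Matrix (Fin g) (Fin g) ℝ) :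
    toC U * halfPoint M Y * (toC U)ᵀ + toC S =
      halfPoint (U * M * Uᵀ + (S + S))
        (U.map (Int.cast : ℤ → ℝ) * Y * (U.map (Int.cast : ℤ → ℝ))ᵀ) := by
  have h1 : (U.map (Int.cast : ℤ → ℝ) * Y * (U.map (Int.cast : ℤ → ℝ))ᵀ).map ((↑) : ℝ → ℂ) =
      toC U * Y.map ((↑) : ℝ → ℂ) * (toC U)ᵀ := by
    ext j k
    simp [Matrix.mul_apply, toC, Finset.sum_mul]
  rw [halfPoint, halfPoint, h1, toC_add, toC_add, toC_mul, toC_mul, toC_transpose,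
    Matrix.mul_add, Matrix.add_mul, Matrix.mul_smul, Matrix.smul_mul, Matrix.mul_smul,
    Matrix.smul_mul, smul_add, add_right_comm, ← two_smul ℂ (toC S), smul_smul]
  norm_num

theorem toBlocks₁₁_right_inv {g : ℕ} (γ : GammaStar g) :
    γ.1.1.toBlocks₁₁ * γ.1.1.toBlocks₂₂ᵀ = 1 := (GammaStar.relations γ.2).1

theorem coe_smul_eq {g : ℕ} (γ : GammaStar g) (Ω : HSpace g) :
    (γ • Ω).1 = halfPoint (γ.1.1.toBlocks₁₁ * twoRe Ω.1 * γ.1.1.toBlocks₁₁ᵀ +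
        (γ.1.1.toBlocks₁₂ * γ.1.1.toBlocks₁₁ᵀ + γ.1.1.toBlocks₁₂ * γ.1.1.toBlocks₁₁ᵀ))
      (γ.1.1.toBlocks₁₁.map (Int.cast : ℤ → ℝ) * imPart Ω.1 *
        (γ.1.1.toBlocks₁₁.map (Int.cast : ℤ → ℝ))ᵀ) := by
  rw [← congr_halfPoint, ← eq_halfPoint, toC_mul, toC_transpose]
  rfl

theorem twoRe_smul {g : ℕ} (γ : GammaStar g) (Ω : HSpace g) :
    twoRe (γ • Ω).1 = γ.1.1.toBlocks₁₁ * twoRe Ω.1 * γ.1.1.toBlocks₁₁ᵀ +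
      (γ.1.1.toBlocks₁₂ * γ.1.1.toBlocks₁₁ᵀ + γ.1.1.toBlocks₁₂ * γ.1.1.toBlocks₁₁ᵀ) := by
  rw [coe_smul_eq, twoRe_halfPoint]

theorem mod2_add_self {g : ℕ} (A S : Matrix (Fin g) (Fin g) ℤ) :
    mod2 (A + (S + S)) = mod2 A := by
  ext j k
  simp [mod2, CharTwo.add_self_eq_zero]

theorem exists_eq_add_self {g : ℕ} {A B : Matrix (Fin g) (Fin g) ℤ} (hA : Aᵀ = A) (hB : Bᵀ = B)
    (h : mod2 A = mod2 B) : ∃ S : Matrix (Fin g) (Fin g) ℤ, Sᵀ = S ∧ A + (S + S) = B := by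
  have hd : ∀ j k, ∃ s : ℤ, B j k - A j k = 2 * s := fun j k => by
    have := congrFun (congrFun h j) k
    exact (ZMod.intCast_eq_intCast_iff_dvd_sub _ _ 2).1 this
  choose s hs using hd
  refine ⟨Matrix.of s, ?_, ?_⟩
  · ext j k
    have h1 := hs j k
    have h2 := hs k j
    have h3 : A k j = A j k := congrFun (congrFun hA j) k
    have h4 : B k j = B j k := congrFun (congrFun hB j) k
    rw [transpose_apply, of_apply, of_apply]
    omega
  · ext j k
    have h1 := hs j k
    simp only [Matrix.add_apply, of_apply]
    omega

/-- Every point of `ℋ_g` is equivalent to a point `M/2 + iY` with `M` a standard form. -/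
theorem exists_smul_eq_halfPoint {g : ℕ} (Ω : HSpace g) :
    ∃ (γ : GammaStar g) (lam : ℕ) (i : ZMod 2) (Y : Matrix (Fin g) (Fin g) ℝ),
      Admissible g lam i ∧ Y.PosDef ∧ (γ • Ω).1 = halfPoint (standardForm g lam i) Y := by
  obtain ⟨U, V, lam, i, hUV, hadm, hmod⟩ := exists_congr_standardForm (twoRe_transpose Ω)
  obtain ⟨S, hS, hadd⟩ := exists_eq_add_self
    (by simp [twoRe_transpose, Matrix.mul_assoc]) (standardForm_transpose g lam i) hmod
  have hcoe : (congrElement U V S hUV hS • Ω).1 = halfPoint (standardForm g lam i)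
      (U.map (Int.cast : ℤ → ℝ) * imPart Ω.1 * (U.map (Int.cast : ℤ → ℝ))ᵀ) := by
    rw [coe_congrElement_smul, ← hadd, ← congr_halfPoint, ← eq_halfPoint]
  refine ⟨congrElement U V S hUV hS, lam, i, _, hadm, ?_, hcoe⟩
  rw [← imPart_halfPoint (standardForm g lam i) (_ * _), ← hcoe]
  exact (congrElement U V S hUV hS • Ω).2.2.1

/-! ### The connected components of `𝒳_ℝ^g` -/

/-- `Ω` has the invariants `(λ, i)`. -/
def HasInvariants {g : ℕ} (lam : ℕ) (i : ZMod 2) (Ω : HSpace g) : Prop :=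
  (mod2 (twoRe Ω.1)).rank = lam ∧ diagInvariant (mod2 (twoRe Ω.1)) = i

theorem hasInvariants_smul {g lam : ℕ} {i : ZMod 2} (γ : GammaStar g) (Ω : HSpace g) :
    HasInvariants lam i (γ • Ω) ↔ HasInvariants lam i Ω := by
  rw [HasInvariants, HasInvariants, twoRe_smul, mod2_add_self,
    rank_mod2_congr (toBlocks₁₁_right_inv γ),
    diagInvariant_mod2_congr (toBlocks₁₁_right_inv γ) (twoRe_transpose Ω)]

theorem proj_mem_component {g lam : ℕ} {i : ZMod 2} {Ω : HSpace g} :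
    proj Ω ∈ component g lam i ↔ HasInvariants lam i Ω := by
  constructor
  · rintro ⟨Ω', h, hp⟩
    obtain ⟨γ, rfl⟩ := proj_eq_iff.1 hp
    exact (hasInvariants_smul γ Ω').2 h
  · exact fun h => ⟨Ω, h, rfl⟩

theorem hasInvariants_halfPoint {g lam : ℕ} {i : ZMod 2} (h : Admissible g lam i)
    {Y : Matrix (Fin g) (Fin g) ℝ} (hΩ : halfPoint (standardForm g lam i) Y ∈ HSet g) :
    HasInvariants lam i ⟨_, hΩ⟩ := by
  rw [HasInvariants, twoRe_halfPoint]
  exact ⟨rank_mod2_standardForm h.1 i, diagInvariant_standardForm h⟩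

/-- The point of `ℋ_g` with standard real part `M/2` and imaginary part `Y`. -/
noncomputable def standardPoint (g lam : ℕ) (i : ZMod 2)
    (Y : {Y : Matrix (Fin g) (Fin g) ℝ // Y.PosDef}) : HSpace g :=
  ⟨halfPoint (standardForm g lam i) Y.1, halfPoint_mem (standardForm_transpose g lam i) Y.2⟩

theorem exists_smul_eq_standardPoint {g : ℕ} (Ω : HSpace g) :
    ∃ (γ : GammaStar g) (lam : ℕ) (i : ZMod 2) (Y : _),
      Admissible g lam i ∧ γ • Ω = standardPoint g lam i Y := by
  obtain ⟨γ, lam, i, Y, hadm, hY, h⟩ := exists_smul_eq_halfPoint Ω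
  exact ⟨γ, lam, i, ⟨Y, hY⟩, hadm, Subtype.ext h⟩

theorem component_eq_range {g lam : ℕ} {i : ZMod 2} (h : Admissible g lam i) :
    component g lam i = Set.range fun Y => proj (standardPoint g lam i Y) := by
  apply Set.Subset.antisymm
  · rintro _ ⟨Ω, hΩ, rfl⟩
    obtain ⟨γ, lam', i', Y, hadm, hγ⟩ := exists_smul_eq_standardPoint Ω
    have h1 : HasInvariants lam' i' (γ • Ω) := hγ ▸ hasInvariants_halfPoint hadm _
    rw [hasInvariants_smul] at h1
    obtain rfl : lam' = lam := h1.1.symm.trans hΩ.1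
    obtain rfl : i' = i := h1.2.symm.trans hΩ.2
    exact ⟨Y, (congrArg proj hγ).symm.trans (proj_smul γ Ω)⟩
  · rintro _ ⟨Y, rfl⟩
    exact proj_mem_component.2 (hasInvariants_halfPoint h _)

theorem exists_mem_component {g : ℕ} (x : XSpace g) :
    ∃ (lam : ℕ) (i : ZMod 2), Admissible g lam i ∧ x ∈ component g lam i := by
  obtain ⟨Ω, rfl⟩ := proj_surjective x
  obtain ⟨γ, lam, i, Y, hadm, hγ⟩ := exists_smul_eq_standardPoint Ω
  refine ⟨lam, i, hadm, ?_⟩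
  rw [← proj_smul γ, hγ]
  exact proj_mem_component.2 (hasInvariants_halfPoint hadm _)

theorem continuous_standardPoint (g lam : ℕ) (i : ZMod 2) :
    Continuous (standardPoint g lam i) := by
  refine Continuous.subtype_mk ?_ _
  refine continuous_pi fun j => continuous_pi fun k => ?_
  simp only [halfPoint, Matrix.add_apply, Matrix.smul_apply, map_apply]
  have : Continuous fun Y : {Y : Matrix (Fin g) (Fin g) ℝ // Y.PosDef} => Y.1 j k :=
    (continuous_apply_apply j k).comp continuous_subtype_val
  exact continuous_const.add ((Complex.continuous_ofReal.comp this).const_smul Complex.I)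

theorem isPreconnected_posDef (g : ℕ) :
    IsPreconnected {Y : Matrix (Fin g) (Fin g) ℝ | Y.PosDef} := by
  apply Convex.isPreconnected
  intro A hA B hB a b ha hb hab
  rcases ha.eq_or_lt with rfl | ha
  · rw [zero_add] at hab
    subst hab
    simpa using hB
  · exact (hA.smul ha).add_posSemidef (hB.posSemidef.smul hb)

theorem isPreconnected_component {g lam : ℕ} {i : ZMod 2} (h : Admissible g lam i) :
    IsPreconnected (component g lam i) := by
  have : PreconnectedSpace {Y : Matrix (Fin g) (Fin g) ℝ // Y.PosDef} :=
    Subtype.preconnectedSpace (isPreconnected_posDef g)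
  rw [component_eq_range h]
  exact isPreconnected_range (continuous_proj.comp (continuous_standardPoint g lam i))

theorem continuous_twoRe (g : ℕ) :
    Continuous fun (Ω : HSpace g) (j k : Fin g) => twoRe Ω.1 j k := by
  refine continuous_pi fun j => continuous_pi fun k => ?_
  rw [Int.isClosedEmbedding_coe_real.isEmbedding.continuous_iff]
  have : ((fun n : ℤ => (n : ℝ)) ∘ fun Ω : HSpace g => twoRe Ω.1 j k) =
      fun Ω => 2 * (Ω.1 j k).re := funext fun Ω => twoRe_cast Ω j k
  rw [this]
  have h2 : Continuous fun Ω : HSpace g => Ω.1 j k :=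
    (continuous_apply_apply j k).comp continuous_subtype_val
  exact continuous_const.mul (Complex.continuous_re.comp h2)

theorem eventually_twoRe_eq {g : ℕ} (Ω : HSpace g) : ∀ᶠ Ω' in 𝓝 Ω, twoRe Ω'.1 = twoRe Ω.1 :=
  (continuous_twoRe g).continuousAt.eventually_mem
    ((isOpen_discrete {fun j k => twoRe Ω.1 j k}).mem_nhds rfl)

theorem isClopen_component (g lam : ℕ) (i : ZMod 2) : IsClopen (component g lam i) := by
  have hq : Topology.IsQuotientMap (proj : HSpace g → XSpace g) := isQuotientMap_quotient_mk'
  have hpre : (proj : HSpace g → XSpace g) ⁻¹' component g lam i =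
      (fun (Ω : HSpace g) (j k : Fin g) => twoRe Ω.1 j k) ⁻¹'
        {N | (mod2 (Matrix.of N)).rank = lam ∧ diagInvariant (mod2 (Matrix.of N)) = i} := by
    ext Ω
    exact proj_mem_component
  rw [← hq.isClopen_preimage, hpre]
  exact (isClopen_discrete _).preimage (continuous_twoRe g)

theorem connectedComponent_eq_component {g lam : ℕ} {i : ZMod 2} (h : Admissible g lam i)
    {x : XSpace g} (hx : x ∈ component g lam i) : connectedComponent x = component g lam i :=
  ((isClopen_component g lam i).connectedComponent_subset hx).antisymm
    ((isPreconnected_component h).subset_connectedComponent hx)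

/-! ### Injectivity of the period map -/

/-- A continuous map from `ℂ^g` to a discrete subgroup which fixes the origin vanishes. -/
theorem eq_zero_of_forall_mem {g : ℕ} {L : Submodule ℤ (CVec g)} [DiscreteTopology L]
    {G : CVec g → CVec g} (hG : Continuous G) (h0 : G 0 = 0) (hmem : ∀ v, G v ∈ L)
    (v : CVec g) : G v = 0 := by
  have := PreconnectedSpace.constant inferInstance (hG.subtype_mk hmem) (x := v) (y := 0)
  rw [← h0]
  exact congrArg Subtype.val this

theorem toC_injective {g : ℕ} : Function.Injective (toC : Matrix (Fin g) (Fin g) ℤ → _) := by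
  intro A B h
  ext j k
  have := congrFun (congrFun h j) k
  simpa [toC] using this

theorem star_intCast_vec {g : ℕ} (y : Fin g → ℤ) :
    star (fun i => (y i : ℂ) : CVec g) = fun i => (y i : ℂ) := by
  ext i; simp

/-- The real points of the lattice `Ω ℤ^g + ℤ^g` are those of `ℤ^g`. -/
theorem exists_int_of_mem_periodLattice {g : ℕ} {Ω : Matrix (Fin g) (Fin g) ℂ} (hΩ : Ω ∈ HSet g)
    {v : CVec g} (hv : v ∈ periodLattice Ω) (hr : ∀ i, (v i).im = 0) :
    ∃ y : Fin g → ℤ, v = fun i => (y i : ℂ) := by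
  obtain ⟨x, y, rfl⟩ := (mem_periodLattice Ω v).1 hv
  have hx : imPart Ω *ᵥ (fun i => (x i : ℝ)) = 0 := by
    ext i
    have := hr i
    simp [mulVec, dotProduct] at this ⊢
    exact this
  have hx0 : (fun i => (x i : ℝ)) = 0 := by
    have := congrArg ((imPart Ω)⁻¹ *ᵥ ·) hx
    simpa [mulVec_mulVec, nonsing_inv_mul _ (isUnit_im_det hΩ)] using this
  refine ⟨y, ?_⟩
  have : (fun i => (x i : ℂ)) = 0 := by
    ext i
    have := congrFun hx0 i
    simpa using this
  rw [this, mulVec_zero, zero_add]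

theorem intCast_mem_periodLattice {g : ℕ} (Ω : Matrix (Fin g) (Fin g) ℂ) (y : Fin g → ℤ) :
    (fun i => (y i : ℂ)) ∈ periodLattice Ω :=
  (mem_periodLattice Ω _).2 ⟨0, y, by ext i; simp [mulVec, dotProduct]⟩

theorem mulVec_intCast_mem_periodLattice {g : ℕ} (Ω : Matrix (Fin g) (Fin g) ℂ) (x : Fin g → ℤ) :
    (Ω *ᵥ fun i => (x i : ℂ)) ∈ periodLattice Ω :=
  (mem_periodLattice Ω _).2 ⟨x, 0, by ext i; simp⟩

/-- A complex linear map that commutes with conjugation and maps `Ω ℤ^g + ℤ^g` into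
`Ω' ℤ^g + ℤ^g` is given by an integral matrix. -/
theorem exists_integral_matrix {g : ℕ} {Ω Ω' : Matrix (Fin g) (Fin g) ℂ} (hΩ' : Ω' ∈ HSet g)
    (φ : CVec g →ₗ[ℂ] CVec g) (hlat : ∀ v ∈ periodLattice Ω, φ v ∈ periodLattice Ω')
    (hstar : ∀ v, star (φ v) = φ (star v)) :
    ∃ U : Matrix (Fin g) (Fin g) ℤ, ∀ v, φ v = toC U *ᵥ v := by
  have h : ∀ j : Fin g, ∃ u : Fin g → ℤ, φ (Pi.single j 1) = fun i => (u i : ℂ) := by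
    intro j
    have hs : (Pi.single j 1 : CVec g) = fun i => (((Pi.single j 1 : Fin g → ℤ) i : ℤ) : ℂ) := by
      ext i
      by_cases hij : i = j
      · subst hij; simp
      · simp [hij]
    refine exists_int_of_mem_periodLattice hΩ' (hlat _ ?_) fun i => ?_
    · rw [hs]; exact intCast_mem_periodLattice Ω _
    · have := congrFun (hstar (Pi.single j 1)) i
      rw [hs, star_intCast_vec, ← hs] at this
      exact Complex.conj_eq_iff_im.1 this
  choose u hu using h
  refine ⟨Matrix.of fun i j => u j i, fun v => ?_⟩
  have : φ = (toC (Matrix.of fun i j => u j i)).mulVecLin := by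
    apply LinearMap.pi_ext'
    intro j
    ext i
    simp [hu, toC]
  rw [this]
  rfl

theorem periodForm_I_smul_ofReal {g : ℕ} (Ω : Matrix (Fin g) (Fin g) ℂ) (a b : Fin g → ℝ) :
    periodForm Ω (Complex.I • fun i => (a i : ℂ)) (fun i => (b i : ℂ)) =
      a ⬝ᵥ ((imPart Ω)⁻¹ *ᵥ b) := by
  rw [periodForm_apply]
  simp [dotProduct]

/-- A real isomorphism between two period triples is given by a matrix `U ∈ GL_g(ℤ)`, and then
`Ω' - U Ω ᵗU` is integral. -/
theorem proj_eq_of_isIsomorphic {g : ℕ} {Ω Ω' : HSpace g}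
    (h : IsIsomorphic (RealPPAV.ofPeriod Ω) (RealPPAV.ofPeriod Ω')) : proj Ω = proj Ω' := by
  obtain ⟨φ, h1, h2, h3⟩ := h
  change ∀ v, φ v ∈ periodLattice Ω'.1 ↔ v ∈ periodLattice Ω.1 at h1
  change ∀ u v, periodForm Ω'.1 (φ u) (φ v) = periodForm Ω.1 u v at h2
  have hdisc := periodLattice_discrete Ω'.2
  have hφ : Continuous φ := φ.toLinearMap.continuous_of_finiteDimensional
  have hstar : ∀ v, star (φ v) = φ (star v) := by
    intro v
    refine sub_eq_zero.1 (eq_zero_of_forall_mem (L := periodLattice Ω'.1)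
      (G := fun v => star (φ v) - φ (star v)) ?_ (by simp) (fun v => ?_) v)
    · exact (continuous_star.comp hφ).sub (hφ.comp continuous_star)
    · exact sub_mem_of_mkQ_eq ((sigma_mkQ Ω'.2 _).symm.trans (h3 v (star v) (sigma_mkQ Ω.2 v)))
  obtain ⟨U, hU⟩ := exists_integral_matrix Ω'.2 φ.toLinearMap (fun v hv => (h1 v).2 hv) hstar
  obtain ⟨V, hV⟩ := exists_integral_matrix Ω.2 φ.symm.toLinearMap
    (fun v hv => (h1 _).1 (by simpa using hv)) (fun v => by
      apply φ.injective
      have := hstar (φ.symm v)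
      simp only [LinearEquiv.apply_symm_apply] at this
      simpa using this.symm)
  change ∀ v, φ v = _ at hU
  change ∀ v, φ.symm v = _ at hV
  have hUV : U * V = 1 := by
    apply toC_injective
    rw [toC_mul, toC_one]
    apply Matrix.toLin'.injective
    ext1 j
    ext1
    simp [toLin'_mul, ← hU, ← hV]
  -- compare the imaginary parts through the polarizations
  set UR : Matrix (Fin g) (Fin g) ℝ := U.map (Int.cast : ℤ → ℝ) with hUR
  have hreal : ∀ a : Fin g → ℝ, φ (fun i => (a i : ℂ)) = fun i => (((UR *ᵥ a) i : ℝ) : ℂ) := by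
    intro a
    rw [hU]
    ext i
    simp [mulVec, dotProduct, toC, hUR]
  have hinv : URᵀ * (imPart Ω'.1)⁻¹ * UR = (imPart Ω.1)⁻¹ := by
    apply (Matrix.toLinearMap₂' ℝ : Matrix (Fin g) (Fin g) ℝ ≃ₗ[ℝ]
      ((Fin g → ℝ) →ₗ[ℝ] (Fin g → ℝ) →ₗ[ℝ] ℝ)).injective
    refine LinearMap.ext₂ fun a b => ?_
    rw [toLinearMap₂'_apply', toLinearMap₂'_apply', ← periodForm_I_smul_ofReal, ← h2, map_smul,
      hreal, hreal, periodForm_I_smul_ofReal, ← mulVec_mulVec, ← mulVec_mulVec,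
      dotProduct_mulVec a, vecMul_transpose]
  have hURV : UR * V.map (Int.cast : ℤ → ℝ) = 1 := by
    rw [hUR, ← toR_mul, hUV]; simp
  have hdet : IsUnit UR.det := isUnit_det_of_right_inverse hURV
  have him : UR * imPart Ω.1 * URᵀ = imPart Ω'.1 := by
    have h4 : (imPart Ω.1)⁻¹⁻¹ = imPart Ω.1 := nonsing_inv_nonsing_inv _ (isUnit_im_det Ω.2)
    have h5 : (imPart Ω'.1)⁻¹⁻¹ = imPart Ω'.1 := nonsing_inv_nonsing_inv _ (isUnit_im_det Ω'.2)
    have hdet' : IsUnit URᵀ.det := by rwa [det_transpose]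
    rw [← h4, ← hinv, Matrix.mul_inv_rev, Matrix.mul_inv_rev, h5, ← Matrix.mul_assoc,
      mul_nonsing_inv _ hdet, Matrix.one_mul, Matrix.mul_assoc, nonsing_inv_mul _ hdet',
      Matrix.mul_one]
  -- the difference `Ω' - U Ω ᵗU` is real, and its columns lie in the lattice of `Ω'`
  have hcol : ∀ j, ∃ s : Fin g → ℤ,
      (fun i => (Ω'.1 - toC U * Ω.1 * (toC U)ᵀ) i j) = fun i => (s i : ℂ) := by
    intro j
    have hs : ∀ A : Matrix (Fin g) (Fin g) ℂ, (fun i => A i j) =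
        A *ᵥ fun i => (((Pi.single j 1 : Fin g → ℤ) i : ℤ) : ℂ) := by
      intro A
      ext i
      simp [mulVec, dotProduct, Pi.single_apply]
    refine exists_int_of_mem_periodLattice Ω'.2 ?_ fun i => ?_
    · rw [hs, sub_mulVec]
      refine Submodule.sub_mem _ (mulVec_intCast_mem_periodLattice _ _) ?_
      rw [← mulVec_mulVec, ← mulVec_mulVec, ← hU, h1]
      have : (toC U)ᵀ *ᵥ (fun i => (((Pi.single j 1 : Fin g → ℤ) i : ℤ) : ℂ)) =
          fun i => (((Uᵀ *ᵥ (Pi.single j 1 : Fin g → ℤ)) i : ℤ) : ℂ) := by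
        ext i
        simp [mulVec, dotProduct, toC]
      rw [this]
      exact mulVec_intCast_mem_periodLattice _ _
    · have h6 := congrFun (congrFun him i) j
      have h7 : (toC U * Ω.1 * (toC U)ᵀ) i j =
          halfPoint (U * twoRe Ω.1 * Uᵀ) (UR * imPart Ω.1 * URᵀ) i j := by
        have := congr_halfPoint U 0 (twoRe Ω.1) (imPart Ω.1)
        rw [← eq_halfPoint] at this
        simp only [toC, Matrix.map_zero, Int.cast_zero, add_zero] at this
        exact congrFun (congrFun this i) j
      rw [Matrix.sub_apply, Complex.sub_im, h7, halfPoint_im, h6]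
      simp
  choose s hs using hcol
  have hS : Ω'.1 - toC U * Ω.1 * (toC U)ᵀ = toC (Matrix.of fun i j => s j i) := by
    ext i j
    exact congrFun (hs j) i
  have hSt : (Matrix.of fun i j => s j i : Matrix (Fin g) (Fin g) ℤ)ᵀ =
      Matrix.of fun i j => s j i := by
    apply toC_injective
    rw [toC_transpose, ← hS, transpose_sub, transpose_mul, transpose_mul, transpose_transpose,
      Ω.2.1, Ω'.2.1, Matrix.mul_assoc]
  refine proj_eq_iff.2 ⟨congrElement U V _ hUV hSt, Subtype.ext ?_⟩
  rw [coe_congrElement_smul, ← hS]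
  abel

theorem isoClass_mk_eq {g : ℕ} {A B : RealPPAV g} :
    IsoClass.mk A = IsoClass.mk B ↔ IsIsomorphic A B :=
  ⟨fun h => Quotient.exact h, fun h => Quotient.sound h⟩

theorem classMap_injective (g : ℕ) : Function.Injective (classMap : XSpace g → IsoClass g) := by
  intro x y h
  obtain ⟨Ω, rfl⟩ := proj_surjective x
  obtain ⟨Ω', rfl⟩ := proj_surjective y
  exact proj_eq_of_isIsomorphic (isoClass_mk_eq.1 h)

/-! ### The linear lift of a real structure -/

/-- The data which the lift `σ` of a real structure to `ℂ^g` provides: an antilinear involution of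
`ℂ^g` that preserves the lattice and changes the sign of the polarization. -/
structure IsLinearRealStructure {g : ℕ} (L : Submodule ℤ (CVec g))
    (E : CVec g →ₗ[ℝ] CVec g →ₗ[ℝ] ℝ) (σ : CVec g →ₗ[ℝ] CVec g) : Prop where
  antilinear : ∀ v, σ (Complex.I • v) = -(Complex.I • σ v)
  involutive : ∀ v, σ (σ v) = v
  map_mem : ∀ v ∈ L, σ v ∈ L
  pol : ∀ u v, E (σ u) (σ v) = -E u v

/-- A complex differentiable real linear map is complex linear. -/
theorem map_I_smul_of_differentiableAt {g : ℕ} (T : CVec g →L[ℝ] CVec g)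
    (h : DifferentiableAt ℂ T 0) (v : CVec g) : T (Complex.I • v) = Complex.I • T v := by
  have h1 : HasFDerivAt T ((fderiv ℂ T 0).restrictScalars ℝ) 0 :=
    h.hasFDerivAt.restrictScalars ℝ
  have h2 := T.hasFDerivAt.unique h1
  rw [h2]
  simp

theorem exists_linearRealStructure {g : ℕ} (A : RealPPAV g) :
    ∃ σ : CVec g →ₗ[ℝ] CVec g, IsLinearRealStructure A.lattice A.pol σ ∧
      ∀ v, A.real (A.lattice.mkQ v) = A.lattice.mkQ (σ v) := by
  have := A.discrete
  have := A.isZLattice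
  obtain ⟨F, hF, hE⟩ := A.isReal
  have hS := A.isRealStructure
  have hadd := hF.map_add hS.antiholomorphic
  let σ : CVec g →L[ℝ] CVec g :=
    (⟨⟨F, hF.map_zero⟩, hadd⟩ : CVec g →+ CVec g).toRealLinearMap hF.continuous
  have hσ : ∀ v, σ v = F v := fun _ => rfl
  have hmem : ∀ v ∈ A.lattice, σ v ∈ A.lattice := by
    intro v hv
    have h0 : A.lattice.mkQ v = 0 := by simpa using hv
    have := hF.mk_eq v
    rw [h0, hS.map_zero] at this
    have h2 : F v ∈ A.lattice := by simpa using this.symm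
    exact h2
  refine ⟨σ, ⟨fun v => ?_, fun v => ?_, hmem, fun u v => ?_⟩, hF.mk_eq⟩
  · let T : CVec g →L[ℝ] CVec g := (starL' ℝ : CVec g ≃L[ℝ] CVec g).toContinuousLinearMap.comp σ
    have hT : ∀ v, T v = star (σ v) := fun _ => rfl
    have h1 := map_I_smul_of_differentiableAt T (hF.differentiable hS.antiholomorphic 0) v
    rw [hT, hT] at h1
    have h2 := congrArg star h1
    rw [star_star] at h2
    change σ (Complex.I • v) = _
    rw [h2]
    ext i
    simp
  · refine sub_eq_zero.1 (eq_zero_of_forall_mem (L := A.lattice) (G := fun v => σ (σ v) - v)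
      ((σ.continuous.comp σ.continuous).sub continuous_id) (by simp) (fun v => ?_) v)
    apply sub_mem_of_mkQ_eq
    rw [hσ, ← hF.mk_eq, hσ, ← hF.mk_eq, hS.involutive]
  · have hspan : Submodule.span ℝ (A.lattice : Set (CVec g)) = ⊤ := IsZLattice.span_top
    have h1 : A.pol.compl₁₂ (σ : CVec g →ₗ[ℝ] CVec g) (σ : CVec g →ₗ[ℝ] CVec g) = -A.pol := by
      refine LinearMap.ext_on hspan fun a ha => LinearMap.ext_on hspan fun b hb => ?_
      exact hE a ha b hb
    exact LinearMap.congr_fun₂ h1 u v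

/-! ### A symplectic basis adapted to the real structure -/

/-- The vectors fixed by `σ`. -/
noncomputable def fixedSpace {g : ℕ} (σ : CVec g →ₗ[ℝ] CVec g) : Submodule ℝ (CVec g) :=
  LinearMap.ker (σ - LinearMap.id)

theorem mem_fixedSpace {g : ℕ} {σ : CVec g →ₗ[ℝ] CVec g} {v : CVec g} :
    v ∈ fixedSpace σ ↔ σ v = v := by
  simp [fixedSpace, sub_eq_zero]

section Frame

variable {g : ℕ} {L : Submodule ℤ (CVec g)} {E : CVec g →ₗ[ℝ] CVec g →ₗ[ℝ] ℝ}
  {σ : CVec g →ₗ[ℝ] CVec g}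

theorem IsLinearRealStructure.add_mem_fixedSpace (hσ : IsLinearRealStructure L E σ) (v : CVec g) :
    v + σ v ∈ fixedSpace σ := by
  rw [mem_fixedSpace, map_add, hσ.involutive, add_comm]

theorem IsLinearRealStructure.map_smul_complex (hσ : IsLinearRealStructure L E σ) (z : ℂ)
    (v : CVec g) : σ (z • v) = conj z • σ v := by
  have h : z • v = z.re • v + z.im • (Complex.I • v) := by
    rw [← Complex.coe_smul, ← Complex.coe_smul, smul_smul, ← add_smul, Complex.re_add_im]
  have h' : conj z = z.re - z.im * Complex.I := by
    rw [← Complex.conj_re z, ← neg_neg z.im, ← Complex.conj_im z]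
    push_cast
    rw [neg_mul, sub_neg_eq_add, Complex.re_add_im]
  rw [h, map_add, map_smul, map_smul, hσ.antilinear, h', sub_smul, mul_smul, Complex.coe_smul,
    Complex.coe_smul, smul_neg, sub_eq_add_neg]

/-- `ℂ^g = V₊ + i V₊`, where `V₊` is the fixed space of `σ`. -/
theorem IsLinearRealStructure.exists_re_im (hσ : IsLinearRealStructure L E σ) (v : CVec g) :
    ∃ a ∈ fixedSpace σ, ∃ b ∈ fixedSpace σ, v = a + Complex.I • b := by
  refine ⟨(1 / 2 : ℝ) • (v + σ v), Submodule.smul_mem _ _ (hσ.add_mem_fixedSpace v),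
    (1 / 2 : ℝ) • (-(Complex.I • v) + σ (-(Complex.I • v))),
    Submodule.smul_mem _ _ (hσ.add_mem_fixedSpace _), ?_⟩
  rw [map_neg, hσ.antilinear]
  ext i
  simp
  linear_combination ((1 / 2) * (v i) - (1 / 2) * σ v i) * Complex.I_sq

/-- The fixed lattice `L ∩ V₊` has a `ℤ`-basis which is a complex basis of `ℂ^g`. -/
theorem IsLinearRealStructure.exists_fixed_basis [DiscreteTopology L] [IsZLattice ℝ L]
    (hσ : IsLinearRealStructure L E σ) :
    ∃ f : Module.Basis (Fin g) ℂ (CVec g), (∀ j, f j ∈ L) ∧ (∀ j, σ (f j) = f j) ∧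
      ∀ l ∈ L, σ l = l → ∃ n : Fin g → ℤ, l = ∑ j, n j • f j := by
  let W := fixedSpace σ
  let Λ : Submodule ℤ W := ZLattice.comap ℝ L W.subtype
  have hΛ : ∀ w : W, w ∈ Λ ↔ (w : CVec g) ∈ L := fun w => Iff.rfl
  have hd : DiscreteTopology Λ :=
    ZLattice.comap_discreteTopology ℝ L continuous_subtype_val W.injective_subtype
  have hspan : Submodule.span ℝ (Λ : Set W) = ⊤ := by
    -- `v = (v + σ v)/2` on `V₊`, and `l + σ l` lies in `L ∩ V₊` for `l ∈ L`
    let p : CVec g →ₗ[ℝ] W :=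
      LinearMap.codRestrict W (LinearMap.id + σ) fun v => hσ.add_mem_fixedSpace v
    have hp : Submodule.map p ⊤ ≤ Submodule.span ℝ (Λ : Set W) := by
      rw [← IsZLattice.span_top (K := ℝ) (L := L), Submodule.map_span]
      apply Submodule.span_mono
      rintro _ ⟨l, hl, rfl⟩
      exact L.add_mem hl (hσ.map_mem l hl)
    rw [eq_top_iff]
    intro w _
    have hw : w = p ((1 / 2 : ℝ) • (w : CVec g)) := by
      apply Subtype.ext
      show (w : CVec g) = (1 / 2 : ℝ) • (w : CVec g) + σ ((1 / 2 : ℝ) • (w : CVec g))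
      rw [map_smul, mem_fixedSpace.1 w.2, ← add_smul]
      norm_num
    rw [hw]
    exact hp ⟨_, trivial, rfl⟩
  have hz : IsZLattice ℝ Λ := ⟨hspan⟩
  let fZ := Module.Free.chooseBasis ℤ Λ
  let fR := fZ.ofZLatticeBasis ℝ Λ
  have hfR : ∀ j, fR j = (fZ j : W) := fun j => fZ.ofZLatticeBasis_apply ℝ Λ j
  have hfix : ∀ j, σ (fR j : W) = (fR j : W) := fun j => mem_fixedSpace.1 (fR j).2
  have hli : LinearIndependent ℂ fun j => ((fR j : W) : CVec g) := by
    rw [Fintype.linearIndependent_iff]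
    intro c hc
    have hconj : ∑ j, conj (c j) • ((fR j : W) : CVec g) = 0 := by
      have := congrArg σ hc
      rw [map_sum, map_zero] at this
      simpa only [hσ.map_smul_complex, hfix] using this
    have hre0 : ∑ j, (c j).re • ((fR j : W) : CVec g) = 0 := by
      have h : ∑ j, (c j).re • ((fR j : W) : CVec g) = (1 / 2 : ℂ) •
          (∑ j, c j • ((fR j : W) : CVec g) + ∑ j, conj (c j) • ((fR j : W) : CVec g)) := by
        rw [← Finset.sum_add_distrib, Finset.smul_sum]
        refine Finset.sum_congr rfl fun j _ => ?_
        rw [← add_smul, smul_smul, ← Complex.coe_smul, Complex.re_eq_add_conj]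
        congr 1
        ring
      rw [h, hc, hconj, add_zero, smul_zero]
    have him0 : ∑ j, (c j).im • ((fR j : W) : CVec g) = 0 := by
      have h : ∑ j, (c j).im • ((fR j : W) : CVec g) = (1 / (2 * Complex.I) : ℂ) •
          (∑ j, c j • ((fR j : W) : CVec g) - ∑ j, conj (c j) • ((fR j : W) : CVec g)) := by
        rw [← Finset.sum_sub_distrib, Finset.smul_sum]
        refine Finset.sum_congr rfl fun j _ => ?_
        rw [← sub_smul, smul_smul, ← Complex.coe_smul, Complex.im_eq_sub_conj]
        congr 1
        ring
      rw [h, hc, hconj, sub_zero, smul_zero]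
    have hind : ∀ a : Module.Free.ChooseBasisIndex ℤ Λ → ℝ,
        ∑ j, a j • ((fR j : W) : CVec g) = 0 → ∀ j, a j = 0 := by
      intro a ha
      refine Fintype.linearIndependent_iff.1 fR.linearIndependent a (Subtype.ext ?_)
      simpa using ha
    exact fun j => Complex.ext (hind _ hre0 j) (hind _ him0 j)
  have hmemspan : ∀ w : W, (w : CVec g) ∈
      Submodule.span ℂ (Set.range fun j => ((fR j : W) : CVec g)) := by
    intro w
    have h := congrArg Subtype.val (fR.sum_repr w)
    rw [← h]
    simp only [Submodule.coe_sum, Submodule.coe_smul]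
    refine Submodule.sum_mem _ fun j _ => ?_
    rw [← Complex.coe_smul]
    exact Submodule.smul_mem _ _ (Submodule.subset_span ⟨j, rfl⟩)
  have hsp : ⊤ ≤ Submodule.span ℂ (Set.range fun j => ((fR j : W) : CVec g)) := by
    intro v _
    obtain ⟨a, ha, b, hb, rfl⟩ := hσ.exists_re_im v
    exact Submodule.add_mem _ (hmemspan ⟨a, ha⟩)
      (Submodule.smul_mem _ _ (hmemspan ⟨b, hb⟩))
  let fC := Module.Basis.mk hli hsp
  have hcard : Fintype.card (Module.Free.ChooseBasisIndex ℤ Λ) = g := by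
    rw [← Module.finrank_eq_card_basis fC]; simp
  let e := Fintype.equivFinOfCardEq hcard
  have hf : ∀ j, fC.reindex e j = ((fZ (e.symm j) : W) : CVec g) := by
    intro j
    rw [Module.Basis.reindex_apply, Module.Basis.mk_apply, hfR]
  refine ⟨fC.reindex e, fun j => ?_, fun j => ?_, fun l hl hlσ => ?_⟩
  · rw [hf]; exact (fZ (e.symm j)).2
  · rw [hf, ← hfR]; exact hfix _
  · let l' : Λ := ⟨⟨l, mem_fixedSpace.2 hlσ⟩, hl⟩
    refine ⟨fun j => fZ.repr l' (e.symm j), ?_⟩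
    have h := congrArg (fun x : Λ => ((x : W) : CVec g)) (fZ.sum_repr l')
    rw [← e.symm.sum_comp] at h
    simp only [hf]
    rw [show l = ((l' : W) : CVec g) from rfl]
    conv_lhs => rw [← h]
    simp

theorem IsLinearRealStructure.exists_real_combination (hσ : IsLinearRealStructure L E σ)
    (f : Module.Basis (Fin g) ℂ (CVec g)) (hfix : ∀ j, σ (f j) = f j) {v : CVec g}
    (hv : σ v = v) : ∃ r : Fin g → ℝ, v = ∑ j, r j • f j := by
  refine ⟨fun j => (f.repr v j).re, ?_⟩
  have h1 : v = ∑ j, conj (f.repr v j) • f j := by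
    conv_lhs => rw [← hv, ← f.sum_repr v, map_sum]
    simp only [hσ.map_smul_complex, hfix]
  conv_lhs => rw [← f.sum_repr v]
  refine Finset.sum_congr rfl fun j _ => ?_
  have h2 : f.repr v j = conj (f.repr v j) := by
    conv_lhs => rw [h1, f.repr_sum_self]
  rw [← Complex.coe_smul, Complex.conj_eq_iff_re.1 h2.symm]

/-- An integral functional on the lattice is represented by the principal polarization. -/
theorem IsPrincipal.exists_represents (hE : IsPrincipal L E) (α : L →ₗ[ℤ] ℤ) :
    ∃ e : L, ∀ l : L, E (e : CVec g) (l : CVec g) = (α l : ℝ) := by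
  obtain ⟨b, hb⟩ := hE
  let e : L := ∑ k, Sum.elim (fun j => α (b (Sum.inr j))) (fun j => -α (b (Sum.inl j))) k • b k
  have hbasis : ∀ m, E (e : CVec g) (b m : CVec g) = (α (b m) : ℝ) := by
    intro m
    have : (e : CVec g) = ∑ k, Sum.elim (fun j => ((α (b (Sum.inr j)) : ℤ) : ℝ))
        (fun j => -((α (b (Sum.inl j)) : ℤ) : ℝ)) k • (b k : CVec g) := by
      simp only [e, Submodule.coe_sum, Submodule.coe_smul]
      refine Finset.sum_congr rfl fun k _ => ?_
      rcases k with k | k <;> simp only [Sum.elim_inl, Sum.elim_inr, ← Int.cast_neg,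
        Int.cast_smul_eq_zsmul]
    rw [this, map_sum, LinearMap.sum_apply]
    simp only [map_smul, LinearMap.smul_apply, hb]
    rcases m with m | m <;> simp [Jg, Matrix.one_apply]
  refine ⟨e, fun l => ?_⟩
  have h : ((E (e : CVec g)).toAddMonoidHom.toIntLinearMap.comp L.subtype) =
      (Int.castAddHom ℝ).toIntLinearMap.comp α := b.ext fun m => hbasis m
  exact LinearMap.congr_fun h l

/-- `(e, f)` is a symplectic basis of the lattice `L` in which the `f_j` are a `ℤ`-basis of the
lattice vectors fixed by `σ`, and a complex basis of `ℂ^g`. -/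
structure IsAdaptedBasis (L : Submodule ℤ (CVec g)) (E : CVec g →ₗ[ℝ] CVec g →ₗ[ℝ] ℝ)
    (σ : CVec g →ₗ[ℝ] CVec g) (e : Fin g → CVec g) (f : Module.Basis (Fin g) ℂ (CVec g)) :
    Prop where
  left_mem : ∀ j, e j ∈ L
  right_mem : ∀ j, f j ∈ L
  fixed : ∀ j, σ (f j) = f j
  left_left : ∀ j k, E (e j) (e k) = 0
  left_right : ∀ j k, E (e j) (f k) = (1 : Matrix (Fin g) (Fin g) ℝ) j k
  exists_of_fixed : ∀ l ∈ L, σ l = l → ∃ n : Fin g → ℤ, l = ∑ j, n j • f j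
  exists_eq : ∀ l ∈ L, ∃ x y : Fin g → ℤ, l = ∑ j, x j • e j + ∑ j, y j • f j

theorem IsPolarization.skew (hpol : IsPolarization L E) (u v : CVec g) : E u v = -E v u := by
  have h := hpol.alternating (u + v)
  simp only [map_add, LinearMap.add_apply, hpol.alternating] at h
  linarith

theorem IsLinearRealStructure.pol_fixed (hσ : IsLinearRealStructure L E σ) {u v : CVec g}
    (hu : σ u = u) (hv : σ v = v) : E u v = 0 := by
  have := hσ.pol u v
  rw [hu, hv] at this
  linarith

/-- The fixed lattice is a direct summand of `L`, since `L / (L ∩ V₊)` embeds into `L` through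
`σ - 1`. Hence coordinates on it extend to functionals on `L`. -/
theorem IsLinearRealStructure.exists_dual [DiscreteTopology L] [IsZLattice ℝ L]
    (hσ : IsLinearRealStructure L E σ) (f : Module.Basis (Fin g) ℂ (CVec g))
    (hf : ∀ j, f j ∈ L) (hfix : ∀ j, σ (f j) = f j)
    (hspan : ∀ l ∈ L, σ l = l → ∃ n : Fin g → ℤ, l = ∑ j, n j • f j) (i : Fin g) :
    ∃ α : L →ₗ[ℤ] ℤ, ∀ j, α ⟨f j, hf j⟩ = (1 : Matrix (Fin g) (Fin g) ℤ) i j := by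
  have : Module.Free ℤ L := ZLattice.module_free ℝ L
  have : Module.Finite ℤ L := ZLattice.module_finite ℝ L
  let q : L →ₗ[ℤ] L :=
    ((σ.toAddMonoidHom.toIntLinearMap.restrict (p := L) (q := L) hσ.map_mem) - LinearMap.id)
  have hq : ∀ l : L, l ∈ LinearMap.ker q ↔ σ (l : CVec g) = l := by
    intro l
    rw [LinearMap.mem_ker, LinearMap.sub_apply, sub_eq_zero, ← Subtype.val_inj]
    rfl
  obtain ⟨s, hs⟩ := Module.projective_lifting_property q.rangeRestrict LinearMap.id
    q.surjective_rangeRestrict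
  have hs' : ∀ y, q (s y) = y := fun y =>
    congrArg Subtype.val (LinearMap.congr_fun hs y)
  let p : L →ₗ[ℤ] L := LinearMap.id - s ∘ₗ q.rangeRestrict
  have hp : ∀ l, σ (p l : CVec g) = p l := by
    intro l
    rw [← hq, LinearMap.mem_ker]
    simp only [p, LinearMap.sub_apply, LinearMap.id_apply, map_sub, LinearMap.comp_apply, hs']
    exact sub_self _
  have hpf : ∀ j, p ⟨f j, hf j⟩ = ⟨f j, hf j⟩ := by
    intro j
    have : q.rangeRestrict ⟨f j, hf j⟩ = 0 := Subtype.ext ((hq _).2 (hfix j))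
    simp [p, this]
  have hcoord : ∀ l : L, ∃ n : ℤ, f.repr (p l) i = n := by
    intro l
    obtain ⟨n, hn⟩ := hspan _ (p l).2 (hp l)
    refine ⟨n i, ?_⟩
    have : (p l : CVec g) = ∑ j, (n j : ℂ) • f j := by
      rw [hn]
      simp only [Int.cast_smul_eq_zsmul]
    rw [this, f.repr_sum_self]
  choose a ha using hcoord
  refine ⟨⟨⟨a, fun l l' => ?_⟩, fun m l => ?_⟩, fun j => ?_⟩
  · apply Int.cast_injective (α := ℂ)
    rw [← ha]
    push_cast
    rw [← ha, ← ha]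
    simp
  · apply Int.cast_injective (α := ℂ)
    rw [← ha]
    simp only [map_smul, Submodule.coe_smul, RingHom.id_apply, smul_eq_mul, Int.cast_mul]
    rw [← ha, ← Int.cast_smul_eq_zsmul ℂ, map_smul]
    simp
  · apply Int.cast_injective (α := ℂ)
    change ((a ⟨f j, hf j⟩ : ℤ) : ℂ) = _
    rw [← ha, hpf]
    simp [Matrix.one_apply, Finsupp.single_apply, eq_comm]

theorem IsLinearRealStructure.exists_adaptedBasis [DiscreteTopology L] [IsZLattice ℝ L]
    (hσ : IsLinearRealStructure L E σ) (hpol : IsPolarization L E) (hprin : IsPrincipal L E) :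
    ∃ e f, IsAdaptedBasis L E σ e f := by
  obtain ⟨f, hf, hfix, hspan⟩ := hσ.exists_fixed_basis
  have hdual : ∀ i, ∃ e : L, ∀ j, E (e : CVec g) (f j) = (1 : Matrix (Fin g) (Fin g) ℝ) i j := by
    intro i
    obtain ⟨α, hα⟩ := hσ.exists_dual f hf hfix hspan i
    obtain ⟨e, he⟩ := hprin.exists_represents α
    refine ⟨e, fun j => ?_⟩
    rw [he ⟨f j, hf j⟩, hα]
    simp [Matrix.one_apply]
  choose e' he' using hdual
  have hskew := hpol.skew
  have hint : ∀ i j, ∃ n : ℤ, E (e' i : CVec g) (e' j : CVec g) = n := fun i j =>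
    hpol.integral _ (e' i).2 _ (e' j).2
  choose s hs using hint
  -- subtract from the `e'_i` the combinations of the `f_k` that make them orthogonal
  let e : Fin g → CVec g := fun i => (e' i : CVec g) + ∑ k, (if i < k then s i k else 0) • f k
  have hff : ∀ j k, E (f j) (f k) = 0 := fun j k => hσ.pol_fixed (hfix j) (hfix k)
  have hfe' : ∀ j k, E (f j) (e' k : CVec g) = -(1 : Matrix (Fin g) (Fin g) ℝ) k j := fun j k => by
    rw [hskew, he']
  have hzsmul : ∀ (n : ℤ) (u v : CVec g), E (n • u) v = n * E u v := by
    intro n u v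
    rw [map_zsmul, LinearMap.smul_apply, zsmul_eq_mul]
  have hzsmul' : ∀ (n : ℤ) (u v : CVec g), E u (n • v) = n * E u v := by
    intro n u v
    rw [map_zsmul, zsmul_eq_mul]
  have hef : ∀ j k, E (e j) (f k) = (1 : Matrix (Fin g) (Fin g) ℝ) j k := by
    intro j k
    simp only [e, map_add, LinearMap.add_apply, map_sum, LinearMap.sum_apply, hzsmul, hff, he']
    simp
  have hee : ∀ j k, E (e j) (e k) = 0 := by
    intro j k
    have h1 : E (e j) (e k) = E (e j) (e' k : CVec g) + if k < j then (s k j : ℝ) else 0 := by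
      conv_lhs => enter [2]; simp only [e]
      rw [map_add, map_sum]
      simp only [hzsmul', hef]
      simp [Matrix.one_apply]
    have h2 : E (e j) (e' k : CVec g) = s j k - if j < k then (s j k : ℝ) else 0 := by
      simp only [e, map_add, LinearMap.add_apply, map_sum, LinearMap.sum_apply, hzsmul, hfe', hs]
      simp [Matrix.one_apply, sub_eq_add_neg]
    have h3 : (s j k : ℝ) = -s k j := by rw [← hs, ← hs, hskew]
    rw [h1, h2]
    rcases lt_trichotomy j k with h | h | h
    · simp [h, h.not_gt]
    · subst h
      have : (s j j : ℝ) = 0 := by linarith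
      simp [this]
    · simp [h, h.not_gt, h3]
  have hmem : ∀ j, e j ∈ L := fun j =>
    L.add_mem (e' j).2 (L.sum_mem fun k _ => L.smul_mem _ (hf k))
  refine ⟨e, f, hmem, hf, hfix, hee, hef, hspan, fun l hl => ?_⟩
  -- a lattice vector orthogonal to all `e_j` and `f_j` vanishes
  choose x hx using fun j => hpol.integral l hl (f j) (hf j)
  choose y hy using fun j => hpol.integral l hl (e j) (hmem j)
  refine ⟨x, -y, ?_⟩
  set w := l - (∑ j, x j • e j + ∑ j, (-y) j • f j) with hw
  have hwL : w ∈ L := L.sub_mem hl (L.add_mem (L.sum_mem fun k _ => L.smul_mem _ (hmem k))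
    (L.sum_mem fun k _ => L.smul_mem _ (hf k)))
  have hwf : ∀ k, E w (f k) = 0 := by
    intro k
    simp only [hw, map_sub, LinearMap.sub_apply, map_add, LinearMap.add_apply, map_sum,
      LinearMap.sum_apply, hzsmul, hff, hef, hx]
    simp [Matrix.one_apply]
  have hwe : ∀ k, E w (e k) = 0 := by
    intro k
    have hfe : ∀ j, E (f j) (e k) = -(1 : Matrix (Fin g) (Fin g) ℝ) k j := fun j => by
      rw [hskew, hef]
    simp only [hw, map_sub, LinearMap.sub_apply, map_add, LinearMap.add_apply, map_sum,
      LinearMap.sum_apply, hzsmul, hfe, hee, hy]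
    simp [Matrix.one_apply]
  obtain ⟨a, ha, b, hb, hab⟩ := hσ.exists_re_im w
  rw [mem_fixedSpace] at ha hb
  have hb0 : b = 0 := by
    by_contra hne
    have hpos := hpol.posDef b hne
    have h1 : E (Complex.I • b) b = 0 := by
      have hfixed : ∀ c, σ c = c → E w c = 0 := by
        intro c hc
        obtain ⟨r, rfl⟩ := hσ.exists_real_combination f hfix hc
        rw [map_sum]
        simp [hwf]
      have h2 := hfixed b hb
      rw [hab, map_add, LinearMap.add_apply, hσ.pol_fixed ha hb, zero_add] at h2
      exact h2
    simp [hermitianForm, h1] at hpos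
  rw [hb0, smul_zero, add_zero] at hab
  obtain ⟨n, hn⟩ := hspan w hwL (hab ▸ ha)
  have hn0 : ∀ k, n k = 0 := by
    intro k
    have h1 := hwe k
    rw [hskew, hn, map_sum] at h1
    simp only [hzsmul', hef] at h1
    simpa [Matrix.one_apply] using h1
  have hw0 : w = 0 := by rw [hn]; simp [hn0]
  exact sub_eq_zero.1 hw0

end Frame

/-! ### Surjectivity of the period map -/

section Period

variable {g : ℕ} {L : Submodule ℤ (CVec g)} {E : CVec g →ₗ[ℝ] CVec g →ₗ[ℝ] ℝ}
  {σ : CVec g →ₗ[ℝ] CVec g} {e : Fin g → CVec g} {f : Module.Basis (Fin g) ℂ (CVec g)}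

theorem IsPolarization.I_smul_comm (hpol : IsPolarization L E) (u v : CVec g) :
    E (Complex.I • u) v = E (Complex.I • v) u := by
  have h := congrArg Complex.re (hpol.hermitian u v)
  simpa [hermitianForm] using h

theorem IsPolarization.I_smul_pos (hpol : IsPolarization L E) {u : CVec g} (hu : u ≠ 0) :
    0 < E (Complex.I • u) u := by
  have h := hpol.posDef u hu
  simpa [hermitianForm] using h

/-- The matrix `(E(i f_j, f_k))`, which is the inverse of the imaginary part of the period
matrix. -/
noncomputable def gramMatrix (E : CVec g →ₗ[ℝ] CVec g →ₗ[ℝ] ℝ)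
    (f : Module.Basis (Fin g) ℂ (CVec g)) : Matrix (Fin g) (Fin g) ℝ :=
  Matrix.of fun j k => E (Complex.I • f j) (f k)

/-- The complex linear automorphism of `ℂ^g` which maps the standard basis to `f`. -/
noncomputable def frameMap (f : Module.Basis (Fin g) ℂ (CVec g)) : CVec g ≃ₗ[ℂ] CVec g :=
  f.equivFun.symm

theorem frameMap_apply (f : Module.Basis (Fin g) ℂ (CVec g)) (z : CVec g) :
    frameMap f z = ∑ j, z j • f j := f.equivFun_symm_apply z

theorem frameMap_ofReal (f : Module.Basis (Fin g) ℂ (CVec g)) (a : Fin g → ℝ) :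
    frameMap f (fun i => (a i : ℂ)) = ∑ j, a j • f j := by
  rw [frameMap_apply]
  simp only [Complex.coe_smul]

theorem frameMap_intCast (f : Module.Basis (Fin g) ℂ (CVec g)) (n : Fin g → ℤ) :
    frameMap f (fun i => (n i : ℂ)) = ∑ j, n j • f j := by
  rw [frameMap_apply]
  simp only [Int.cast_smul_eq_zsmul]

/-- The period matrix of an adapted basis: `e_j = ∑_i Ω_ij f_i`. -/
noncomputable def periodMatrix (e : Fin g → CVec g) (f : Module.Basis (Fin g) ℂ (CVec g)) :
    Matrix (Fin g) (Fin g) ℂ :=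
  Matrix.of fun i j => f.repr (e j) i

theorem frameMap_periodMatrix_col (e : Fin g → CVec g) (f : Module.Basis (Fin g) ℂ (CVec g))
    (j : Fin g) : frameMap f (fun i => periodMatrix e f i j) = e j := by
  rw [frameMap_apply]
  exact f.sum_repr (e j)

theorem frameMap_periodMatrix_mulVec (e : Fin g → CVec g) (f : Module.Basis (Fin g) ℂ (CVec g))
    (x : Fin g → ℤ) :
    frameMap f (periodMatrix e f *ᵥ fun i => (x i : ℂ)) = ∑ j, x j • e j := by
  have h : (periodMatrix e f *ᵥ fun i => (x i : ℂ)) =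
      ∑ j, (x j : ℂ) • fun i => periodMatrix e f i j := by
    ext i
    simp [mulVec, dotProduct, mul_comm]
  rw [h, map_sum]
  simp only [map_smul, frameMap_periodMatrix_col]
  simp only [Int.cast_smul_eq_zsmul]

theorem IsLinearRealStructure.frameMap_star (hσ : IsLinearRealStructure L E σ)
    (hfix : ∀ j, σ (f j) = f j) (z : CVec g) : frameMap f (star z) = σ (frameMap f z) := by
  rw [frameMap_apply, frameMap_apply, map_sum]
  simp only [hσ.map_smul_complex, hfix]
  rfl

theorem pol_I_smul_frameMap (f : Module.Basis (Fin g) ℂ (CVec g))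
    (E : CVec g →ₗ[ℝ] CVec g →ₗ[ℝ] ℝ) (a b : Fin g → ℝ) :
    E (Complex.I • frameMap f fun i => (a i : ℂ)) (frameMap f fun i => (b i : ℂ)) =
      a ⬝ᵥ (gramMatrix E f *ᵥ b) := by
  rw [frameMap_ofReal, frameMap_ofReal, Finset.smul_sum, map_sum E, LinearMap.sum_apply]
  refine Finset.sum_congr rfl fun j _ => ?_
  rw [smul_comm Complex.I, map_smul, LinearMap.smul_apply, smul_eq_mul, map_sum]
  simp [gramMatrix, mulVec, dotProduct, mul_comm]

theorem IsLinearRealStructure.pol_frameMap (hσ : IsLinearRealStructure L E σ)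
    (hpol : IsPolarization L E) (hfix : ∀ j, σ (f j) = f j) (u v : CVec g) :
    E (frameMap f u) (frameMap f v) =
      (fun i => (u i).im) ⬝ᵥ (gramMatrix E f *ᵥ fun i => (v i).re) -
      (fun i => (u i).re) ⬝ᵥ (gramMatrix E f *ᵥ fun i => (v i).im) := by
  have hz : ∀ z : CVec g, frameMap f z = frameMap f (fun i => ((z i).re : ℂ)) +
      Complex.I • frameMap f (fun i => ((z i).im : ℂ)) := by
    intro z
    rw [← map_smul, ← map_add]
    congr 1
    ext i
    simp only [Pi.add_apply, Pi.smul_apply, smul_eq_mul]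
    rw [mul_comm, Complex.re_add_im]
  have hreal : ∀ a : Fin g → ℝ,
      σ (frameMap f fun i => (a i : ℂ)) = frameMap f fun i => (a i : ℂ) := by
    intro a
    rw [← hσ.frameMap_star hfix]
    congr 1
    ext i
    simp
  have h1 : ∀ a b : Fin g → ℝ,
      E (frameMap f fun i => (a i : ℂ)) (frameMap f fun i => (b i : ℂ)) = 0 := fun a b =>
    hσ.pol_fixed (hreal a) (hreal b)
  have h2 : ∀ a b : Fin g → ℝ, E (frameMap f fun i => (a i : ℂ))
      (Complex.I • frameMap f fun i => (b i : ℂ)) = -(a ⬝ᵥ (gramMatrix E f *ᵥ b)) := by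
    intro a b
    rw [hpol.skew, hpol.I_smul_comm, pol_I_smul_frameMap]
  have h3 : ∀ a b : Fin g → ℝ, E (Complex.I • frameMap f fun i => (a i : ℂ))
      (Complex.I • frameMap f fun i => (b i : ℂ)) = 0 := by
    intro a b
    rw [hpol.I_smul_comm, smul_smul, Complex.I_mul_I, neg_one_smul, map_neg,
      LinearMap.neg_apply, h1, neg_zero]
  rw [hz u, hz v]
  simp only [map_add, LinearMap.add_apply, h1, h2, h3,
    pol_I_smul_frameMap]
  ring

theorem IsPolarization.gramMatrix_posDef (hpol : IsPolarization L E)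
    (f : Module.Basis (Fin g) ℂ (CVec g)) : (gramMatrix E f).PosDef := by
  refine Matrix.PosDef.of_dotProduct_mulVec_pos ?_ fun a ha => ?_
  · ext j k
    simp [gramMatrix, hpol.I_smul_comm]
  · have hne : (frameMap f fun i => (a i : ℂ)) ≠ 0 := by
      rw [Ne, LinearEquiv.map_eq_zero_iff]
      intro h
      apply ha
      ext i
      simpa using congrFun h i
    have := hpol.I_smul_pos hne
    rw [pol_I_smul_frameMap] at this
    simpa using this

/-- The imaginary part of the period matrix is inverse to the Gram matrix. -/
theorem IsAdaptedBasis.transpose_im_mul_gramMatrix (h : IsAdaptedBasis L E σ e f)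
    (hσ : IsLinearRealStructure L E σ) (hpol : IsPolarization L E) :
    (imPart (periodMatrix e f))ᵀ * gramMatrix E f = 1 := by
  ext j k
  have h1 := hσ.pol_frameMap hpol h.fixed (fun i => periodMatrix e f i j) (Pi.single k 1)
  have h2 : frameMap f (Pi.single k 1) = f k := by
    rw [frameMap_apply]
    simp [Pi.single_apply]
  have h3 : (fun i => ((Pi.single k 1 : CVec g) i).re) = Pi.single k 1 := by
    ext i
    by_cases hik : i = k
    · subst hik; simp
    · simp [hik]
  have h4 : (fun i => ((Pi.single k 1 : CVec g) i).im) = 0 := by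
    ext i
    by_cases hik : i = k
    · subst hik; simp
    · simp [hik]
  rw [frameMap_periodMatrix_col, h2, h.left_right, h3, h4, mulVec_zero, dotProduct_zero,
    sub_zero, mulVec_single_one] at h1
  rw [h1]
  rfl

theorem IsAdaptedBasis.im_inv (h : IsAdaptedBasis L E σ e f)
    (hσ : IsLinearRealStructure L E σ) (hpol : IsPolarization L E) :
    (imPart (periodMatrix e f))⁻¹ = gramMatrix E f := by
  have hs : (gramMatrix E f)ᵀ = gramMatrix E f := by
    have := (hpol.gramMatrix_posDef f).isHermitian.eq
    rwa [conjTranspose_eq_transpose_of_trivial] at this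
  have h1 := congrArg transpose (h.transpose_im_mul_gramMatrix hσ hpol)
  rw [transpose_mul, transpose_transpose, hs, transpose_one] at h1
  exact inv_eq_left_inv h1

theorem IsAdaptedBasis.periodMatrix_mem (h : IsAdaptedBasis L E σ e f)
    (hσ : IsLinearRealStructure L E σ) (hpol : IsPolarization L E) :
    periodMatrix e f ∈ HSet g := by
  set Ω := periodMatrix e f with hΩ
  have hQ := hpol.gramMatrix_posDef f
  have hinv := h.im_inv hσ hpol
  have hYQ := h.transpose_im_mul_gramMatrix hσ hpol
  have hY : (imPart Ω).PosDef := by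
    rw [← Matrix.posDef_inv_iff, hinv]
    exact hQ
  have hYs : (imPart Ω)ᵀ = imPart Ω := by
    have := hY.isHermitian.eq
    rwa [conjTranspose_eq_transpose_of_trivial] at this
  have hX : (Ω.map Complex.re)ᵀ = Ω.map Complex.re := by
    ext j k
    have h1 := hσ.pol_frameMap hpol h.fixed (fun i => Ω i j) (fun i => Ω i k)
    rw [hΩ, frameMap_periodMatrix_col, frameMap_periodMatrix_col, h.left_left, ← hΩ] at h1
    have h2 : ∀ A B : Matrix (Fin g) (Fin g) ℝ, (fun i => A i j) ⬝ᵥ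
        (gramMatrix E f *ᵥ fun i => B i k) = (Aᵀ * (gramMatrix E f * B)) j k := fun _ _ => rfl
    have h3 := h2 (imPart Ω) (Ω.map Complex.re)
    have h4 := h2 (Ω.map Complex.re) (imPart Ω)
    simp only [map_apply] at h3 h4
    have hQY : gramMatrix E f * imPart Ω = 1 := by
      rw [hYs] at hYQ
      exact mul_eq_one_comm.1 hYQ
    rw [h3, h4, ← Matrix.mul_assoc, hYQ, hQY, Matrix.one_mul, Matrix.mul_one] at h1
    linarith
  have hint : ∀ j, ∃ n : Fin g → ℤ, ∀ i, 2 * (Ω i j).re = n i := by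
    intro j
    obtain ⟨n, hn⟩ := h.exists_of_fixed (e j + σ (e j))
      (L.add_mem (h.left_mem j) (hσ.map_mem _ (h.left_mem j)))
      (mem_fixedSpace.1 (hσ.add_mem_fixedSpace _))
    refine ⟨n, fun i => ?_⟩
    rw [← frameMap_intCast, ← frameMap_periodMatrix_col e f j, ← hσ.frameMap_star h.fixed,
      ← map_add] at hn
    have := congrArg Complex.re (congrFun ((frameMap f).injective hn) i)
    simp only [Pi.add_apply, Pi.star_apply, RCLike.star_def, Complex.add_re, Complex.conj_re,
      Complex.intCast_re] at this
    rw [two_mul]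
    exact this
  choose n hn using hint
  refine ⟨?_, hY, Matrix.of fun i j => n j i, fun i j => hn j i⟩
  ext j k
  apply Complex.ext
  · exact congrFun (congrFun hX j) k
  · exact congrFun (congrFun hYs j) k

end Period

theorem exists_isIsomorphic_ofPeriod {g : ℕ} (A : RealPPAV g) :
    ∃ Ω : HSpace g, IsIsomorphic (RealPPAV.ofPeriod Ω) A := by
  have := A.discrete
  have := A.isZLattice
  obtain ⟨σ, hσ, hmk⟩ := exists_linearRealStructure A
  obtain ⟨e, f, h⟩ := hσ.exists_adaptedBasis A.isPolarization A.isPrincipal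
  have hΩ := h.periodMatrix_mem hσ A.isPolarization
  have hmem : ∀ v, frameMap f v ∈ A.lattice ↔ v ∈ periodLattice (periodMatrix e f) := by
    intro v
    constructor
    · intro hv
      obtain ⟨x, y, hxy⟩ := h.exists_eq _ hv
      rw [mem_periodLattice]
      refine ⟨x, y, (frameMap f).injective ?_⟩
      rw [hxy, map_add, frameMap_periodMatrix_mulVec, frameMap_intCast]
    · intro hv
      obtain ⟨x, y, rfl⟩ := (mem_periodLattice _ _).1 hv
      rw [map_add, frameMap_periodMatrix_mulVec, frameMap_intCast]
      exact A.lattice.add_mem (A.lattice.sum_mem fun k _ => A.lattice.smul_mem _ (h.left_mem k))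
        (A.lattice.sum_mem fun k _ => A.lattice.smul_mem _ (h.right_mem k))
  refine ⟨⟨_, hΩ⟩, frameMap f, hmem, fun u v => ?_, fun v w hvw => ?_⟩
  · show A.pol (frameMap f u) (frameMap f v) = periodForm (periodMatrix e f) u v
    rw [hσ.pol_frameMap A.isPolarization h.fixed, periodForm_apply,
      h.im_inv hσ A.isPolarization]
  · have h1 : star v - w ∈ periodLattice (periodMatrix e f) :=
      sub_mem_of_mkQ_eq ((sigma_mkQ hΩ v).symm.trans hvw)
    rw [hmk, ← hσ.frameMap_star h.fixed, Submodule.mkQ_apply, Submodule.mkQ_apply,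
      Submodule.Quotient.eq, ← map_sub, hmem]
    exact h1

theorem classMap_bijective (g : ℕ) : Function.Bijective (classMap : XSpace g → IsoClass g) := by
  refine ⟨classMap_injective g, fun c => ?_⟩
  induction c using Quotient.ind with
  | _ A =>
    obtain ⟨Ω, h⟩ := exists_isIsomorphic_ofPeriod A
    exact ⟨proj Ω, Quotient.sound h⟩

/-! ### The involution `S ↦ -S` on standard points -/

/-- Real matrices as complex matrices. -/
abbrev ofR {g : ℕ} (A : Matrix (Fin g) (Fin g) ℝ) : Matrix (Fin g) (Fin g) ℂ :=
  A.map ((↑) : ℝ → ℂ)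

theorem toC_neg {g : ℕ} (A : Matrix (Fin g) (Fin g) ℤ) : toC (-A) = -toC A := by
  ext; simp [toC]

theorem ofR_mul {g : ℕ} (A B : Matrix (Fin g) (Fin g) ℝ) : ofR (A * B) = ofR A * ofR B := by
  ext j k; simp [ofR, mul_apply]

theorem ofR_one {g : ℕ} : ofR (1 : Matrix (Fin g) (Fin g) ℝ) = 1 := by
  simp [ofR]

theorem halfDiag_transpose (g lam : ℕ) : (halfDiag g lam)ᵀ = halfDiag g lam :=
  diagonal_transpose _

theorem isUnit_halfDiag_det (g lam : ℕ) : IsUnit (halfDiag g lam).det := by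
  rw [halfDiag, det_diagonal, isUnit_iff_ne_zero, Finset.prod_ne_zero_iff]
  intro j _
  split_ifs <;> norm_num

/-- The imaginary part `K Y⁻¹ K`, where `K = (½ I_λ 0; 0 I)`. -/
noncomputable def dualIm (g lam : ℕ) (Y : Matrix (Fin g) (Fin g) ℝ) :
    Matrix (Fin g) (Fin g) ℝ :=
  halfDiag g lam * Y⁻¹ * halfDiag g lam

theorem dualIm_posDef {g lam : ℕ} {Y : Matrix (Fin g) (Fin g) ℝ} (hY : Y.PosDef) :
    (dualIm g lam Y).PosDef := by
  have hu : IsUnit (halfDiag g lam) := (isUnit_iff_isUnit_det _).2 (isUnit_halfDiag_det g lam)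
  have := hY.inv.mul_mul_conjTranspose_same (B := halfDiag g lam) (vecMul_injective_of_isUnit hu)
  rwa [conjTranspose_eq_transpose_of_trivial, halfDiag_transpose] at this

theorem halfDiag_eq (g lam : ℕ) :
    ofR (halfDiag g lam) = 1 - (1 / 2 : ℂ) • toC (headProj g lam) := by
  ext j k
  simp only [ofR, map_apply, halfDiag, headProj, toC, Matrix.sub_apply, Matrix.smul_apply,
    diagonal_apply, one_apply, smul_eq_mul]
  split_ifs <;> norm_num

theorem headProj_mul_self (g lam : ℕ) : headProj g lam * headProj g lam = headProj g lam := by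
  have := standardForm_mul_headProj g lam 0
  rwa [standardForm_zero] at this

theorem headProj_mul_standardForm {g lam : ℕ} (h : lam ≤ g) (i : ZMod 2) :
    headProj g lam * standardForm g lam i = standardForm g lam i := by
  rw [← standardForm_mul_self h i, Matrix.mul_assoc, standardForm_mul_self h i,
    standardForm_mul_headProj]

section Identities

variable {g lam : ℕ}

theorem halfDiag_mul_one_add :
    ofR (halfDiag g lam) * (1 + toC (headProj g lam)) = 1 := by
  have hp : toC (headProj g lam) * toC (headProj g lam) = toC (headProj g lam) := by
    rw [← toC_mul, headProj_mul_self]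
  rw [halfDiag_eq, Matrix.mul_add, Matrix.mul_one, Matrix.sub_mul, Matrix.one_mul,
    Matrix.smul_mul, hp]
  module

theorem one_add_mul_halfDiag :
    (1 + toC (headProj g lam)) * ofR (halfDiag g lam) = 1 :=
  mul_eq_one_comm.1 halfDiag_mul_one_add

theorem standardForm_mul_halfDiag (i : ZMod 2) :
    toC (standardForm g lam i) * ofR (halfDiag g lam) =
      (1 / 2 : ℂ) • toC (standardForm g lam i) := by
  rw [halfDiag_eq, Matrix.mul_sub, Matrix.mul_one, Matrix.mul_smul, ← toC_mul,
    standardForm_mul_headProj]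
  module

theorem halfDiag_mul_standardForm (h : lam ≤ g) (i : ZMod 2) :
    ofR (halfDiag g lam) * toC (standardForm g lam i) =
      (1 / 2 : ℂ) • toC (standardForm g lam i) := by
  rw [halfDiag_eq, Matrix.sub_mul, Matrix.one_mul, Matrix.smul_mul, ← toC_mul,
    headProj_mul_standardForm h]
  module

variable {Y : Matrix (Fin g) (Fin g) ℝ}

/-- The matrix `i K Y⁻¹` of the isomorphism that carries `-σ` to `σ`. -/
noncomputable def flipMatrix (g lam : ℕ) (Y : Matrix (Fin g) (Fin g) ℝ) :
    Matrix (Fin g) (Fin g) ℂ :=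
  Complex.I • ofR (halfDiag g lam * Y⁻¹)

theorem ofR_inv_mul (hY : Y.PosDef) : ofR Y⁻¹ * ofR Y = 1 := by
  rw [← ofR_mul, nonsing_inv_mul _ ((isUnit_iff_isUnit_det _).1 hY.isUnit), ofR_one]

theorem ofR_mul_inv (hY : Y.PosDef) : ofR Y * ofR Y⁻¹ = 1 :=
  mul_eq_one_comm.1 (ofR_inv_mul hY)

theorem halfPoint_dualIm (M : Matrix (Fin g) (Fin g) ℤ) :
    halfPoint M (dualIm g lam Y) =
      (1 / 2 : ℂ) • toC M +
        Complex.I • (ofR (halfDiag g lam) * ofR Y⁻¹ * ofR (halfDiag g lam)) := by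
  rw [halfPoint, dualIm, ← ofR_mul, ← ofR_mul]

theorem flipMatrix_mul_halfPoint (h : lam ≤ g) (i : ZMod 2) (hY : Y.PosDef) :
    flipMatrix g lam Y * halfPoint (standardForm g lam i) Y =
      halfPoint (standardForm g lam i) (dualIm g lam Y) * toC (standardForm g lam i) - 1 := by
  have hI : Complex.I * Complex.I = -1 := Complex.I_mul_I
  rw [halfPoint_dualIm, Matrix.add_mul, Matrix.smul_mul, Matrix.smul_mul, ← toC_mul,
    standardForm_mul_self h, Matrix.mul_assoc _ _ (toC _), halfDiag_mul_standardForm h,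
    halfPoint, flipMatrix, ofR_mul, Matrix.mul_add, Matrix.smul_mul, Matrix.smul_mul,
    Matrix.mul_smul, Matrix.mul_smul, Matrix.mul_assoc _ (ofR Y⁻¹) (ofR Y), ofR_inv_mul hY,
    Matrix.mul_one, halfDiag_eq, smul_smul Complex.I Complex.I, hI]
  module

theorem flipMatrix_eq (i : ZMod 2) :
    flipMatrix g lam Y =
      halfPoint (standardForm g lam i) (dualIm g lam Y) * (1 + toC (headProj g lam)) -
        toC (standardForm g lam i) := by
  rw [halfPoint_dualIm, Matrix.add_mul, Matrix.smul_mul, Matrix.smul_mul,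
    Matrix.mul_assoc _ _ (1 + _),
    halfDiag_mul_one_add, Matrix.mul_one, Matrix.mul_add, Matrix.mul_one, ← toC_mul,
    standardForm_mul_headProj, flipMatrix, ofR_mul]
  module

/-- The formula for `Σ_M (M/2 + iY)`. The denominator is `CΩ + D = -i (1 + M²) Y`. -/
theorem moebius_sigmaMatrix (h : lam ≤ g) (i : ZMod 2) (hY : Y.PosDef) :
    moebius (sigmaMatrix (standardForm g lam i)) (halfPoint (standardForm g lam i) Y) =
      halfPoint (standardForm g lam i) (dualIm g lam Y) := by
  set M := standardForm g lam i with hM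
  have hI : Complex.I * Complex.I = -1 := Complex.I_mul_I
  have hden : toC (-(1 + M * M)) * halfPoint M Y + toC M =
      -(Complex.I • ((1 + toC (headProj g lam)) * ofR Y)) := by
    rw [toC_neg, toC_add, toC_one, hM, standardForm_mul_self h, halfPoint, Matrix.neg_mul,
      Matrix.mul_add, Matrix.mul_smul, Matrix.mul_smul, Matrix.add_mul, Matrix.one_mul, ← toC_mul,
      headProj_mul_standardForm h]
    module
  have hinv : (-(Complex.I • ((1 + toC (headProj g lam)) * ofR Y)))⁻¹ =
      Complex.I • (ofR Y⁻¹ * ofR (halfDiag g lam)) := by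
    apply inv_eq_right_inv
    rw [Matrix.neg_mul, Matrix.smul_mul, Matrix.mul_smul, smul_smul, hI, Matrix.mul_assoc,
      ← Matrix.mul_assoc (ofR Y), ofR_mul_inv hY, Matrix.one_mul, one_add_mul_halfDiag]
    simp
  have hnum : toC (-M) * halfPoint M Y + toC 1 =
      ofR (halfDiag g lam) - Complex.I • (toC M * ofR Y) := by
    rw [toC_neg, toC_one, halfPoint, Matrix.neg_mul, Matrix.mul_add, Matrix.mul_smul,
      Matrix.mul_smul, ← toC_mul, hM, standardForm_mul_self h, halfDiag_eq]
    module
  rw [moebius, sigmaMatrix, toBlocks_fromBlocks₁₁, toBlocks_fromBlocks₁₂, toBlocks_fromBlocks₂₁,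
    toBlocks_fromBlocks₂₂, hden, hinv, hnum, halfPoint_dualIm, Matrix.mul_smul, Matrix.sub_mul,
    ← Matrix.mul_assoc, Matrix.smul_mul, Matrix.mul_assoc (toC M), ← Matrix.mul_assoc (ofR Y),
    ofR_mul_inv hY, Matrix.one_mul, standardForm_mul_halfDiag, smul_sub, smul_smul, hI]
  module

theorem sigmaMatrix_mem {M : Matrix (Fin g) (Fin g) ℤ} (hM : Mᵀ = M) :
    sigmaMatrix M ∈ SiegelGroup g := by
  rw [SymplecticGroup.mem_iff, sigmaMatrix, Matrix.J, fromBlocks_transpose, fromBlocks_multiply,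
    fromBlocks_multiply]
  congr 1 <;> simp [hM]
  noncomm_ring

end Identities

/-! ### The isomorphism `(𝔄_Ω, E_Ω, -σ_Ω) ≅ (𝔄_Ω', E_Ω', σ_Ω')` -/

theorem mulVec_toC_intCast {g : ℕ} (A : Matrix (Fin g) (Fin g) ℤ) (x : Fin g → ℤ) :
    toC A *ᵥ (fun i => (x i : ℂ)) = fun i => (((A *ᵥ x) i : ℤ) : ℂ) := by
  ext i; simp [mulVec, dotProduct, toC]

theorem mulVec_integral_mem_periodLattice {g : ℕ} (Ω : Matrix (Fin g) (Fin g) ℂ)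
    (P Q : Matrix (Fin g) (Fin g) ℤ) (x : Fin g → ℤ) :
    (Ω * toC P + toC Q) *ᵥ (fun i => (x i : ℂ)) ∈ periodLattice Ω := by
  rw [add_mulVec, ← mulVec_mulVec, mulVec_toC_intCast, mulVec_toC_intCast]
  exact (mem_periodLattice Ω _).2 ⟨_, _, rfl⟩

theorem standardPoint_coe {g lam : ℕ} {i : ZMod 2}
    (Y : {Y : Matrix (Fin g) (Fin g) ℝ // Y.PosDef}) :
    (standardPoint g lam i Y).1 = halfPoint (standardForm g lam i) Y.1 := rfl

/-- `Y ↦ K Y⁻¹ K` on the cone of positive definite matrices. -/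
noncomputable def dualPosDef (g lam : ℕ) (Y : {Y : Matrix (Fin g) (Fin g) ℝ // Y.PosDef}) :
    {Y : Matrix (Fin g) (Fin g) ℝ // Y.PosDef} :=
  ⟨dualIm g lam Y.1, dualIm_posDef Y.2⟩

theorem dualPosDef_coe {g lam : ℕ} (Y : {Y : Matrix (Fin g) (Fin g) ℝ // Y.PosDef}) :
    (dualPosDef g lam Y).1 = dualIm g lam Y.1 := rfl

section Flip

variable {g lam : ℕ} {Y : Matrix (Fin g) (Fin g) ℝ}

theorem flipMatrix_mul_inv (hY : Y.PosDef) :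
    flipMatrix g lam Y * (-(Complex.I • (ofR Y * (1 + toC (headProj g lam))))) = 1 := by
  rw [flipMatrix, ofR_mul, Matrix.mul_neg, Matrix.smul_mul, Matrix.mul_smul, smul_smul,
    Complex.I_mul_I, Matrix.mul_assoc, ← Matrix.mul_assoc (ofR Y⁻¹), ofR_inv_mul hY,
    Matrix.one_mul, halfDiag_mul_one_add]
  simp

theorem flipMatrix_mul_left (h : lam ≤ g) (i : ZMod 2) (hY : Y.PosDef) :
    flipMatrix g lam Y * (halfPoint (standardForm g lam i) Y * toC (-standardForm g lam i) +
      toC 1) = halfPoint (standardForm g lam i) (dualIm g lam Y) := by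
  rw [Matrix.mul_add, ← Matrix.mul_assoc, flipMatrix_mul_halfPoint h i hY, toC_neg, toC_one,
    Matrix.mul_one, Matrix.mul_neg, Matrix.sub_mul, Matrix.mul_assoc, ← toC_mul,
    standardForm_mul_self h, flipMatrix_eq i, Matrix.mul_add]
  noncomm_ring

theorem flipMatrix_mul_right (h : lam ≤ g) (i : ZMod 2) (hY : Y.PosDef) :
    flipMatrix g lam Y * (halfPoint (standardForm g lam i) Y * toC (-(1 + headProj g lam)) +
      toC (standardForm g lam i)) = 1 := by
  have h1 : toC (standardForm g lam i) * toC (headProj g lam) = toC (standardForm g lam i) := by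
    rw [← toC_mul, standardForm_mul_headProj]
  have h2 : toC (headProj g lam) * toC (standardForm g lam i) = toC (standardForm g lam i) := by
    rw [← toC_mul, headProj_mul_standardForm h]
  have h3 : toC (standardForm g lam i) * toC (standardForm g lam i) = toC (headProj g lam) := by
    rw [← toC_mul, standardForm_mul_self h]
  rw [Matrix.mul_add, ← Matrix.mul_assoc, flipMatrix_mul_halfPoint h i hY, toC_neg, toC_add,
    toC_one, flipMatrix_eq i, Matrix.sub_mul _ _ (toC (standardForm g lam i)), Matrix.mul_neg,
    Matrix.sub_mul, Matrix.mul_assoc, Matrix.mul_assoc, Matrix.mul_add, Matrix.add_mul, h1, h2, h3]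
  noncomm_ring

theorem mulVec_flipMatrix_mem_iff (h : lam ≤ g) (i : ZMod 2) (hY : Y.PosDef) (v : CVec g) :
    flipMatrix g lam Y *ᵥ v ∈ periodLattice (halfPoint (standardForm g lam i) (dualIm g lam Y)) ↔
      v ∈ periodLattice (halfPoint (standardForm g lam i) Y) := by
  constructor
  · intro hv
    obtain ⟨a, b, hab⟩ := (mem_periodLattice _ _).1 hv
    rw [← one_mulVec (fun i => (b i : ℂ)), ← flipMatrix_mul_right h i hY,
      ← flipMatrix_mul_left h i hY, ← mulVec_mulVec, ← mulVec_mulVec, ← mulVec_add] at hab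
    have hinj := Matrix.mulVec_injective_of_isUnit
      ((isUnit_iff_isUnit_det _).2
        (isUnit_det_of_right_inverse (flipMatrix_mul_inv (lam := lam) hY)))
    rw [hinj hab]
    exact Submodule.add_mem _ (mulVec_integral_mem_periodLattice _ _ _ _)
      (mulVec_integral_mem_periodLattice _ _ _ _)
  · intro hv
    obtain ⟨x, y, rfl⟩ := (mem_periodLattice _ _).1 hv
    rw [mulVec_add, mulVec_mulVec, flipMatrix_mul_halfPoint h i hY, flipMatrix_eq i,
      show (1 : Matrix (Fin g) (Fin g) ℂ) = toC 1 from toC_one.symm, ← toC_add, sub_eq_add_neg,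
      sub_eq_add_neg, ← toC_neg, ← toC_neg]
    exact Submodule.add_mem _ (mulVec_integral_mem_periodLattice _ _ _ _)
      (mulVec_integral_mem_periodLattice _ _ _ _)

theorem star_mulVec_flipMatrix (v : CVec g) :
    star (flipMatrix g lam Y *ᵥ v) = flipMatrix g lam Y *ᵥ (-star v) := by
  ext j
  simp only [flipMatrix, ofR, mulVec, dotProduct, Pi.star_apply, star_sum, Matrix.smul_apply,
    map_apply, smul_eq_mul, Pi.neg_apply, star_mul', RCLike.star_def, Complex.conj_I,
    Complex.conj_ofReal]
  refine Finset.sum_congr rfl fun k _ => ?_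
  ring

theorem transpose_mul_dualIm_inv_mul (hY : Y.PosDef) :
    (halfDiag g lam * Y⁻¹)ᵀ * (dualIm g lam Y)⁻¹ * (halfDiag g lam * Y⁻¹) = Y⁻¹ := by
  have hK := isUnit_halfDiag_det g lam
  have hYd : IsUnit Y.det := (isUnit_iff_isUnit_det _).1 hY.isUnit
  have hYs : (Y⁻¹)ᵀ = Y⁻¹ := by
    have := hY.inv.isHermitian.eq
    rwa [conjTranspose_eq_transpose_of_trivial] at this
  rw [transpose_mul, hYs, halfDiag_transpose, dualIm, Matrix.mul_inv_rev, Matrix.mul_inv_rev,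
    nonsing_inv_nonsing_inv _ hYd]
  simp only [Matrix.mul_assoc]
  rw [nonsing_inv_mul_cancel_left _ _ hK, mul_nonsing_inv_cancel_left _ _ hK,
    mul_nonsing_inv _ hYd, Matrix.mul_one]

theorem periodForm_flipMatrix (M : Matrix (Fin g) (Fin g) ℤ) (hY : Y.PosDef) (u v : CVec g) :
    periodForm (halfPoint M (dualIm g lam Y)) (flipMatrix g lam Y *ᵥ u)
      (flipMatrix g lam Y *ᵥ v) = periodForm (halfPoint M Y) u v := by
  set W := halfDiag g lam * Y⁻¹ with hW
  have hre : ∀ z : CVec g, (fun j => ((flipMatrix g lam Y *ᵥ z) j).re) =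
      -(W *ᵥ fun j => (z j).im) := by
    intro z; ext j; simp [flipMatrix, ofR, mulVec, dotProduct, ← hW]
  have him : ∀ z : CVec g, (fun j => ((flipMatrix g lam Y *ᵥ z) j).im) =
      W *ᵥ fun j => (z j).re := by
    intro z; ext j; simp [flipMatrix, ofR, mulVec, dotProduct, ← hW]
  have hinv := transpose_mul_dualIm_inv_mul (lam := lam) hY
  rw [← hW] at hinv
  clear_value W
  have hmove : ∀ a b : Fin g → ℝ, (W *ᵥ a) ⬝ᵥ ((dualIm g lam Y)⁻¹ *ᵥ (W *ᵥ b)) =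
      a ⬝ᵥ (Y⁻¹ *ᵥ b) := by
    intro a b
    rw [← hinv, ← mulVec_mulVec,
      ← mulVec_mulVec, dotProduct_mulVec a, vecMul_transpose]
  have hp : ∀ Y', (halfPoint M Y').map Complex.im = Y' := imPart_halfPoint M
  rw [periodForm_apply, periodForm_apply, hp, hp, hre, hre, him, him, neg_dotProduct, mulVec_neg,
    dotProduct_neg, hmove, hmove]
  ring

end Flip

/-- Multiplication by `i K Y⁻¹` is an isomorphism from `(𝔄_Ω, E_Ω, -σ_Ω)`, `Ω = M/2 + iY`, to the
triple of `M/2 + i K Y⁻¹ K`; being `i` times a real matrix, it anticommutes with conjugation. -/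
theorem isIsomorphic_neg_standardPoint {g lam : ℕ} (h : lam ≤ g) (i : ZMod 2)
    (Y : {Y : Matrix (Fin g) (Fin g) ℝ // Y.PosDef}) :
    IsIsomorphic (RealPPAV.ofPeriod (standardPoint g lam i Y)).neg
      (RealPPAV.ofPeriod (standardPoint g lam i (dualPosDef g lam Y))) := by
  obtain ⟨Y, hY⟩ := Y
  have h1 := flipMatrix_mul_inv (lam := lam) hY
  have h2 := mul_eq_one_comm.1 h1
  have hone : ∀ P Q : Matrix (Fin g) (Fin g) ℂ, P * Q = 1 → ∀ z, P *ᵥ (Q *ᵥ z) = z := by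
    intro P Q h z; rw [mulVec_mulVec, h, one_mulVec]
  refine ⟨LinearEquiv.ofLinearMap (flipMatrix g lam Y).mulVecLin (mulVecLin _)
    (LinearMap.ext fun z => hone _ _ h1 z) (LinearMap.ext fun z => hone _ _ h2 z),
    mulVec_flipMatrix_mem_iff h i hY, periodForm_flipMatrix _ hY, fun v w hvw => ?_⟩
  have hmem : -star v - w ∈ periodLattice (halfPoint (standardForm g lam i) Y) := by
    apply sub_mem_of_mkQ_eq
    rw [map_neg]
    exact hvw
  show sigma (standardPoint g lam i (dualPosDef g lam ⟨Y, hY⟩)).2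
      (Submodule.mkQ _ (flipMatrix g lam Y *ᵥ v)) = Submodule.mkQ _ (flipMatrix g lam Y *ᵥ w)
  rw [sigma_mkQ, star_mulVec_flipMatrix, Submodule.mkQ_apply, Submodule.mkQ_apply,
    Submodule.Quotient.eq, ← mulVec_sub]
  exact (mulVec_flipMatrix_mem_iff h i hY _).2 hmem

/-! ### The involution of the moduli space -/

theorem IsIsomorphic.neg {g : ℕ} {A B : RealPPAV g} (h : IsIsomorphic A B) :
    IsIsomorphic A.neg B.neg := by
  obtain ⟨φ, h1, h2, h3⟩ := h
  refine ⟨φ, h1, h2, fun v w hvw => ?_⟩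
  have hvw' : A.real (A.lattice.mkQ v) = A.lattice.mkQ (-w) := by
    rw [map_neg]
    exact neg_eq_iff_eq_neg.1 hvw
  have := h3 v (-w) hvw'
  rw [map_neg, map_neg] at this
  exact neg_eq_iff_eq_neg.2 this

theorem isIsomorphic_neg_neg {g : ℕ} (A : RealPPAV g) : IsIsomorphic A.neg.neg A :=
  ⟨LinearEquiv.refl ℂ _, fun _ => Iff.rfl, fun _ _ => rfl, fun _ _ h =>
    (neg_neg (A.real _)).symm.trans h⟩

/-- `[(𝔄, E, S)] ↦ [(𝔄, E, -S)]` on isomorphism classes. -/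
def IsoClass.neg {g : ℕ} : IsoClass g → IsoClass g :=
  Quotient.map RealPPAV.neg fun _ _ h => IsIsomorphic.neg h

theorem IsoClass.neg_neg {g : ℕ} (c : IsoClass g) : c.neg.neg = c := by
  induction c using Quotient.ind with
  | _ A => exact Quotient.sound (isIsomorphic_neg_neg A)

/-- The involution `Σ` of `𝒳_ℝ^g`, which corresponds to `[(𝔄, E, S)] ↦ [(𝔄, E, -S)]`. -/
noncomputable def sigmaInvolution (g : ℕ) (x : XSpace g) : XSpace g :=
  (Equiv.ofBijective classMap (classMap_bijective g)).symm (classMap x).neg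

theorem classMap_sigmaInvolution {g : ℕ} (x : XSpace g) :
    classMap (sigmaInvolution g x) = (classMap x).neg :=
  Equiv.ofBijective_apply_symm_apply classMap (classMap_bijective g) _

theorem sigmaInvolution_involutive (g : ℕ) : Function.Involutive (sigmaInvolution g) := by
  intro x
  apply classMap_injective
  rw [classMap_sigmaInvolution, classMap_sigmaInvolution, IsoClass.neg_neg]

theorem sigmaInvolution_standardPoint {g lam : ℕ} (h : lam ≤ g) (i : ZMod 2)
    (Y : {Y : Matrix (Fin g) (Fin g) ℝ // Y.PosDef}) :
    sigmaInvolution g (proj (standardPoint g lam i Y)) =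
      proj (standardPoint g lam i (dualPosDef g lam Y)) := by
  apply classMap_injective
  rw [classMap_sigmaInvolution]
  exact Quotient.sound (isIsomorphic_neg_standardPoint h i Y)

theorem sigmaInvolution_image_component {g lam : ℕ} {i : ZMod 2} (h : Admissible g lam i) :
    sigmaInvolution g '' component g lam i = component g lam i := by
  have hsub : sigmaInvolution g '' component g lam i ⊆ component g lam i := by
    rw [component_eq_range h]
    rintro _ ⟨_, ⟨Y, rfl⟩, rfl⟩
    exact ⟨dualPosDef g lam Y, (sigmaInvolution_standardPoint h.1 i Y).symm⟩
  refine hsub.antisymm fun x hx => ?_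
  exact ⟨sigmaInvolution g x, hsub ⟨x, hx, rfl⟩, sigmaInvolution_involutive g x⟩

/-- The determinant of the imaginary part is an invariant of the class, since `det A = ±1` for
`A ∈ GL_g(ℤ)`. -/
theorem det_imPart_eq_of_proj_eq {g : ℕ} {Ω Ω' : HSpace g} (h : proj Ω = proj Ω') :
    (imPart Ω.1).det = (imPart Ω'.1).det := by
  obtain ⟨γ, rfl⟩ := proj_eq_iff.1 h
  rw [coe_smul_eq, imPart_halfPoint, det_mul, det_mul, det_transpose]
  have hu : IsUnit γ.1.1.toBlocks₁₁.det := isUnit_det_of_right_inverse (toBlocks₁₁_right_inv γ)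
  have hdet : (γ.1.1.toBlocks₁₁.map (Int.cast : ℤ → ℝ)).det = (γ.1.1.toBlocks₁₁.det : ℝ) :=
    ((Int.castRingHom ℝ).map_det _).symm
  have hsq : (γ.1.1.toBlocks₁₁.det : ℝ) * γ.1.1.toBlocks₁₁.det = 1 := by
    exact_mod_cast Int.isUnit_mul_self hu
  rw [hdet, mul_right_comm, hsq, one_mul]

/-- The class of `2i·I_g` is not fixed: its image is the class of `(i/2)·I_g`. -/
theorem sigmaInvolution_ne_id {g : ℕ} (hg : 0 < g) : sigmaInvolution g ≠ id := by
  intro hid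
  have hpos : ((2 : ℝ) • (1 : Matrix (Fin g) (Fin g) ℝ)).PosDef :=
    PosDef.one.smul (by norm_num)
  have h := sigmaInvolution_standardPoint (Nat.zero_le g) 1 ⟨_, hpos⟩
  rw [hid, id] at h
  have hdet := det_imPart_eq_of_proj_eq h
  have hinv : ((2 : ℝ) • (1 : Matrix (Fin g) (Fin g) ℝ))⁻¹ = (1 / 2 : ℝ) • 1 := by
    apply inv_eq_right_inv
    rw [Matrix.smul_mul, Matrix.mul_smul, smul_smul, Matrix.one_mul]
    norm_num
  have hK : halfDiag g 0 = 1 := by simp [halfDiag]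
  rw [standardPoint_coe, standardPoint_coe, imPart_halfPoint, imPart_halfPoint, dualPosDef_coe,
    dualIm, hK, hinv, Matrix.one_mul, Matrix.mul_one, det_smul, det_smul, det_one, mul_one, mul_one,
    Fintype.card_fin] at hdet
  have h1 : (1 : ℝ) < 2 ^ g := one_lt_pow₀ (by norm_num) hg.ne'
  have h2 : (1 / 2 : ℝ) ^ g ≤ 1 := pow_le_one₀ (by norm_num) (by norm_num)
  linarith

/-! ### Real analyticity -/

section Analytic

variable {V : Type*} [NormedAddCommGroup V] [NormedSpace ℝ V] {g : ℕ} {z : V}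

theorem analyticAt_det {A : V → Matrix (Fin g) (Fin g) ℝ}
    (hA : ∀ j k, AnalyticAt ℝ (fun v => A v j k) z) : AnalyticAt ℝ (fun v => (A v).det) z := by
  simp only [det_apply]
  refine Finset.analyticAt_fun_sum _ fun τ _ => ?_
  simp only [Units.smul_def, zsmul_eq_mul]
  exact analyticAt_const.mul (Finset.analyticAt_fun_prod _ fun k _ => hA _ _)

theorem analyticAt_inv {A : V → Matrix (Fin g) (Fin g) ℝ}
    (hA : ∀ j k, AnalyticAt ℝ (fun v => A v j k) z) (hz : (A z).det ≠ 0) (j k : Fin g) :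
    AnalyticAt ℝ (fun v => (A v)⁻¹ j k) z := by
  simp only [Matrix.inv_def, Ring.inverse_eq_inv', Matrix.smul_apply, smul_eq_mul, adjugate_apply]
  refine ((analyticAt_det hA).inv hz).mul (analyticAt_det fun l m => ?_)
  simp only [updateRow_apply]
  split_ifs
  · exact analyticAt_const
  · exact hA _ _

theorem analyticAt_mul {A B : V → Matrix (Fin g) (Fin g) ℝ}
    (hA : ∀ j k, AnalyticAt ℝ (fun v => A v j k) z)
    (hB : ∀ j k, AnalyticAt ℝ (fun v => B v j k) z) (j k : Fin g) :
    AnalyticAt ℝ (fun v => (A v * B v) j k) z := by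
  simp only [Matrix.mul_apply]
  exact Finset.analyticAt_fun_sum _ fun l _ => (hA _ _).mul (hB _ _)

end Analytic

/-- The extension of `Ω ↦ M/2 + i K (A (Im Ω) ᵗA)⁻¹ K` to all complex matrices. -/
noncomputable def flipExtension (g lam : ℕ) (i : ZMod 2) (A : Matrix (Fin g) (Fin g) ℝ)
    (Z : Fin g → Fin g → ℂ) : Fin g → Fin g → ℂ :=
  fun j k => halfPoint (standardForm g lam i)
    (dualIm g lam (A * imPart (Matrix.of Z) * Aᵀ)) j k

theorem analyticAt_flipExtension {g lam : ℕ} {i : ZMod 2} {A : Matrix (Fin g) (Fin g) ℝ}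
    {Z : Fin g → Fin g → ℂ} (hZ : (A * imPart (Matrix.of Z) * Aᵀ).det ≠ 0) :
    AnalyticAt ℝ (flipExtension g lam i A) Z := by
  have him : ∀ j k, AnalyticAt ℝ
      (fun Z : Fin g → Fin g → ℂ => imPart (Matrix.of Z) j k) Z := by
    intro j k
    exact (Complex.imCLM.comp ((ContinuousLinearMap.proj (R := ℝ) k).comp
      (ContinuousLinearMap.proj (R := ℝ) (φ := fun _ : Fin g => Fin g → ℂ) j))).analyticAt Z
  have hconst : ∀ (C : Matrix (Fin g) (Fin g) ℝ) (j k),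
      AnalyticAt ℝ (fun _ : Fin g → Fin g → ℂ => C j k) Z := fun _ _ _ => analyticAt_const
  have hdual : ∀ j k, AnalyticAt ℝ (fun Z : Fin g → Fin g → ℂ =>
      dualIm g lam (A * imPart (Matrix.of Z) * Aᵀ) j k) Z :=
    analyticAt_mul (analyticAt_mul (hconst _) (analyticAt_inv
      (analyticAt_mul (analyticAt_mul (hconst _) him) (hconst _)) hZ)) (hconst _)
  refine analyticAt_pi_iff.2 fun j => analyticAt_pi_iff.2 fun k => ?_
  simp only [flipExtension, halfPoint, Matrix.add_apply, Matrix.smul_apply, map_apply]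
  refine analyticAt_const.fun_add (analyticAt_const.fun_smul ?_)
  exact (Complex.ofRealCLM.analyticAt _).comp (hdual j k)

/-- Near each point of `ℋ_g` the involution lifts to a real analytic map of `ℋ_g`. -/
theorem exists_local_lift {g : ℕ} (Ω₀ : HSpace g) :
    ∃ (Ψ : HSpace g → HSpace g) (G : (Fin g → Fin g → ℂ) → Fin g → Fin g → ℂ),
      AnalyticAt ℝ G (fun j k => Ω₀.1 j k) ∧ ContinuousAt Ψ Ω₀ ∧
      (∀ Ω, (fun j k => (Ψ Ω).1 j k) = G fun j k => Ω.1 j k) ∧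
      ∀ᶠ Ω in 𝓝 Ω₀, sigmaInvolution g (proj Ω) = proj (Ψ Ω) := by
  obtain ⟨γ, lam, i, Y, hadm, hγ⟩ := exists_smul_eq_standardPoint Ω₀
  have him : ∀ Ω : HSpace g, imPart (γ • Ω).1 = γ.1.1.toBlocks₁₁.map (Int.cast : ℤ → ℝ) *
      imPart Ω.1 * (γ.1.1.toBlocks₁₁.map (Int.cast : ℤ → ℝ))ᵀ := fun Ω => by
    rw [coe_smul_eq, imPart_halfPoint]
  let Ψ : HSpace g → HSpace g := fun Ω =>
    standardPoint g lam i (dualPosDef g lam ⟨imPart (γ • Ω).1, (γ • Ω).2.2.1⟩)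
  have hΨ : ∀ Ω, (fun j k => (Ψ Ω).1 j k) = flipExtension g lam i
      (γ.1.1.toBlocks₁₁.map (Int.cast : ℤ → ℝ)) fun j k => Ω.1 j k := by
    intro Ω
    ext j k
    show halfPoint (standardForm g lam i) (dualIm g lam (imPart (γ • Ω).1)) j k = _
    rw [him]
    rfl
  have hG : AnalyticAt ℝ (flipExtension g lam i (γ.1.1.toBlocks₁₁.map (Int.cast : ℤ → ℝ)))
      (fun j k => Ω₀.1 j k) := by
    apply analyticAt_flipExtension
    change (_ * imPart Ω₀.1 * _).det ≠ 0
    rw [← him]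
    exact (isUnit_im_det (γ • Ω₀).2).ne_zero
  refine ⟨Ψ, _, hG, ?_, hΨ, ?_⟩
  · rw [Topology.IsInducing.subtypeVal.continuousAt_iff]
    have h1 : (Subtype.val ∘ Ψ : HSpace g → Matrix (Fin g) (Fin g) ℂ) =
        flipExtension g lam i (γ.1.1.toBlocks₁₁.map (Int.cast : ℤ → ℝ)) ∘
          (Subtype.val : HSpace g → Matrix (Fin g) (Fin g) ℂ) := funext fun Ω => hΨ Ω
    rw [h1]
    exact ContinuousAt.comp (f := (Subtype.val : HSpace g → Matrix (Fin g) (Fin g) ℂ))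
      hG.continuousAt continuous_subtype_val.continuousAt
  · filter_upwards [eventually_twoRe_eq Ω₀] with Ω hΩ
    have hstd : γ • Ω = standardPoint g lam i ⟨imPart (γ • Ω).1, (γ • Ω).2.2.1⟩ := by
      apply Subtype.ext
      have h2 : twoRe (γ • Ω).1 = standardForm g lam i := by
        rw [twoRe_smul, hΩ, ← twoRe_smul, hγ, standardPoint_coe, twoRe_halfPoint]
      rw [standardPoint_coe, ← h2]
      exact eq_halfPoint _
    rw [← proj_smul γ, hstd, sigmaInvolution_standardPoint hadm.1]

theorem sigmaInvolution_isRealAnalytic (g : ℕ) : IsRealAnalytic (sigmaInvolution g) := by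
  constructor
  · have hq : Topology.IsQuotientMap (proj : HSpace g → XSpace g) := isQuotientMap_quotient_mk'
    rw [hq.continuous_iff, continuous_iff_continuousAt]
    intro Ω₀
    obtain ⟨Ψ, G, -, hΨ, -, hev⟩ := exists_local_lift Ω₀
    exact (continuous_proj.continuousAt.comp hΨ).congr (hev.mono fun Ω h => h.symm)
  · intro U _ f hf Ω₀ hΩ₀
    obtain ⟨Ψ, G, hG, hΨ, hΨG, hev⟩ := exists_local_lift Ω₀
    have hmem : proj (Ψ Ω₀) ∈ U := hev.self_of_nhds ▸ hΩ₀
    obtain ⟨H, hH, hfH⟩ := hf (Ψ Ω₀) hmem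
    rw [hΨG] at hH
    refine ⟨H ∘ G, hH.comp hG, ?_⟩
    filter_upwards [hev, hΨ.eventually hfH] with Ω h1 h2
    rw [Function.comp_apply, h1, h2, hΨG]
    rfl

end RealModuli

theorem proposition4p1 (g : ℕ) (hg : 0 < g) :
    -- `𝒳_ℝ^g` classifies the triples `(𝔄, E, S)` up to real isomorphism
    Function.Bijective (classMap : XSpace g → IsoClass g) ∧
    ∃ T : XSpace g → XSpace g,
      -- `T [(𝔄, E, S)] = [(𝔄, E, -S)]`
      (∀ (x : XSpace g) (A : RealPPAV g),
        classMap x = IsoClass.mk A → classMap (T x) = IsoClass.mk A.neg) ∧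
      -- `T` is a (non-trivial) real analytic involution
      IsRealAnalytic T ∧ Function.Involutive T ∧ T ≠ id ∧
      -- `T` maps each connected component `𝒳_(λ,i)^g` onto itself
      (∀ (lam : ℕ) (i : ZMod 2), Admissible g lam i →
        (∃ x, connectedComponent x = component g lam i) ∧
        T '' component g lam i = component g lam i) ∧
      (∀ x, T '' connectedComponent x = connectedComponent x) ∧
      -- the explicit formula on the representatives `M/2 + iY`
      (∀ (lam : ℕ) (i : ZMod 2), Admissible g lam i →
        ∀ Y : Matrix (Fin g) (Fin g) ℝ, Y.PosDef →
          sigmaMatrix (standardForm g lam i) ∈ SiegelGroup g ∧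
          moebius (sigmaMatrix (standardForm g lam i)) (halfPoint (standardForm g lam i) Y) =
            halfPoint (standardForm g lam i) (halfDiag g lam * Y⁻¹ * halfDiag g lam) ∧
          ∃ (h : halfPoint (standardForm g lam i) Y ∈ HSet g)
            (h' : moebius (sigmaMatrix (standardForm g lam i))
              (halfPoint (standardForm g lam i) Y) ∈ HSet g),
            proj ⟨_, h⟩ ∈ component g lam i ∧ T (proj ⟨_, h⟩) = proj ⟨_, h'⟩) := by

  refine ⟨classMap_bijective g, sigmaInvolution g, fun x A h => ?_,
    sigmaInvolution_isRealAnalytic g, sigmaInvolution_involutive g, sigmaInvolution_ne_id hg,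
    fun lam i hadm => ⟨?_, sigmaInvolution_image_component hadm⟩, fun x => ?_,
    fun lam i hadm Y hY => ⟨sigmaMatrix_mem (standardForm_transpose g lam i),
      moebius_sigmaMatrix hadm.1 i hY, (standardPoint g lam i ⟨Y, hY⟩).2, ?_, ?_, ?_⟩⟩
  · rw [classMap_sigmaInvolution, h]
    rfl
  · exact ⟨proj (standardPoint g lam i ⟨1, Matrix.PosDef.one⟩),
      connectedComponent_eq_component hadm (proj_mem_component.2 (hasInvariants_halfPoint hadm _))⟩
  · obtain ⟨lam, i, hadm, hx⟩ := exists_mem_component x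
    rw [connectedComponent_eq_component hadm hx, sigmaInvolution_image_component hadm]
  · rw [moebius_sigmaMatrix hadm.1 i hY]
    exact halfPoint_mem (standardForm_transpose g lam i) (dualIm_posDef hY)
  · exact proj_mem_component.2 (hasInvariants_halfPoint hadm _)
  · refine (sigmaInvolution_standardPoint hadm.1 i ⟨Y, hY⟩).trans (congrArg proj (Subtype.ext ?_))
    exact (moebius_sigmaMatrix hadm.1 i hY).symm
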